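/- Let $\mathbb N=\{0,1,2,\dots\}$. Consider the following three classes of functions $f:\mathbb N\to\mathbb N$. **Tile counting functions $\mathcal F$.** A *tile* is an axis-parallel simply connected closed polygon in $\mathbb R^2$ (the closed region bounded by a simple closed polygonal curve with axis-parallel edges); it is *tall* if it has height $1$. A *tiling* of a region $\Gamma\subset\mathbb R^2$ with a set $T$ of tiles is a collection of translates of tiles in $T$ with pairwise disjoint interiors and with union $\Gamma$. A function $f$ belongs to $\mathcal F$ if there are a finite set $T$ of tall tiles and a real number $\varepsilon\ge 0$ such that, for every $n\in\mathbb N$, $f(n)$ is the number of tilings with $T$ of the rectangle of height $1$ and length $n+\varepsilon$ (the rectangle of length $0$ is regarded as the empty region, with exactly one tiling, the empty one). **Diagonals $\mathcal D$.** For $k\ge 1$ let $\mathcal R_k$ be the smallest class of formal power series in $x_1,\dots,x_k$ such that (1) $0,x_1,\dots,x_k\in\mathcal R_k$; (2) if $F,G\in\mathcal R_k$ then $F+G,\ F\cdot G\in\mathcal R_k$; (3) if $F\in\mathcal R_k$ has zero constant term then $\frac1{1-F}\in\mathcal R_k$. A function $f$ belongs to $\mathcal D$ if there are $k\ge1$ and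 $G\in\mathcal R_k$ such that $f(n)=[x_1^n\cdots x_k^n]\,G$ for all $n\in\mathbb N$. **Binomial multisums $\mathcal B$.** For $a,b\in\mathbb Z$ let $\binom ab=\frac{a!}{b!\,(a-b)!}$ if $0\le b\le a$, let $\binom{-1}{0}=1$, and let $\binom ab=0$ otherwise. A function $f$ belongs to $\mathcal B$ if there are $r,d\in\mathbb N$ and functions $\alpha_i(v,n)=\mathbf a_i\cdot v+a_i'n+a_i''$ and $\beta_i(v,n)=\mathbf b_i\cdot v+b_i'n+b_i''$, $1\le i\le r$, with $\mathbf a_i,\mathbf b_i\in\mathbb Z^d$ and $a_i',a_i'',b_i',b_i''\in\mathbb Z$, such that for all $n\in\mathbb N$ $$f(n)=\sum_{v\in\mathbb Z^d}\ \prod_{i=1}^r\binom{\alpha_i(v,n)}{\beta_i(v,n)},$$ where for every $n$ only finitely many summands are nonzero. Then $\mathcal F=\mathcal D=\mathcal B$, and each of these classes is closed under pointwise addition and pointwise multiplication: if $f$ and $g$ belong to the class, then so do $n\mapsto f(n)+g(n)$ and $n\mapsto f(n)\,g(n)$. -/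

import Mathlib

namespace IrrationalTiling

/-! ### Tile counting functions -/

/-- An axis-parallel closed polygonal region in the plane `ℝ × ℝ`: a finite union of closed
axis-parallel rectangles `[b₁, b₂]` with nonempty interior. -/
def IsAxisParallelRegion (K : Set (ℝ × ℝ)) : Prop :=
  ∃ s : Finset ((ℝ × ℝ) × (ℝ × ℝ)),
    (∀ b ∈ s, b.1.1 < b.2.1 ∧ b.1.2 < b.2.2) ∧ K = ⋃ b ∈ s, Set.Icc b.1 b.2

/-- A tile: an axis-parallel simply connected closed polygon. For a finite union of rectangles,
being simply connected and having connected interior together say that it is a closed topological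
disc, i.e. the closed region bounded by a simple closed axis-parallel polygonal curve (two squares
sharing only a corner are excluded by the second condition). -/
structure IsTile (K : Set (ℝ × ℝ)) : Prop where
  region : IsAxisParallelRegion K
  simplyConnected : IsSimplyConnected K
  interior_connected : IsConnected (interior K)

/-- A tile is tall if its height is exactly `1`. -/
def IsTall (K : Set (ℝ × ℝ)) : Prop :=
  ∃ c : ℝ, Prod.snd '' K = Set.Icc c (c + 1)

/-- The translate of `K` by the vector `v`. -/
def translate (v : ℝ × ℝ) (K : Set (ℝ × ℝ)) : Set (ℝ × ℝ) :=
  (fun p => v + p) '' K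

/-- `P` is a tiling of the region `Γ` with the set of tiles `T`: a collection of translates of
tiles in `T` whose interiors are pairwise disjoint and whose union is `Γ`. -/
structure IsTiling (T : Set (Set (ℝ × ℝ))) (Γ : Set (ℝ × ℝ)) (P : Set (Set (ℝ × ℝ))) : Prop where
  pieces : ∀ K ∈ P, ∃ τ ∈ T, ∃ v : ℝ × ℝ, K = translate v τ
  nonoverlapping : ∀ K ∈ P, ∀ L ∈ P, K ≠ L → Disjoint (interior K) (interior L)
  covers : ⋃₀ P = Γ

/-- The rectangle of height `1` and length `a`. The degenerate rectangle of length `0` is the empty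
region (an empty union of polygons), so that it has exactly one tiling, the empty one. -/
noncomputable def rectangle (a : ℝ) : Set (ℝ × ℝ) :=
  open Classical in if 0 < a then Set.Icc 0 a ×ˢ Set.Icc 0 1 else ∅

/-- The class `F` of tile counting functions: `f n` is the number of tilings of the rectangle of
height `1` and length `n + ε` with a fixed finite set `T` of tall tiles, for a fixed `ε ≥ 0`. -/
def tileCountingFunctions : Set (ℕ → ℕ) :=
  {f | ∃ (T : Set (Set (ℝ × ℝ))) (ε : ℝ),
    T.Finite ∧ (∀ τ ∈ T, IsTile τ ∧ IsTall τ) ∧ 0 ≤ ε ∧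
      ∀ n : ℕ, {P | IsTiling T (rectangle (n + ε)) P}.encard = (f n : ℕ∞)}

/-! ### Diagonals of `ℕ`-rational generating functions -/

/-- The class `R_k` of `ℕ`-rational generating functions in `k` variables: the smallest class of
power series containing `0` and the variables, closed under sums and products, and containing
`G = 1 / (1 - F)` whenever it contains `F` and `F` has zero constant term. -/
inductive IsNRational {k : ℕ} : MvPowerSeries (Fin k) ℤ → Prop
  | zero : IsNRational 0
  | var (i : Fin k) : IsNRational (MvPowerSeries.X i)
  | add {F G : MvPowerSeries (Fin k) ℤ} :
      IsNRational F → IsNRational G → IsNRational (F + G)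
  | mul {F G : MvPowerSeries (Fin k) ℤ} :
      IsNRational F → IsNRational G → IsNRational (F * G)
  | inv_one_sub {F G : MvPowerSeries (Fin k) ℤ} :
      IsNRational F → MvPowerSeries.constantCoeff F = 0 → (1 - F) * G = 1 → IsNRational G

/-- The class `D` of diagonals `f n = [x₁ⁿ ⋯ x_kⁿ] G` of `ℕ`-rational generating functions `G` in
`k ≥ 1` variables. -/
def diagonals : Set (ℕ → ℕ) :=
  {f | ∃ (k : ℕ) (G : MvPowerSeries (Fin k) ℤ), 1 ≤ k ∧ IsNRational G ∧
    ∀ n : ℕ, MvPowerSeries.coeff (Finsupp.equivFunOnFinite.symm fun _ => n) G = (f n : ℤ)}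

/-! ### Binomial multisums -/

/-- Binomial coefficients extended to all integers, with value `1` at `(-1, 0)` and value `0` at all
other pairs that do not satisfy `0 ≤ b ≤ a`. -/
def binom (a b : ℤ) : ℕ :=
  if 0 ≤ b ∧ b ≤ a then a.toNat.choose b.toNat
  else if a = -1 ∧ b = 0 then 1 else 0

/-- An affine function `(v, n) ↦ c · v + c' n + c''` on `ℤ^d × ℕ` with integer coefficients. -/
structure AffineForm (d : ℕ) where
  lin : Fin d → ℤ
  coeffN : ℤ
  const : ℤ

/-- The value of an affine function at `(v, n)`. -/
def AffineForm.eval {d : ℕ} (α : AffineForm d) (v : Fin d → ℤ) (n : ℕ) : ℤ :=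
  (∑ j, α.lin j * v j) + α.coeffN * n + α.const

/-- The class `B` of binomial multisums: functions `f : ℕ → ℕ` such that
`f n = ∑_{v ∈ ℤ^d} ∏_{i < r} binom (α_i (v, n)) (β_i (v, n))`, where for every `n` only finitely
many summands are nonzero. -/
def binomialMultisums : Set (ℕ → ℕ) :=
  {f | ∃ (r d : ℕ) (α β : Fin r → AffineForm d), ∀ n : ℕ,
    (Function.support fun v : Fin d → ℤ =>
      ∏ i, binom ((α i).eval v n) ((β i).eval v n)).Finite ∧
    ∑ᶠ v : Fin d → ℤ, ∏ i, binom ((α i).eval v n) ((β i).eval v n) = f n}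

/-- A class of functions `ℕ → ℕ` is closed under pointwise addition and multiplication. -/
def ClosedUnderAddMul (C : Set (ℕ → ℕ)) : Prop :=
  ∀ f ∈ C, ∀ g ∈ C, (fun n => f n + g n) ∈ C ∧ (fun n => f n * g n) ∈ C

end IrrationalTiling

/-! Cutting along lower and left boundaries turns a tiling of a strip into a partition into
half-open tiles. A tile of a partition is determined by the leftmost bottom point that it covers
and its shape, and the region that remains to its right has only finitely many shapes, so tilings
are walks in a finite directed graph with real edge lengths. Expanding the lengths in positive
rational coordinates with respect to a family independent over `ℚ`, walks of a given length are
counted by a coefficient of a system of `ℕ`-rational series in which carries make the exponents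
integral, hence by a diagonal. Coefficients of `ℕ`-rational series are binomial multisums by
induction over the construction of the series. Conversely, a product of binomial coefficients
counts families of lattice paths; lengths in general position force the numbers of steps of a walk
of given length to solve the linear equations between the arguments, and Gordan's theorem makes
these lengths positive because the multisum is finite. Such a graph is realized by tiles whose
sides have a step that encodes the vertices, and an edge from the last vertex to the first, of a
length `ε` outside the rational span of all other lengths, turns walks between two vertices into
closed walks, that is, tilings of a rectangle. -/

open Filter
open scoped ENNReal Topology

namespace IrrationalTiling

/-! ### Positive coordinates over the rationals -/

section PositiveCoordinates

variable {ι : Type*} [Fintype ι] {u : ι → ℝ}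

theorem exists_rat_forall_mul_lt {κ : Type*} (X : Finset κ) (a b : κ → ℝ)
    (hb : ∀ x ∈ X, 0 < b x) : ∃ δ : ℚ, 0 < δ ∧ ∀ x ∈ X, δ * a x < b x := by
  have hsmall : ∀ᶠ δ : ℝ in 𝓝[>] 0, ∀ x ∈ X, δ * a x < b x := by
    refine (Finset.eventually_all X).mpr fun x hx => ?_
    have hlim : Tendsto (fun δ : ℝ => δ * a x) (𝓝[>] 0) (𝓝 0) :=
      ((continuous_mul_const (a x)).tendsto' 0 0 (zero_mul _)).mono_left nhdsWithin_le_nhds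
    exact hlim.eventually_lt_const (hb x hx)
  obtain ⟨ε, hε, hεX⟩ := mem_nhdsGT_iff_exists_Ioo_subset.mp hsmall
  obtain ⟨δ, hδ, hδε⟩ := exists_rat_btwn (Set.mem_Ioi.mp hε)
  exact ⟨δ, by exact_mod_cast hδ, hεX ⟨hδ, hδε⟩⟩

theorem linearIndependent_of_mem_span {κ K V : Type*} [Finite κ] [DivisionRing K]
    [AddCommGroup V] [Module K V] {u v : κ → V} (hu : LinearIndependent K u)
    (h : ∀ i, u i ∈ Submodule.span K (Set.range v)) : LinearIndependent K v := by
  have := Fintype.ofFinite κ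
  rw [linearIndependent_iff_card_le_finrank_span, ← finrank_span_eq_card hu]
  have := FiniteDimensional.span_of_finite K (Set.finite_range v)
  exact Submodule.finrank_mono (Submodule.span_le.mpr (Set.range_subset_iff.mpr h))

theorem exists_eq_mul_sum_add_mul (u : ι → ℝ) {q : ι → ℝ} {δ : ℝ} (hδ : 0 < δ)
    (hq : ∀ i, 0 < q i) : ∃ v : ι → ℝ, ∀ j, u j = q j * ∑ i, v i + δ * v j := by
  have hden : 0 < δ + ∑ i, q i := add_pos_of_pos_of_nonneg hδ
    (Finset.sum_nonneg fun i _ => (hq i).le)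
  set s : ℝ := (∑ i, u i) / (δ + ∑ i, q i)
  have hsum : ∑ i, (u i - s * q i) / δ = s := by
    rw [← Finset.sum_div, Finset.sum_sub_distrib, ← Finset.mul_sum, div_eq_iff hδ.ne']
    linear_combination -(div_mul_cancel₀ (∑ i, u i) hden.ne')
  refine ⟨fun i => (u i - s * q i) / δ, fun j => ?_⟩
  rw [hsum, mul_div_cancel₀ _ hδ.ne']
  ring

/- For rational `q j` slightly below `u j` and a small rational `δ`, let `v` be the family with
`u j = q j * ∑ i, v i + δ * v j`. The coefficients `∑ j, c j * q j + δ * c i` of `∑ j, c j * u j`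
in the family `v` are close to the positive number `∑ j, c j * u j`. -/
theorem exists_pos_coordinates (hu : ∀ i, 0 < u i) (hli : LinearIndependent ℚ u)
    (X : Finset (ι → ℚ)) (hX : ∀ c ∈ X, 0 < ∑ i, (c i : ℝ) * u i) :
    ∃ v : ι → ℝ, LinearIndependent ℚ v ∧ ∀ c ∈ X, ∃ r : ι → ℚ,
      (∀ i, 0 < r i) ∧ ∑ i, (c i : ℝ) * u i = ∑ i, (r i : ℝ) * v i := by
  obtain ⟨δ, hδ, hδX⟩ := exists_rat_forall_mul_lt X
    (fun c => 2 * ∑ i, |(c i : ℝ)|) (fun c => ∑ i, (c i : ℝ) * u i) hX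
  have hδR : (0 : ℝ) < δ := by exact_mod_cast hδ
  have hnear j : ∃ q : ℚ, max 0 (u j - δ) < q ∧ (q : ℝ) < u j :=
    exists_rat_btwn (max_lt (hu j) (sub_lt_self _ hδR))
  choose q hq hqu using hnear
  obtain ⟨v, huv⟩ := exists_eq_mul_sum_add_mul u hδR fun i => (le_max_left _ _).trans_lt (hq i)
  refine ⟨v, linearIndependent_of_mem_span hli fun j => ?_, fun c hc =>
    ⟨fun i => ∑ j, c j * q j + δ * c i, fun i => ?_, ?_⟩⟩
  · have hmem i : v i ∈ Submodule.span ℚ (Set.range v) := Submodule.subset_span ⟨i, rfl⟩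
    rw [huv j]
    simp only [← Rat.smul_def]
    exact add_mem (Submodule.smul_mem _ _ (sum_mem fun i _ => hmem i))
      (Submodule.smul_mem _ _ (hmem j))
  · have herr : ∑ j, (c j : ℝ) * (u j - q j) ≤ δ * ∑ j, |(c j : ℝ)| := by
      rw [Finset.mul_sum]
      refine Finset.sum_le_sum fun j _ => ?_
      calc (c j : ℝ) * (u j - q j) ≤ |(c j : ℝ)| * (u j - q j) :=
            mul_le_mul_of_nonneg_right (le_abs_self _) (sub_nonneg.mpr (hqu j).le)
        _ ≤ |(c j : ℝ)| * δ := mul_le_mul_of_nonneg_left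
            (by linarith [(max_lt_iff.mp (hq j)).2]) (abs_nonneg _)
        _ = δ * |(c j : ℝ)| := mul_comm _ _
    have hci : -(δ * c i) ≤ δ * ∑ j, |(c j : ℝ)| := by
      rw [← mul_neg]
      exact mul_le_mul_of_nonneg_left ((neg_le_abs _).trans (Finset.single_le_sum
        (f := fun j => |(c j : ℝ)|) (fun _ _ => abs_nonneg _) (Finset.mem_univ i))) hδR.le
    have hpos : (0 : ℝ) < ∑ j, (c j : ℝ) * q j + δ * c i := by
      have := hδX c hc
      simp only [mul_sub, Finset.sum_sub_distrib] at herr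
      linarith
    exact_mod_cast hpos
  · calc ∑ j, (c j : ℝ) * u j = ∑ j, ((c j * q j) * ∑ i, v i + δ * c j * v j) :=
          Finset.sum_congr rfl fun j _ => by rw [huv j]; ring
      _ = ∑ i, ((∑ j, c j * q j + δ * c i : ℚ) : ℝ) * v i := by
          push_cast
          simp only [add_mul, Finset.sum_add_distrib, ← Finset.mul_sum, ← Finset.sum_mul]

end PositiveCoordinates

theorem exists_linearIndependent_pos_coordinates (X : Finset ℝ) (hX : ∀ x ∈ X, 0 < x) :
    ∃ (k : ℕ) (v : Fin k → ℝ), LinearIndependent ℚ v ∧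
      ∀ x ∈ X, ∃ r : Fin k → ℚ, (∀ i, 0 < r i) ∧ x = ∑ i, (r i : ℝ) * v i := by
  classical
  obtain ⟨b, hbX, hspan, hli⟩ := exists_linearIndependent ℚ (X : Set ℝ)
  have := (X.finite_toSet.subset hbX).fintype
  let e := Fintype.equivFin b
  have hcoord : ∀ x ∈ X, ∃ c : Fin (Fintype.card b) → ℚ,
      ∑ i, (c i : ℝ) * (e.symm i : ℝ) = x := fun x hx => by
    have hmem : x ∈ Submodule.span ℚ (Set.range fun i => (e.symm i : ℝ)) := by
      change x ∈ Submodule.span ℚ (Set.range (Subtype.val ∘ e.symm))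
      rw [e.symm.surjective.range_comp, Subtype.range_coe, hspan]
      exact Submodule.subset_span hx
    simpa only [Rat.smul_def] using (Submodule.mem_span_range_iff_exists_fun ℚ).mp hmem
  choose! c hc using hcoord
  obtain ⟨v, hvli, hvX⟩ := exists_pos_coordinates (fun i => hX _ (hbX (e.symm i).2))
    (hli.comp e.symm e.symm.injective) (X.image c) fun _ h => by
      obtain ⟨x, hx, rfl⟩ := Finset.mem_image.mp h
      simpa only [Function.comp_apply, hc x hx] using hX x hx
  refine ⟨_, v, hvli, fun x hx => ?_⟩
  obtain ⟨r, hr, hrx⟩ := hvX (c x) (Finset.mem_image_of_mem c hx)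
  exact ⟨r, hr, (hc x hx).symm.trans hrx⟩

theorem exists_common_denominator {κ : Type*} (X : Finset κ) (r : κ → ℚ) :
    ∃ M : ℕ, 0 < M ∧ ∀ x ∈ X, 0 ≤ r x → ∃ a : ℕ, r x * M = a := by
  refine ⟨∏ x ∈ X, (r x).den, Finset.prod_pos fun x _ => (r x).pos, fun x hx hr => ?_⟩
  obtain ⟨d, hd⟩ := Finset.dvd_prod_of_mem (fun x => (r x).den) hx
  refine ⟨(r x).num.toNat * d, ?_⟩
  have hnum : ((r x).num.toNat : ℚ) = (r x).num := by
    exact_mod_cast Int.toNat_of_nonneg (Rat.num_nonneg.mpr hr)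
  rw [hd, Nat.cast_mul, Nat.cast_mul, hnum, ← mul_assoc, Rat.mul_den_eq_num]

theorem exists_linearIndependent_nat_coordinates (X : Finset ℝ) (hX : ∀ x ∈ X, 0 ≤ x) :
    ∃ (k : ℕ) (v : Fin k → ℝ) (M : ℕ), 0 < M ∧ LinearIndependent ℚ v ∧
      ∑ i, v i = 1 ∧ ∀ x ∈ X, ∃ a : Fin k → ℕ, x * M = ∑ i, a i * v i := by
  classical
  obtain ⟨k, w, hli, hwX⟩ := exists_linearIndependent_pos_coordinates
    (insert 1 (X.filter (0 < ·))) (by simp)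
  obtain ⟨s, hs, hs1⟩ := hwX 1 (Finset.mem_insert_self _ _)
  have hcoord : ∀ x ∈ X, ∃ r : Fin k → ℚ, (∀ i, 0 ≤ r i) ∧ x = ∑ i, (r i : ℝ) * w i := by
    intro x hx
    rcases (hX x hx).eq_or_lt with rfl | hpos
    · exact ⟨0, fun _ => le_rfl, by simp⟩
    · obtain ⟨r, hr, hxr⟩ := hwX x (by simp [hx, hpos])
      exact ⟨r, fun i => (hr i).le, hxr⟩
  choose! r hr hxr using hcoord
  obtain ⟨M, hM, hden⟩ := exists_common_denominator (X ×ˢ Finset.univ) fun p => r p.1 p.2 / s p.2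
  refine ⟨k, fun i => s i * w i, M, hM, ?_, hs1.symm, fun x hx => ?_⟩
  · convert hli.units_smul fun i => Units.mk0 (s i) (hs i).ne' using 1
    ext i
    simp [Units.smul_def, Rat.smul_def]
  · choose a ha using fun i => hden (x, i) (Finset.mk_mem_product hx (Finset.mem_univ i))
      (div_nonneg (hr x hx i) (hs i).le)
    refine ⟨a, ?_⟩
    conv_lhs => rw [hxr x hx, Finset.sum_mul]
    refine Finset.sum_congr rfl fun i _ => ?_
    have hsi : (s i : ℝ) ≠ 0 := by exact_mod_cast (hs i).ne'
    have hai : (r x i : ℝ) / s i * M = a i := by exact_mod_cast ha i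
    rw [← hai]
    field_simp

/-! ### `ℕ`-rational series -/

section NRational

variable {k : ℕ} {F : MvPowerSeries (Fin k) ℤ}

theorem isNRational_one : IsNRational (1 : MvPowerSeries (Fin k) ℤ) :=
  IsNRational.inv_one_sub .zero (map_zero _) (by rw [sub_zero, mul_one])

theorem IsNRational.pow (hF : IsNRational F) (n : ℕ) : IsNRational (F ^ n) := by
  induction n with
  | zero => simpa using isNRational_one
  | succ n ih => rw [pow_succ]; exact ih.mul hF

theorem isNRational_sum {ι : Type*} (s : Finset ι) (F : ι → MvPowerSeries (Fin k) ℤ)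
    (hF : ∀ i ∈ s, IsNRational (F i)) : IsNRational (∑ i ∈ s, F i) :=
  Finset.sum_induction F IsNRational (fun _ _ => .add) .zero hF

theorem isNRational_prod {ι : Type*} (s : Finset ι) (F : ι → MvPowerSeries (Fin k) ℤ)
    (hF : ∀ i ∈ s, IsNRational (F i)) : IsNRational (∏ i ∈ s, F i) :=
  Finset.prod_induction F IsNRational (fun _ _ => .mul) isNRational_one hF

theorem isNRational_monomial (c : Fin k →₀ ℕ) :
    IsNRational (MvPowerSeries.monomial c (1 : ℤ)) := by
  have h : MvPowerSeries.monomial c (1 : ℤ) = ∏ i, MvPowerSeries.X i ^ c i := by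
    simp_rw [MvPowerSeries.X_pow_eq]
    rw [MvPowerSeries.prod_monomial, Finset.prod_const_one, Finsupp.univ_sum_single]
  rw [h]
  exact isNRational_prod _ _ fun i _ => (IsNRational.var i).pow _

theorem IsNRational.exists_inv_one_sub (hF : IsNRational F)
    (h0 : MvPowerSeries.constantCoeff F = 0) : ∃ S, IsNRational S ∧ (1 - F) * S = 1 := by
  have hunit : IsUnit (1 - F) := by
    rw [MvPowerSeries.isUnit_iff_constantCoeff]
    simp [h0]
  obtain ⟨S, hS⟩ := hunit.exists_right_inv
  exact ⟨S, .inv_one_sub hF h0 hS, hS⟩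

/-- The series `y i`, `i ∈ s`, solve the linear system `y i = ∑ j ∈ s, M i j * y j + g i` with
`ℕ`-rational coefficients, and the rank `ρ` increases strictly along the entries of `M` with nonzero
constant term, so that `1 - M` is invertible. -/
structure IsRankedSystem {ι α : Type*} [Preorder α] (ρ : ι → α) (s : Finset ι)
    (M : ι → ι → MvPowerSeries (Fin k) ℤ) (g y : ι → MvPowerSeries (Fin k) ℤ) : Prop where
  matrix : ∀ i ∈ s, ∀ j ∈ s, IsNRational (M i j)
  inhomogeneity : ∀ i ∈ s, IsNRational (g i)
  rank_lt : ∀ i ∈ s, ∀ j ∈ s, MvPowerSeries.constantCoeff (M i j) ≠ 0 → ρ i < ρ j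
  eq : ∀ i ∈ s, y i = ∑ j ∈ s, M i j * y j + g i

section RankedSystem

variable {ι α : Type*} [DecidableEq ι] [Preorder α] {ρ : ι → α} {s : Finset ι} {a : ι}
  {M : ι → ι → MvPowerSeries (Fin k) ℤ} {g y : ι → MvPowerSeries (Fin k) ℤ}
  {S : MvPowerSeries (Fin k) ℤ}

theorem IsRankedSystem.eq_inv_mul (h : IsRankedSystem ρ (insert a s) M g y) (ha : a ∉ s)
    (hS : (1 - M a a) * S = 1) : y a = S * (∑ j ∈ s, M a j * y j + g a) := by
  have hya := h.eq a (Finset.mem_insert_self a s)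
  rw [Finset.sum_insert ha] at hya
  linear_combination (-y a) * hS + S * hya

theorem IsRankedSystem.eliminate (h : IsRankedSystem ρ (insert a s) M g y) (ha : a ∉ s)
    (hS : (1 - M a a) * S = 1) (hSr : IsNRational S) :
    IsRankedSystem ρ s (fun i j => M i j + M i a * S * M a j) (fun i => g i + M i a * S * g a)
      y := by
  have ma := Finset.mem_insert_self a s
  have ms {i} (hi : i ∈ s) : i ∈ insert a s := Finset.mem_insert_of_mem hi
  refine ⟨fun i hi j hj => ?_, fun i hi => ?_, fun i hi j hj hij => ?_, fun i hi => ?_⟩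
  · exact (h.matrix i (ms hi) j (ms hj)).add
      (((h.matrix i (ms hi) a ma).mul hSr).mul (h.matrix a ma j (ms hj)))
  · exact (h.inhomogeneity i (ms hi)).add
      (((h.matrix i (ms hi) a ma).mul hSr).mul (h.inhomogeneity a ma))
  · by_cases h0 : MvPowerSeries.constantCoeff (M i j) = 0
    · rw [map_add, h0, zero_add, map_mul, map_mul] at hij
      exact (h.rank_lt i (ms hi) a ma (left_ne_zero_of_mul (left_ne_zero_of_mul hij))).trans
        (h.rank_lt a ma j (ms hj) (right_ne_zero_of_mul hij))
    · exact h.rank_lt i (ms hi) j (ms hj) h0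
  · have hyi := h.eq i (ms hi)
    rw [Finset.sum_insert ha, h.eq_inv_mul ha hS] at hyi
    rw [hyi]
    simp only [add_mul, Finset.sum_add_distrib, mul_add, Finset.mul_sum, mul_assoc]
    ring

end RankedSystem

theorem IsRankedSystem.isNRational {ι α : Type*} [Preorder α] {ρ : ι → α} {s : Finset ι}
    {M : ι → ι → MvPowerSeries (Fin k) ℤ} {g y : ι → MvPowerSeries (Fin k) ℤ}
    (h : IsRankedSystem ρ s M g y) : ∀ i ∈ s, IsNRational (y i) := by
  classical
  induction s using Finset.induction_on generalizing M g with
  | empty => simp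
  | insert a s ha ih =>
    have ma := Finset.mem_insert_self a s
    obtain ⟨S, hSr, hS⟩ := (h.matrix a ma a ma).exists_inv_one_sub
      (by_contra fun h0 => lt_irrefl _ (h.rank_lt a ma a ma h0))
    have hs := ih (h.eliminate ha hS hSr)
    refine Finset.forall_mem_insert _ _ _ |>.mpr ⟨?_, hs⟩
    rw [h.eq_inv_mul ha hS]
    exact hSr.mul ((isNRational_sum _ _ fun j hj =>
      (h.matrix a ma j (Finset.mem_insert_of_mem hj)).mul (hs j hj)).add (h.inhomogeneity a ma))

end NRational

/-! ### Walk counts -/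

open scoped Classical in
/-- `N p L` is the number of walks of length `L` from `p` to `fin` in the finite directed
multigraph with edges `E`, whose edge lengths lie in an ordered group `G`. The walks themselves are
not represented: the recursion on the first edge determines their number, and it makes sense for
counts in any `A`. -/
structure IsWalkCount {Q E G A : Type*} [Fintype E] [AddCommGroup G] [PartialOrder G]
    [AddCommMonoidWithOne A] (src dst : E → Q) (len : E → G) (fin : Q) (N : Q → G → A) : Prop where
  len_pos : ∀ e, 0 < len e
  nonneg_of_ne_zero : ∀ p L, N p L ≠ 0 → 0 ≤ L
  first_edge : ∀ p L, N p L = (if p = fin ∧ L = 0 then 1 else 0) +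
    ∑ e, if src e = p then N (dst e) (L - len e) else 0

theorem induction_sub_of_forall_pos {E G : Type*} [Finite E] [AddCommGroup G]
    [LinearOrder G] [IsOrderedAddMonoid G] [Archimedean G] (len : E → G) (hlen : ∀ e, 0 < len e)
    {motive : G → Prop} (neg : ∀ L < 0, motive L)
    (step : ∀ L, 0 ≤ L → (∀ e, motive (L - len e)) → motive L) (L : G) : motive L := by
  rcases isEmpty_or_nonempty E with _ | _
  · exact (lt_or_ge L 0).elim (neg L) fun hL => step L hL isEmptyElim
  obtain ⟨e₀, he₀⟩ := Finite.exists_min len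
  have below (n : ℕ) : ∀ L < n • len e₀, motive L := by
    induction n with
    | zero => simpa using neg
    | succ n ih =>
      intro L hL
      refine (lt_or_ge L 0).elim (neg L) fun hL0 => step L hL0 fun e => ih _ ?_
      calc L - len e ≤ L - len e₀ := sub_le_sub_left (he₀ e) L
        _ < n • len e₀ := sub_lt_iff_lt_add.mpr (by rwa [← succ_nsmul])
  obtain ⟨n, hn⟩ := Archimedean.arch L (hlen e₀)
  exact below (n + 1) L (hn.trans_lt (nsmul_lt_nsmul_left (hlen e₀) n.lt_succ_self))

section WalkCount

variable {Q E G A : Type*} [Fintype E] [AddCommMonoidWithOne A] {src dst : E → Q} {fin : Q}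

open scoped Classical in
theorem isWalkCount_of_first_edge [AddCommGroup G] [LinearOrder G] [IsOrderedAddMonoid G]
    {len : E → G} {N : Q → G → A} (len_pos : ∀ e, 0 < len e)
    (of_neg : ∀ p, ∀ L < 0, N p L = 0)
    (first_edge : ∀ p L, 0 ≤ L → N p L = (if p = fin ∧ L = 0 then 1 else 0) +
      ∑ e, if src e = p then N (dst e) (L - len e) else 0) :
    IsWalkCount src dst len fin N where
  len_pos := len_pos
  nonneg_of_ne_zero p L h := not_lt.mp fun hL => h (of_neg p L hL)
  first_edge p L := by
    rcases lt_or_ge L 0 with hL | hL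
    · have hstep e : N (dst e) (L - len e) = 0 :=
        of_neg _ _ ((sub_lt_self L (len_pos e)).trans hL)
      simp [of_neg p L hL, hL.ne, hstep]
    · convert first_edge p L hL

variable {H : Type*} [AddCommGroup G] [LinearOrder G] [IsOrderedAddMonoid G] [Archimedean G]
  [AddCommGroup H] [PartialOrder H] [IsOrderedAddMonoid H] {N : Q → G → A}

theorem IsWalkCount.comp_injective {φ : H →+ G} {len : E → H} (hφ : Function.Injective φ)
    (hlen : ∀ e, 0 ≤ len e) (hN : IsWalkCount src dst (φ ∘ len) fin N) :
    IsWalkCount src dst len fin fun p z => N p (φ z) where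
  len_pos e := (hlen e).lt_of_ne' fun h => (hN.len_pos e).ne' (by simp [h])
  first_edge p z := by
    classical
    rw [hN.first_edge]
    simp only [Function.comp_apply, map_sub]
    congr! 3
    exact map_eq_zero_iff φ hφ
  nonneg_of_ne_zero := by
    suffices key : ∀ L p z, φ z = L → N p L ≠ 0 → 0 ≤ z from fun p z => key (φ z) p z rfl
    refine induction_sub_of_forall_pos (φ ∘ len) hN.len_pos
      (fun L hL p _ _ h => absurd hL (hN.nonneg_of_ne_zero p L h).not_gt) ?_
    rintro L - ih p z rfl hz
    rw [hN.first_edge] at hz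
    by_cases hend : p = fin ∧ φ z = 0
    · exact ((map_eq_zero_iff φ hφ).mp hend.2).ge
    · rw [if_neg hend, zero_add] at hz
      obtain ⟨e, -, he⟩ := Finset.exists_ne_zero_of_sum_ne_zero hz
      have hrest := ih e (dst e) (z - len e) (map_sub φ z _) fun h =>
        he (by rw [h, ite_self])
      exact (hlen e).trans (sub_nonneg.mp hrest)

end WalkCount

/-! ### Walk counts on lattices and Cartier carries -/

section Carry

variable {k : ℕ} (M : ℕ)

/-- The quotient of `z` by `M`, coordinate by coordinate, where the negative coordinates are
not divided. -/
noncomputable def carry (z : Fin k → ℤ) : Fin k →₀ ℕ :=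
  Finsupp.equivFunOnFinite.symm fun j => (z j / M).toNat

/-- The remainder left by `carry`. -/
noncomputable def carryRem (z : Fin k → ℤ) : Fin k → ℤ := fun j => z j - M * carry M z j

/-- The range of `carryRem` on vectors that are bounded below by `-h`. -/
noncomputable def carryBox (h : Fin k → ℕ) : Finset (Fin k → ℤ) :=
  Fintype.piFinset fun j => Finset.Ico (-(h j : ℤ)) M

variable {M} {h : Fin k → ℕ} {κ a z : Fin k → ℤ}

theorem mem_carryBox : κ ∈ carryBox M h ↔ ∀ j, -(h j : ℤ) ≤ κ j ∧ κ j < M := by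
  simp only [carryBox, Fintype.mem_piFinset, Finset.mem_Ico]

theorem carryRem_eq_of_carry_eq_zero (hz : carry M z = 0) : carryRem M z = z := by
  funext j
  simp [carryRem, hz]

theorem carry_eq_zero_of_neg (hM : 0 < M) {j : Fin k} (hz : z j < 0) : carry M z j = 0 := by
  have hdiv : z j / M < 0 := Int.ediv_neg_of_neg_of_pos hz (by exact_mod_cast hM)
  simp [carry, hdiv.le]

theorem carryRem_eq_emod {j : Fin k} (hz : 0 ≤ z j) : carryRem M z j = z j % M := by
  have hdiv : 0 ≤ z j / M := Int.ediv_nonneg hz (Int.natCast_nonneg M)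
  simp [carryRem, carry, Int.emod_def, Int.toNat_of_nonneg hdiv]

theorem carryRem_lt (hM : 0 < M) (z : Fin k → ℤ) (j : Fin k) : carryRem M z j < M := by
  rcases lt_or_ge (z j) 0 with hz | hz
  · simp only [carryRem, carry_eq_zero_of_neg hM hz]
    lia
  · rw [carryRem_eq_emod hz]
    exact Int.emod_lt_of_pos _ (by exact_mod_cast hM)

theorem carryRem_add_mem_carryBox (hM : 0 < M) (hκ : κ ∈ carryBox M h) (ha : 0 ≤ a) :
    carryRem M (κ + a) ∈ carryBox M h := by
  refine mem_carryBox.mpr fun j => ⟨?_, carryRem_lt hM _ j⟩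
  have hκj := (mem_carryBox.mp hκ j).1
  have haj : 0 ≤ a j := ha j
  rcases lt_or_ge ((κ + a) j) 0 with hz | hz
  · simp only [carryRem, carry_eq_zero_of_neg hM hz, Pi.add_apply]
    lia
  · rw [carryRem_eq_emod hz]
    have := Int.emod_nonneg ((κ + a) j) (by exact_mod_cast hM.ne' : (M : ℤ) ≠ 0)
    lia

end Carry

section LatticeWalks

variable {Q E : Type*} [Fintype E] {src dst : E → Q} {fin : Q} {k : ℕ} {len : E → Fin k → ℤ}
  {N : Q → (Fin k → ℤ) → ℕ} {M : ℕ}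

/-- The generating function of `c ↦ N p (M * c - κ)`. -/
def walkSeries (M : ℕ) (N : Q → (Fin k → ℤ) → ℕ) (i : Q × (Fin k → ℤ)) :
    MvPowerSeries (Fin k) ℤ :=
  fun c => N i.1 fun j => M * (c j : ℤ) - i.2 j

open scoped Classical in
/-- The matrix of the linear system for `walkSeries`: an edge leads from `(p, κ)` to the end of the
edge and the remainder of `κ + len e`, and its weight is the monomial of the carry. -/
noncomputable def carryMatrix (src dst : E → Q) (len : E → Fin k → ℤ) (M : ℕ)
    (i j : Q × (Fin k → ℤ)) : MvPowerSeries (Fin k) ℤ :=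
  ∑ e, if src e = i.1 ∧ (dst e, carryRem M (i.2 + len e)) = j then
    MvPowerSeries.monomial (carry M (i.2 + len e)) 1 else 0

theorem coeff_walkSeries (p : Q) (κ : Fin k → ℤ) (c : Fin k →₀ ℕ) :
    MvPowerSeries.coeff c (walkSeries M N (p, κ)) = N p fun j => M * (c j : ℤ) - κ j := rfl

theorem coeff_monomial_carry_mul_walkSeries (hM : 0 < M) {q : Q}
    (hN : ∀ L, N q L ≠ 0 → 0 ≤ L) (z : Fin k → ℤ) (c : Fin k →₀ ℕ) :
    MvPowerSeries.coeff c
        (MvPowerSeries.monomial (carry M z) (1 : ℤ) * walkSeries M N (q, carryRem M z)) =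
      N q fun j => M * (c j : ℤ) - z j := by
  rw [MvPowerSeries.coeff_monomial_mul, one_mul]
  split_ifs with hle
  · rw [coeff_walkSeries]
    congr 2
    ext j
    rw [Finsupp.tsub_apply, Nat.cast_sub (hle j), carryRem]
    ring
  · obtain ⟨j, hj⟩ : ∃ j, c j < carry M z j := by
      by_contra! hc
      exact hle hc
    refine (Nat.cast_eq_zero.mpr (by_contra fun hne => ?_)).symm
    have hcoord : 0 ≤ M * (c j : ℤ) - z j := hN _ hne j
    have hz : 0 ≤ z j := not_lt.mp fun hz => by simp [carry_eq_zero_of_neg hM hz] at hj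
    have hrem : 0 ≤ carryRem M z j := by
      rw [carryRem_eq_emod hz]
      exact Int.emod_nonneg (z j) (by exact_mod_cast hM.ne')
    rw [carryRem] at hrem
    have : (M : ℤ) * c j < M * carry M z j := by gcongr
    lia

open scoped Classical in
theorem sum_carryMatrix_mul {S : Finset (Q × (Fin k → ℤ))} {p : Q} {κ : Fin k → ℤ}
    (hS : ∀ e, (dst e, carryRem M (κ + len e)) ∈ S)
    (y : Q × (Fin k → ℤ) → MvPowerSeries (Fin k) ℤ) :
    ∑ j ∈ S, carryMatrix src dst len M (p, κ) j * y j =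
      ∑ e, if src e = p then MvPowerSeries.monomial (carry M (κ + len e)) 1 *
        y (dst e, carryRem M (κ + len e)) else 0 := by
  simp only [carryMatrix, Finset.sum_mul]
  rw [Finset.sum_comm]
  refine Finset.sum_congr rfl fun e _ => ?_
  rw [Finset.sum_eq_single_of_mem _ (hS e) fun b _ hb => by
    rw [if_neg fun hc => hb hc.2.symm, zero_mul]]
  by_cases hs : src e = p <;> simp [hs]

theorem lt_of_constantCoeff_carryMatrix_ne_zero (hlen : ∀ e, 0 < len e) {i j : Q × (Fin k → ℤ)}
    (h : MvPowerSeries.constantCoeff (carryMatrix src dst len M i j) ≠ 0) : i.2 < j.2 := by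
  classical
  rw [carryMatrix, map_sum] at h
  obtain ⟨e, -, he⟩ := Finset.exists_ne_zero_of_sum_ne_zero h
  split_ifs at he with hc
  · have hcarry : carry M (i.2 + len e) = 0 := by
      by_contra hne
      rw [← MvPowerSeries.coeff_zero_eq_constantCoeff_apply, MvPowerSeries.coeff_monomial,
        if_neg (Ne.symm hne)] at he
      exact he rfl
    rw [← hc.2, carryRem_eq_of_carry_eq_zero hcarry]
    exact lt_add_of_pos_right i.2 (hlen e)
  · exact absurd (map_zero _) he

theorem mul_sub_eq_zero_iff {c : Fin k →₀ ℕ} {κ : Fin k → ℤ} (hκ : ∀ j, κ j < M) :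
    (fun j => M * (c j : ℤ) - κ j) = 0 ↔ κ = 0 ∧ c = 0 := by
  refine ⟨fun h => ?_, by rintro ⟨rfl, rfl⟩; ext; simp⟩
  have hj j : M * (c j : ℤ) = κ j := sub_eq_zero.mp (congrFun h j)
  have hc : c = 0 := by
    ext j
    have hlt : M * (c j : ℤ) < M * 1 := by rw [hj, mul_one]; exact hκ j
    have := lt_of_mul_lt_mul_left hlt (Int.natCast_nonneg M)
    rw [Finsupp.coe_zero, Pi.zero_apply]
    lia
  exact ⟨funext fun j => by simp [← hj, hc], hc⟩

open scoped Classical in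
theorem IsWalkCount.isRankedSystem_walkSeries [Fintype Q] (hN : IsWalkCount src dst len fin N)
    (hM : 0 < M) (h : Fin k → ℕ) :
    IsRankedSystem Prod.snd (Finset.univ ×ˢ carryBox M h) (carryMatrix src dst len M)
      (fun i => if i.1 = fin ∧ i.2 = 0 then 1 else 0) (walkSeries M N) where
  matrix i _ j _ := isNRational_sum _ _ fun e _ => by
    split_ifs
    exacts [isNRational_monomial _, .zero]
  inhomogeneity i _ := by
    split_ifs
    exacts [isNRational_one, .zero]
  rank_lt i _ j _ := lt_of_constantCoeff_carryMatrix_ne_zero hN.len_pos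
  eq := by
    rintro ⟨p, κ⟩ hi
    have hκ : κ ∈ carryBox M h := (Finset.mem_product.mp hi).2
    rw [sum_carryMatrix_mul fun e => Finset.mk_mem_product (Finset.mem_univ _)
      (carryRem_add_mem_carryBox hM hκ (hN.len_pos e).le)]
    ext c
    have hedge e : MvPowerSeries.coeff c (if src e = p then
          MvPowerSeries.monomial (carry M (κ + len e)) 1 *
            walkSeries M N (dst e, carryRem M (κ + len e)) else 0) =
        ((if src e = p then N (dst e) ((fun j => M * (c j : ℤ) - κ j) - len e) else 0 : ℕ) :
          ℤ) := by
      split_ifs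
      · rw [coeff_monomial_carry_mul_walkSeries hM (hN.nonneg_of_ne_zero _)]
        congr 2
        ext j
        simp only [Pi.add_apply, Pi.sub_apply]
        ring
      · simp
    rw [map_add, map_sum, coeff_walkSeries, hN.first_edge,
      mul_sub_eq_zero_iff fun j => (mem_carryBox.mp hκ j).2]
    simp only [hedge, apply_ite (MvPowerSeries.coeff c), MvPowerSeries.coeff_one, map_zero]
    push_cast
    rw [add_comm]
    congr 1
    split_ifs <;> simp_all

theorem IsWalkCount.mul_add_mem_diagonals [Finite Q] (hN : IsWalkCount src dst len fin N)
    (hM : 0 < M) (hk : 1 ≤ k) (s : Q) (h : Fin k → ℕ) :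
    (fun n : ℕ => N s fun j => M * (n : ℤ) + h j) ∈ diagonals := by
  have := Fintype.ofFinite Q
  have hmem : (s, fun j => -(h j : ℤ)) ∈ (Finset.univ : Finset Q) ×ˢ carryBox M h :=
    Finset.mk_mem_product (Finset.mem_univ s) (mem_carryBox.mpr fun j => ⟨le_rfl, by lia⟩)
  refine ⟨k, _, hk, (hN.isRankedSystem_walkSeries hM h).isNRational _ hmem, fun n => ?_⟩
  simp only [coeff_walkSeries, Finsupp.equivFunOnFinite_symm_apply_apply, sub_neg_eq_add]

end LatticeWalks

/-- The homomorphism sending the `j`-th unit vector to `v j / M`. -/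
noncomputable def latticeValue {k : ℕ} (v : Fin k → ℝ) (M : ℕ) : (Fin k → ℤ) →+ ℝ where
  toFun z := (∑ j, (z j : ℝ) * v j) / M
  map_zero' := by simp
  map_add' z w := by simp [add_mul, Finset.sum_add_distrib, add_div]

theorem latticeValue_apply {k : ℕ} (v : Fin k → ℝ) (M : ℕ) (z : Fin k → ℤ) :
    latticeValue v M z = (∑ j, (z j : ℝ) * v j) / M := rfl

theorem latticeValue_injective {k : ℕ} {v : Fin k → ℝ} (hv : LinearIndependent ℚ v) {M : ℕ}
    (hM : 0 < M) : Function.Injective (latticeValue v M) := by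
  refine (injective_iff_map_eq_zero _).mpr fun z hz => ?_
  rw [latticeValue_apply, div_eq_zero_iff, or_iff_left (by positivity)] at hz
  have hcoord := Fintype.linearIndependent_iff.mp hv (fun j => (z j : ℚ))
    (by simpa [Rat.smul_def] using hz)
  exact funext fun j => by exact_mod_cast hcoord j

theorem IsWalkCount.natCast_add_mem_diagonals {Q E : Type*} [Finite Q] [Fintype E]
    {src dst : E → Q} {len : E → ℝ} {fin : Q} {N : Q → ℝ → ℕ} (hN : IsWalkCount src dst len fin N)
    (s : Q) {η : ℝ} (hη : 0 ≤ η) : (fun n : ℕ => N s (n + η)) ∈ diagonals := by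
  classical
  obtain ⟨k, v, M, hM, hv, hsum, hX⟩ := exists_linearIndependent_nat_coordinates
    (insert η (Finset.univ.image len)) (by simp [hη, fun e => (hN.len_pos e).le])
  have hMR : (M : ℝ) ≠ 0 := by positivity
  obtain ⟨h, hh⟩ := hX η (Finset.mem_insert_self _ _)
  have hcoord e : ∃ a : Fin k → ℕ, len e * M = ∑ i, a i * v i := hX (len e) (by simp)
  choose a ha using hcoord
  have hlen : len = latticeValue v M ∘ fun e j => (a e j : ℤ) := funext fun e => by
    rw [Function.comp_apply, latticeValue_apply, eq_div_iff hMR, ha]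
    simp
  have hk : 1 ≤ k := Nat.one_le_iff_ne_zero.mpr fun hk => by subst hk; simp at hsum
  rw [hlen] at hN
  have hdiag := (hN.comp_injective (latticeValue_injective hv hM)
    fun e j => Int.natCast_nonneg _).mul_add_mem_diagonals hM hk s h
  have hvalue (n : ℕ) : latticeValue v M (fun j => M * (n : ℤ) + h j) = n + η := by
    rw [latticeValue_apply, div_eq_iff hMR, add_mul, hh]
    push_cast
    rw [← mul_one ((n : ℝ) * M), ← hsum, Finset.mul_sum, ← Finset.sum_add_distrib]
    exact Finset.sum_congr rfl fun j _ => by ring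
  simpa only [hvalue] using hdiag

/-! ### Partitions into half-open tiles -/

theorem mem_translate {v p : ℝ × ℝ} {K : Set (ℝ × ℝ)} : p ∈ translate v K ↔ p - v ∈ K := by
  rw [translate, Set.image_add_left, Set.mem_preimage, neg_add_eq_sub]

theorem translate_translate (v w : ℝ × ℝ) (K : Set (ℝ × ℝ)) :
    translate v (translate w K) = translate (v + w) K := by
  ext p
  rw [mem_translate, mem_translate, mem_translate, sub_sub]

@[simp]
theorem translate_zero (K : Set (ℝ × ℝ)) : translate 0 K = K := by
  ext p
  rw [mem_translate, sub_zero]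

theorem translate_injective (v : ℝ × ℝ) : Function.Injective (translate v) :=
  (add_right_injective v).image_injective

theorem translate_subset_translate {v : ℝ × ℝ} {K L : Set (ℝ × ℝ)} :
    translate v K ⊆ translate v L ↔ K ⊆ L :=
  Set.image_subset_image_iff (add_right_injective v)

theorem translate_diff (v : ℝ × ℝ) (K L : Set (ℝ × ℝ)) :
    translate v (K \ L) = translate v K \ translate v L :=
  Set.image_sdiff (add_right_injective v) K L

/-- `P` is an exact partition of `Γ` into horizontal translates of members of `𝓣`. It replaces
tilings by closed tiles, which overlap along their boundaries. -/
structure IsPartition (𝓣 : Set (Set (ℝ × ℝ))) (Γ : Set (ℝ × ℝ)) (P : Set (Set (ℝ × ℝ))) :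
    Prop where
  pieces : ∀ K ∈ P, ∃ τ ∈ 𝓣, ∃ x : ℝ, K = translate (x, 0) τ
  disjoint : P.PairwiseDisjoint id
  covers : ⋃₀ P = Γ

/-- The number of exact partitions of `Γ` into horizontal translates of members of `𝓣`. -/
noncomputable def partitionCount (𝓣 : Set (Set (ℝ × ℝ))) (Γ : Set (ℝ × ℝ)) : ℕ∞ :=
  {P | IsPartition 𝓣 Γ P}.encard

/-- The leftmost point of `τ` on the horizontal axis is the origin. A half-open tile is normalized
in this way, so that in a partition the tile that covers the leftmost bottom point of the region is
anchored there. -/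
def IsAnchored (τ : Set (ℝ × ℝ)) : Prop := (0, 0) ∈ τ ∧ ∀ x : ℝ, (x, 0) ∈ τ → 0 ≤ x

section Partition

variable {𝓣 : Set (Set (ℝ × ℝ))} {Γ : Set (ℝ × ℝ)} {P : Set (Set (ℝ × ℝ))} {τ : Set (ℝ × ℝ)}

theorem IsPartition.subset (h : IsPartition 𝓣 Γ P) {K : Set (ℝ × ℝ)} (hK : K ∈ P) : K ⊆ Γ :=
  h.covers ▸ Set.subset_sUnion_of_mem hK

theorem IsAnchored.mem_translate (h : IsAnchored τ) (x : ℝ) : (x, 0) ∈ translate (x, 0) τ := by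
  rw [IrrationalTiling.mem_translate, sub_self]
  exact h.1

theorem IsPartition.exists_translate (h : IsPartition 𝓣 Γ P) (h𝓣 : ∀ τ ∈ 𝓣, IsAnchored τ)
    {p : ℝ × ℝ} (hp : p ∈ Γ) :
    ∃ τ ∈ 𝓣, ∃ x, (x, 0) ∈ Γ ∧ translate (x, 0) τ ∈ P ∧ p ∈ translate (x, 0) τ := by
  rw [← h.covers] at hp
  obtain ⟨K, hK, hpK⟩ := hp
  obtain ⟨τ, hτ, x, rfl⟩ := h.pieces K hK
  exact ⟨τ, hτ, x, h.subset hK ((h𝓣 τ hτ).mem_translate x), hK, hpK⟩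

theorem IsPartition.translate (h : IsPartition 𝓣 Γ P) (x : ℝ) :
    IsPartition 𝓣 (translate (x, 0) Γ) (IrrationalTiling.translate (x, 0) '' P) where
  pieces := by
    rintro _ ⟨K, hK, rfl⟩
    obtain ⟨τ, hτ, y, rfl⟩ := h.pieces K hK
    exact ⟨τ, hτ, x + y, by simp [translate_translate]⟩
  disjoint := by
    rintro _ ⟨K, hK, rfl⟩ _ ⟨L, hL, rfl⟩ hne
    have hdisj : Disjoint K L := h.disjoint hK hL fun h => hne (by rw [h])
    exact (Set.disjoint_image_iff (add_right_injective _)).mpr hdisj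
  covers := by
    rw [← h.covers]
    exact Set.image_sUnion.symm

theorem partitionCount_translate (𝓣 : Set (Set (ℝ × ℝ))) (Γ : Set (ℝ × ℝ)) (x : ℝ) :
    partitionCount 𝓣 (translate (x, 0) Γ) = partitionCount 𝓣 Γ := by
  have hle (Γ : Set (ℝ × ℝ)) (x : ℝ) :
      partitionCount 𝓣 Γ ≤ partitionCount 𝓣 (translate (x, 0) Γ) :=
    Set.encard_le_encard_of_injOn (fun _ hP => IsPartition.translate hP x)
      (translate_injective _).image_injective.injOn
  refine le_antisymm ?_ (hle Γ x)
  have hback := hle (translate (x, 0) Γ) (-x)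
  rwa [translate_translate, Prod.mk_add_mk, neg_add_cancel, add_zero, Prod.mk_zero_zero,
    translate_zero] at hback

theorem partitionCount_empty (h𝓣 : ∀ τ ∈ 𝓣, IsAnchored τ) : partitionCount 𝓣 ∅ = 1 := by
  rw [partitionCount, Set.encard_eq_one]
  refine ⟨∅, Set.eq_singleton_iff_unique_mem.mpr ⟨⟨by simp, by simp, by simp⟩, fun P hP => ?_⟩⟩
  refine Set.eq_empty_of_forall_notMem fun K hK => ?_
  obtain ⟨τ, hτ, x, rfl⟩ := hP.pieces K hK
  exact hP.subset hK ((h𝓣 τ hτ).mem_translate x)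

theorem IsPartition.insert (hP : IsPartition 𝓣 (Γ \ τ) P) (hτ : τ ∈ 𝓣) (hsub : τ ⊆ Γ) :
    IsPartition 𝓣 Γ (insert τ P) where
  pieces := by
    rintro K (rfl | hK)
    exacts [⟨K, hτ, 0, (translate_zero K).symm⟩, hP.pieces K hK]
  disjoint := hP.disjoint.insert fun _ hL _ =>
    Set.disjoint_left.mpr fun _ hpτ hpL => (hP.subset hL hpL).2 hpτ
  covers := by rw [Set.sUnion_insert, hP.covers, Set.union_sdiff_cancel hsub]

theorem IsPartition.sdiff_singleton (hP : IsPartition 𝓣 Γ P) (hτ : τ ∈ P) :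
    IsPartition 𝓣 (Γ \ τ) (P \ {τ}) where
  pieces K hK := hP.pieces K hK.1
  disjoint := hP.disjoint.subset Set.sdiff_subset
  covers := by
    rw [← hP.covers]
    ext p
    constructor
    · rintro ⟨L, ⟨hL, hne⟩, hp⟩
      exact ⟨⟨L, hL, hp⟩, Set.disjoint_left.mp (hP.disjoint hL hτ hne) hp⟩
    · rintro ⟨⟨L, hL, hp⟩, hpτ⟩
      exact ⟨L, ⟨hL, fun hLτ => hpτ (hLτ ▸ hp)⟩, hp⟩

theorem IsPartition.exists_mem (hP : IsPartition 𝓣 Γ P) (h𝓣 : ∀ τ ∈ 𝓣, IsAnchored τ)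
    (hΓ : IsAnchored Γ) : ∃ τ ∈ 𝓣, τ ∈ P := by
  obtain ⟨τ, hτ, x, hxΓ, hK, h0⟩ := hP.exists_translate h𝓣 hΓ.1
  have hle : 0 ≤ -x := (h𝓣 τ hτ).2 (-x) (by simpa [mem_translate] using h0)
  obtain rfl : x = 0 := le_antisymm (neg_nonneg.mp hle) (hΓ.2 x hxΓ)
  rw [Prod.mk_zero_zero, translate_zero] at hK
  exact ⟨τ, hτ, hK⟩

theorem IsPartition.zero_notMem (hP : IsPartition 𝓣 (Γ \ τ) P) (hτ : IsAnchored τ)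
    {K : Set (ℝ × ℝ)} (hK : K ∈ P) : (0, 0) ∉ K :=
  fun h0 => (hP.subset hK h0).2 hτ.1

theorem setOf_isPartition_eq_biUnion (h𝓣 : ∀ τ ∈ 𝓣, IsAnchored τ) (hΓ : IsAnchored Γ) :
    {P | IsPartition 𝓣 Γ P} =
      ⋃ τ ∈ {τ ∈ 𝓣 | τ ⊆ Γ}, insert τ '' {P | IsPartition 𝓣 (Γ \ τ) P} := by
  ext P
  simp only [Set.mem_iUnion₂, Set.mem_image, Set.mem_ofPred_eq]
  constructor
  · intro hP
    obtain ⟨τ, hτ, hτP⟩ := hP.exists_mem h𝓣 hΓ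
    exact ⟨τ, ⟨hτ, hP.subset hτP⟩, P \ {τ}, hP.sdiff_singleton hτP, by
      rw [Set.insert_sdiff_singleton, Set.insert_eq_of_mem hτP]⟩
  · rintro ⟨τ, ⟨hτ, hsub⟩, P, hP, rfl⟩
    exact hP.insert hτ hsub

theorem encard_image_insert_isPartition (hτ : IsAnchored τ) :
    (insert τ '' {P | IsPartition 𝓣 (Γ \ τ) P}).encard = partitionCount 𝓣 (Γ \ τ) := by
  have hnotMem {P} (hP : IsPartition 𝓣 (Γ \ τ) P) : τ ∉ P :=
    fun h => hP.zero_notMem hτ h hτ.1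
  refine Set.InjOn.encard_image fun P hP P' hP' heq => ?_
  rw [← Set.insert_sdiff_self_of_notMem (hnotMem hP), heq,
    Set.insert_sdiff_self_of_notMem (hnotMem hP')]

open scoped Classical in
theorem partitionCount_eq_sum (T : Finset (Set (ℝ × ℝ))) (hT : ∀ τ ∈ T, IsAnchored τ)
    (hΓ : IsAnchored Γ) :
    partitionCount T Γ = ∑ τ ∈ T, if τ ⊆ Γ then partitionCount T (Γ \ τ) else 0 := by
  have hfilter : {τ ∈ (T : Set (Set (ℝ × ℝ))) | τ ⊆ Γ} = (T.filter (· ⊆ Γ) : Finset _) := by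
    simp
  rw [partitionCount, setOf_isPartition_eq_biUnion hT hΓ, ← Finset.sum_filter, hfilter,
    (Finset.finite_toSet _).encard_biUnion, finsum_mem_coe_finset]
  · exact Finset.sum_congr rfl fun τ hτ =>
      encard_image_insert_isPartition (hT τ (Finset.mem_of_mem_filter τ hτ))
  · intro τ hτ τ' hτ' hne
    refine Set.disjoint_left.mpr ?_
    rintro _ ⟨P, hP, rfl⟩ ⟨P', -, heq⟩
    have hmem : τ' ∈ insert τ P := heq ▸ Set.mem_insert τ' P'
    exact (IsPartition.zero_notMem hP (hT τ (Finset.mem_of_mem_filter τ hτ))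
      (Set.mem_of_mem_insert_of_ne hmem hne.symm)) (hT τ' (Finset.mem_of_mem_filter τ' hτ')).1

end Partition

/-- The part of the strip of height `1` to the right of the abscissa `ℓ`. -/
def halfStrip (ℓ : ℝ) : Set (ℝ × ℝ) := Set.Ici ℓ ×ˢ Set.Ico 0 1

theorem mem_halfStrip {ℓ : ℝ} {p : ℝ × ℝ} :
    p ∈ halfStrip ℓ ↔ ℓ ≤ p.1 ∧ 0 ≤ p.2 ∧ p.2 < 1 := Iff.rfl

theorem axis_mem_halfStrip {ℓ x : ℝ} : (x, 0) ∈ halfStrip ℓ ↔ ℓ ≤ x := by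
  simp [mem_halfStrip]

theorem translate_halfStrip (x ℓ : ℝ) :
    translate (x, 0) (halfStrip ℓ) = halfStrip (x + ℓ) := by
  ext p
  simp [mem_translate, mem_halfStrip, le_sub_iff_add_le, add_comm]

open scoped Classical in
/-- The number of partitions of the part of `R` to the left of the abscissa `ℓ`, where `R` has to
contain everything to the right. -/
noncomputable def remCount (𝓣 : Set (Set (ℝ × ℝ))) (R : Set (ℝ × ℝ)) (ℓ : ℝ) : ℕ∞ :=
  if halfStrip ℓ ⊆ R then partitionCount 𝓣 (R \ halfStrip ℓ) else 0

section RemCount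

variable {𝓣 : Set (Set (ℝ × ℝ))} {R : Set (ℝ × ℝ)} {ℓ : ℝ}

theorem remCount_translate (𝓣 : Set (Set (ℝ × ℝ))) (R : Set (ℝ × ℝ)) (x ℓ : ℝ) :
    remCount 𝓣 (translate (x, 0) R) (x + ℓ) = remCount 𝓣 R ℓ := by
  rw [remCount, remCount, ← translate_halfStrip, translate_subset_translate, ← translate_diff,
    partitionCount_translate]

theorem remCount_of_not_subset (h : ¬halfStrip ℓ ⊆ R) : remCount 𝓣 R ℓ = 0 := if_neg h

theorem remCount_of_neg (𝓣 : Set (Set (ℝ × ℝ))) (hR : IsAnchored R) (hℓ : ℓ < 0) :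
    remCount 𝓣 R ℓ = 0 :=
  remCount_of_not_subset fun h => hℓ.not_ge (hR.2 ℓ (h (axis_mem_halfStrip.mpr le_rfl)))

open scoped Classical in
theorem remCount_zero (h𝓣 : ∀ τ ∈ 𝓣, IsAnchored τ) (hR : IsAnchored R) :
    remCount 𝓣 R 0 = if R = halfStrip 0 then 1 else 0 := by
  split_ifs with hRe
  · rw [remCount, if_pos hRe.ge, hRe, sdiff_self, Set.bot_eq_empty, partitionCount_empty h𝓣]
  · refine ite_eq_right_iff.mpr fun hsub => ?_
    rw [partitionCount, Set.encard_eq_zero, Set.eq_empty_iff_forall_notMem]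
    intro P hP
    obtain ⟨p, hp⟩ : (R \ halfStrip 0).Nonempty :=
      Set.sdiff_nonempty.mpr fun h => hRe (h.antisymm hsub)
    obtain ⟨τ, -, x, hx, -⟩ := hP.exists_translate h𝓣 hp
    exact hx.2 (axis_mem_halfStrip.mpr (hR.2 x hx.1))

theorem remCount_diff_zero {τ : Set (ℝ × ℝ)} (hτ : IsAnchored τ) : remCount 𝓣 (R \ τ) 0 = 0 :=
  remCount_of_not_subset fun h => (h (axis_mem_halfStrip.mpr le_rfl)).2 hτ.1

open scoped Classical in
theorem remCount_eq_sum_of_pos (T : Finset (Set (ℝ × ℝ))) (hT : ∀ τ ∈ T, IsAnchored τ)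
    (hR : IsAnchored R) (hℓ : 0 < ℓ) :
    remCount T R ℓ = ∑ τ ∈ T, if τ ⊆ R then remCount T (R \ τ) ℓ else 0 := by
  have hΓ : IsAnchored (R \ halfStrip ℓ) :=
    ⟨⟨hR.1, fun h => hℓ.not_ge (axis_mem_halfStrip.mp h)⟩, fun x hx => hR.2 x hx.1⟩
  simp only [remCount, Set.subset_sdiff, partitionCount_eq_sum T hT hΓ]
  split_ifs with hsub
  · refine Finset.sum_congr rfl fun τ _ => ?_
    simp only [hsub, true_and, disjoint_comm (a := halfStrip ℓ), sdiff_sdiff_comm (c := τ), ite_and]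
  · simp [hsub]

open scoped Classical in
theorem remCount_eq_sum (T : Finset (Set (ℝ × ℝ))) (hT : ∀ τ ∈ T, IsAnchored τ)
    (hR : IsAnchored R) (ℓ : ℝ) :
    remCount T R ℓ = (if R = halfStrip 0 ∧ ℓ = 0 then 1 else 0) +
      ∑ τ ∈ T, if τ ⊆ R then remCount T (R \ τ) ℓ else 0 := by
  rcases lt_trichotomy ℓ 0 with hneg | rfl | hpos
  · have hstep τ : remCount T (R \ τ) ℓ = 0 := remCount_of_not_subset fun h =>
      hneg.not_ge (hR.2 ℓ (h (axis_mem_halfStrip.mpr le_rfl)).1)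
    simp [remCount_of_neg T hR hneg, hneg.ne, hstep]
  · rw [remCount_zero hT hR, Finset.sum_eq_zero fun τ hτ => by
      rw [remCount_diff_zero (hT τ hτ), ite_self]]
    simp
  · rw [remCount_eq_sum_of_pos T hT hR hpos, if_neg fun h => hpos.ne' h.2, zero_add]

theorem remCount_eq_zero_of_lt (h𝓣 : ∀ τ ∈ 𝓣, IsAnchored τ) {W : ℝ}
    (hW : ∀ τ ∈ 𝓣, ∀ p ∈ τ, -W ≤ p.1) {q : ℝ} (hR : ∀ x, (x, 0) ∈ R → q ≤ x)
    {p : ℝ × ℝ} (hp : p ∈ R) (hpW : p.1 < q - W) (hW0 : 0 ≤ W) (ℓ : ℝ) :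
    remCount 𝓣 R ℓ = 0 := by
  classical
  refine ite_eq_right_iff.mpr fun hsub => ?_
  rw [partitionCount, Set.encard_eq_zero, Set.eq_empty_iff_forall_notMem]
  intro P hP
  have hqℓ : q ≤ ℓ := hR ℓ (hsub (axis_mem_halfStrip.mpr le_rfl))
  have hpℓ : p ∉ halfStrip ℓ := fun h => by linarith [(mem_halfStrip.mp h).1]
  obtain ⟨τ, hτ, x, hx, -, hpτ⟩ := hP.exists_translate h𝓣 ⟨hp, hpℓ⟩
  have hqx : q ≤ x := hR x hx.1
  have hpx : -W ≤ p.1 - x := hW τ hτ _ (mem_translate.mp hpτ)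
  linarith

end RemCount

/-! ### Tilings as walks in a finite graph of boundary shapes -/

section ENatWalkCount

variable {Q E G : Type*} [Fintype E] [AddCommGroup G] [LinearOrder G] [IsOrderedAddMonoid G]
  [Archimedean G] {src dst : E → Q} {len : E → G} {fin : Q} {N : Q → G → ℕ∞}

theorem IsWalkCount.ne_top (hN : IsWalkCount src dst len fin N) (p : Q) (L : G) : N p L ≠ ⊤ := by
  refine induction_sub_of_forall_pos len hN.len_pos (motive := fun L => ∀ p, N p L ≠ ⊤)
    (fun L hL p htop => ?_) (fun L _ ih p => ?_) L p
  · exact (hN.nonneg_of_ne_zero p L (by simp [htop])).not_gt hL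
  · rw [hN.first_edge p L, Ne, ENat.add_eq_top, not_or]
    refine ⟨by split_ifs <;> simp, ?_⟩
    refine Finset.sum_induction _ (· ≠ ⊤) (fun a b ha hb => ?_) (by simp) fun e _ => ?_
    · exact ENat.add_eq_top.not.mpr (not_or.mpr ⟨ha, hb⟩)
    · split_ifs
      exacts [ih e _, by simp]

theorem IsWalkCount.toNat (hN : IsWalkCount src dst len fin N) :
    IsWalkCount src dst len fin fun p L => (N p L).toNat where
  len_pos := hN.len_pos
  nonneg_of_ne_zero p L h := hN.nonneg_of_ne_zero p L fun h0 => h (by simp [h0])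
  first_edge p L := by
    rw [← Nat.cast_inj (R := ℕ∞)]
    push_cast
    simp only [ENat.natCast_toNat (hN.ne_top _ _)]
    exact hN.first_edge p L

end ENatWalkCount

theorem isWalkCount_remCount (T : Finset (Set (ℝ × ℝ))) (hT : ∀ τ ∈ T, IsAnchored τ)
    {𝓢 : Set (Set (ℝ × ℝ))} [Fintype 𝓢] (hanch : ∀ R ∈ 𝓢, IsAnchored R)
    {len : 𝓢 × T → ℝ} (hlen : ∀ e, 0 < len e) {dst : 𝓢 × T → Option 𝓢}
    (hdst : ∀ e ℓ, (dst e).elim 0 (fun R : 𝓢 => remCount T R (ℓ - len e)) =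
      open scoped Classical in if e.2.1 ⊆ e.1.1 then remCount T (e.1.1 \ e.2.1) ℓ else 0)
    (h0 : halfStrip 0 ∈ 𝓢) :
    IsWalkCount (fun e => some e.1) dst len (some ⟨halfStrip 0, h0⟩)
      fun p ℓ => p.elim 0 fun R : 𝓢 => remCount T R ℓ := by
  classical
  refine isWalkCount_of_first_edge hlen ?_ ?_
  · rintro (_ | R) ℓ hℓ
    exacts [rfl, remCount_of_neg _ (hanch R R.2) hℓ]
  · rintro (_ | R) ℓ -
    · simp
    · simp only [hdst, Option.elim_some, Option.some_inj, Fintype.sum_prod_type,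
        Finset.sum_ite_irrel, Finset.sum_const_zero, Finset.sum_ite_eq', Finset.mem_univ, if_true]
      rw [remCount_eq_sum T hT (hanch R R.2), ← Finset.sum_coe_sort T]
      simp only [Subtype.ext_iff]

theorem mem_diagonals_of_finite_shapes (T : Finset (Set (ℝ × ℝ))) (hT : ∀ τ ∈ T, IsAnchored τ)
    {𝓢 : Set (Set (ℝ × ℝ))} (hfin : 𝓢.Finite) (h0 : halfStrip 0 ∈ 𝓢)
    (hanch : ∀ R ∈ 𝓢, IsAnchored R)
    (hstep : ∀ R ∈ 𝓢, ∀ τ ∈ T, τ ⊆ R → (∃ q > 0, translate (-q, 0) (R \ τ) ∈ 𝓢) ∨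
      ∀ ℓ, remCount T (R \ τ) ℓ = 0) {ε : ℝ} (hε : 0 ≤ ε) {f : ℕ → ℕ}
    (hf : ∀ n : ℕ, remCount T (halfStrip 0) (n + ε) = f n) : f ∈ diagonals := by
  classical
  have := hfin.fintype
  have hedge (e : 𝓢 × T) : ∃ q : ℝ, 0 < q ∧ ∃ p : Option 𝓢, ∀ ℓ,
      p.elim 0 (fun R : 𝓢 => remCount T R (ℓ - q)) =
        if e.2.1 ⊆ e.1.1 then remCount T (e.1.1 \ e.2.1) ℓ else 0 := by
    obtain ⟨⟨R, hR⟩, ⟨τ, hτ⟩⟩ := e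
    by_cases hsub : τ ⊆ R
    · rcases hstep R hR τ hτ hsub with ⟨q, hq, hmem⟩ | hzero
      · refine ⟨q, hq, some ⟨_, hmem⟩, fun ℓ => ?_⟩
        simp only [Option.elim_some, if_pos hsub]
        rw [sub_eq_neg_add, remCount_translate]
      · exact ⟨1, one_pos, none, fun ℓ => by simp [hzero]⟩
    · exact ⟨1, one_pos, none, fun ℓ => by simp [hsub]⟩
  choose len hlen dst hdst using hedge
  have hdiag := (isWalkCount_remCount T hT hanch hlen hdst h0).toNat.natCast_add_mem_diagonals
    (some ⟨_, h0⟩) hε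
  simpa only [Option.elim_some, hf, ENat.toNat_natCast] using hdiag

section IcoUnion

variable {J : Set (ℝ × ℝ)} {t : ℝ}

/-- The union of the intervals `[i.1, i.2)` with `i ∈ J`. -/
def icoUnion (J : Set (ℝ × ℝ)) : Set ℝ := ⋃ i ∈ J, Set.Ico i.1 i.2

theorem mem_icoUnion : t ∈ icoUnion J ↔ ∃ i ∈ J, i.1 ≤ t ∧ t < i.2 := by
  simp only [icoUnion, Set.mem_iUnion₂, exists_prop, Set.mem_Ico]

theorem Ico_subset_icoUnion {i : ℝ × ℝ} (hi : i ∈ J) : Set.Ico i.1 i.2 ⊆ icoUnion J :=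
  Set.subset_biUnion_of_mem (u := fun i : ℝ × ℝ => Set.Ico i.1 i.2) hi

theorem mem_icoUnion_translate {x : ℝ} :
    t ∈ icoUnion (translate (x, x) J) ↔ t - x ∈ icoUnion J := by
  simp only [mem_icoUnion, translate, Set.exists_mem_image, Prod.fst_add, Prod.snd_add,
    le_sub_iff_add_le', sub_lt_iff_lt_add']

/-- The positive distances from the left endpoint of an interval of `J` to the right endpoint of
an interval of `J`. -/
def runLengths (J : Set (ℝ × ℝ)) : Set ℝ := {c | 0 < c ∧ ∃ i ∈ J, ∃ j ∈ J, c = j.2 - i.1}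

theorem runLengths_translate {x : ℝ} : runLengths (translate (x, x) J) = runLengths J := by
  simp only [runLengths, translate, Set.exists_mem_image, Prod.fst_add, Prod.snd_add,
    add_sub_add_left_eq_sub]

theorem finite_runLengths (hJ : J.Finite) : (runLengths J).Finite := by
  refine (hJ.image2 (fun i j => j.2 - i.1) hJ).subset ?_
  rintro _ ⟨-, i, hi, j, hj, rfl⟩
  exact ⟨i, hi, j, hj, rfl⟩

theorem exists_first_notMem_icoUnion (hJ : J.Finite) (ht : t ∈ icoUnion J) :
    ∃ i ∈ J, t < i.2 ∧ Set.Ico t i.2 ⊆ icoUnion J ∧ i.2 ∉ icoUnion J := by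
  obtain ⟨i₀, hi₀, hi₀t, hti₀⟩ := mem_icoUnion.mp ht
  obtain ⟨i, ⟨hiJ, hti, hi⟩, hmax⟩ := Set.exists_max_image
    {i ∈ J | t < i.2 ∧ Set.Ico t i.2 ⊆ icoUnion J} Prod.snd (hJ.subset (Set.sep_subset _ _))
    ⟨i₀, hi₀, hti₀, (Set.Ico_subset_Ico_left hi₀t).trans (Ico_subset_icoUnion hi₀)⟩
  refine ⟨i, hiJ, hti, hi, fun hmem => ?_⟩
  obtain ⟨j, hj, hji, hij⟩ := mem_icoUnion.mp hmem
  refine hij.not_ge (hmax j ⟨hj, hti.trans hij, ?_⟩)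
  exact Set.Ico_subset_Ico_union_Ico.trans (Set.union_subset hi
    ((Set.Ico_subset_Ico_left hji).trans (Ico_subset_icoUnion hj)))

theorem exists_run (hJ : J.Finite) (ht : t ∈ icoUnion J)
    (hleft : ∀ᶠ u in 𝓝[<] t, u ∉ icoUnion J) :
    ∃ s, t < s ∧ s - t ∈ runLengths J ∧ Set.Ico t s ⊆ icoUnion J ∧ s ∉ icoUnion J := by
  obtain ⟨j, hj, hjt, htj⟩ := mem_icoUnion.mp ht
  obtain rfl : j.1 = t := by
    refine hjt.eq_of_not_lt fun hlt => ?_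
    obtain ⟨u, hu, hju, hut⟩ := (hleft.and (Ioo_mem_nhdsLT hlt)).exists
    exact hu (Ico_subset_icoUnion hj ⟨hju.le, hut.trans htj⟩)
  obtain ⟨i, hi, hti, hcov, hunc⟩ := exists_first_notMem_icoUnion hJ ht
  exact ⟨i.2, hti, ⟨sub_pos.mpr hti, j, hj, i, hi, rfl⟩, hcov, hunc⟩

end IcoUnion

theorem finite_addSubmonoid_closure_le {C : Set ℝ} (hC : C.Finite) (hpos : ∀ c ∈ C, 0 < c)
    (B : ℝ) : {r | r ∈ AddSubmonoid.closure C ∧ r ≤ B}.Finite := by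
  have hCt := hC.to_subtype
  obtain ⟨m, hm, hmin⟩ : ∃ m > 0, ∀ c ∈ C, m ≤ c := by
    rcases C.eq_empty_or_nonempty with rfl | hne
    · exact ⟨1, one_pos, by simp⟩
    · obtain ⟨m, hm, hmin⟩ := Set.exists_min_image C id hC hne
      exact ⟨m, hpos m hm, hmin⟩
  obtain ⟨n, hn⟩ := exists_nat_gt (B / m)
  refine ((List.finite_length_le C n).image fun l => (l.map Subtype.val).sum).subset ?_
  rintro r ⟨hr, hB⟩
  obtain ⟨l, hl, rfl⟩ := AddSubmonoid.exists_list_of_mem_closure hr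
  lift l to List C using hl
  refine ⟨l, ?_, rfl⟩
  have hsum := List.card_nsmul_le_sum (l.map Subtype.val) m (by simpa using fun c hc _ => hmin c hc)
  rw [List.length_map, nsmul_eq_mul, ← le_div_iff₀ hm] at hsum
  exact_mod_cast (hsum.trans_lt ((div_le_div_of_nonneg_right hB hm.le).trans_lt hn)).le

section Shapes

/-- The abscissas of the points of `K` on the horizontal axis. -/
def bottom (K : Set (ℝ × ℝ)) : Set ℝ := {x | (x, 0) ∈ K}

/-- The tile `e.2`, translated horizontally by `e.1`. -/
def placed (e : ℝ × Set (ℝ × ℝ)) : Set (ℝ × ℝ) := translate (e.1, 0) e.2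

/-- An anchored tile whose bottom is the union of the finitely many half-open intervals in `J`. -/
structure IsHalfOpenTile (τ : Set (ℝ × ℝ)) (J : Set (ℝ × ℝ)) : Prop where
  anchored : IsAnchored τ
  finite : J.Finite
  bottom_eq : bottom τ = icoUnion J

/-- The tiles in `S` have been placed on the half strip so that `q` is the leftmost bottom point
that is not covered. -/
structure IsConfig (T : Finset (Set (ℝ × ℝ))) (S : Set (ℝ × Set (ℝ × ℝ))) (q : ℝ) : Prop where
  finite : S.Finite
  mem : ∀ e ∈ S, e.2 ∈ T
  start_mem : ∀ e ∈ S, e.1 ∈ Set.Ico 0 q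
  disjoint : S.PairwiseDisjoint placed
  covered : ∀ t ∈ Set.Ico 0 q, ∃ e ∈ S, t ∈ bottom (placed e)
  uncovered : ∀ e ∈ S, q ∉ bottom (placed e)
  nonneg : 0 ≤ q

/-- The region that remains of the half strip, with its leftmost bottom point at the origin. -/
def configRegion (S : Set (ℝ × Set (ℝ × ℝ))) (q : ℝ) : Set (ℝ × ℝ) :=
  translate (-q, 0) (halfStrip 0 \ ⋃ e ∈ S, placed e)

variable {S : Set (ℝ × Set (ℝ × ℝ))} {e : ℝ × Set (ℝ × ℝ)} {q t : ℝ} {τ : Set (ℝ × ℝ)}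

theorem mem_placed {p : ℝ × ℝ} : p ∈ placed e ↔ (p.1 - e.1, p.2) ∈ e.2 := by
  rw [placed, mem_translate, ← Prod.mk.eta (p := p - _), Prod.fst_sub, Prod.snd_sub, sub_zero]

theorem mem_bottom_placed : t ∈ bottom (placed e) ↔ t - e.1 ∈ bottom e.2 := mem_placed

theorem IsHalfOpenTile.bottom_placed {J : Set (ℝ × ℝ)} (h : IsHalfOpenTile e.2 J) :
    bottom (placed e) = icoUnion (translate (e.1, e.1) J) := by
  ext t
  rw [mem_icoUnion_translate, ← h.bottom_eq, mem_bottom_placed]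

theorem mem_configRegion {p : ℝ × ℝ} :
    p ∈ configRegion S q ↔ p ∈ halfStrip (-q) ∧ ∀ e ∈ S, (p.1 + q - e.1, p.2) ∉ e.2 := by
  have hshift : p - (-q, 0) = (p.1 + q, p.2) := by ext <;> simp
  simp [configRegion, mem_translate, hshift, mem_halfStrip, mem_placed, neg_le_iff_add_nonneg]

theorem IsConfig.isAnchored {T : Finset (Set (ℝ × ℝ))} (h : IsConfig T S q) :
    IsAnchored (configRegion S q) := by
  constructor
  · have hstrip : (0, 0) ∈ halfStrip (-q) := axis_mem_halfStrip.mpr (neg_nonpos.mpr h.nonneg)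
    refine mem_configRegion.mpr ⟨hstrip, fun e he hmem => ?_⟩
    exact h.uncovered e he (mem_bottom_placed.mpr (by rwa [zero_add] at hmem))
  · intro x hx
    obtain ⟨hx, hS⟩ := mem_configRegion.mp hx
    by_contra! hneg
    obtain ⟨e, he, hmem⟩ := h.covered (x + q)
      ⟨neg_le_iff_add_nonneg.mp (axis_mem_halfStrip.mp hx), add_lt_of_neg_left q hneg⟩
    exact hS e he (mem_bottom_placed.mp hmem)

theorem isConfig_empty (T : Finset (Set (ℝ × ℝ))) : IsConfig T ∅ 0 where
  finite := Set.finite_empty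
  mem := by simp
  start_mem := by simp
  disjoint := by simp
  covered := by simp
  uncovered := by simp
  nonneg := le_rfl

theorem configRegion_empty : configRegion ∅ 0 = halfStrip 0 := by
  simp only [configRegion, neg_zero, Prod.mk_zero_zero, translate_zero, Set.biUnion_empty,
    Set.sdiff_empty]

theorem placed_subset_of_subset_configRegion (hsub : τ ⊆ configRegion S q) :
    placed (q, τ) ⊆ halfStrip 0 \ ⋃ e ∈ S, placed e := by
  rw [placed, ← translate_subset_translate (v := (-q, 0)), translate_translate, Prod.mk_add_mk,
    neg_add_cancel, add_zero, Prod.mk_zero_zero, translate_zero]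
  exact hsub

theorem translate_configRegion_diff (S : Set (ℝ × Set (ℝ × ℝ))) (τ : Set (ℝ × ℝ)) (q r : ℝ) :
    translate (-r, 0) (configRegion S q \ τ) = configRegion (insert (q, τ) S) (q + r) := by
  have hτ : translate (-(q + r), 0) (placed (q, τ)) = translate (-r, 0) τ := by
    rw [placed, translate_translate, Prod.mk_add_mk, add_zero, neg_add_rev, neg_add_cancel_right]
  rw [configRegion, configRegion, Set.biUnion_insert, Set.union_comm, ← Set.sdiff_sdiff,
    translate_diff, translate_diff _ _ (placed _), hτ, translate_translate, Prod.mk_add_mk,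
    add_zero, neg_add_rev]

theorem exists_first_uncovered {I : Set (ℝ × ℝ) → Set (ℝ × ℝ)} (hS : S.Finite)
    (hI : ∀ e ∈ S, IsHalfOpenTile e.2 (I e.2)) (ht : ∃ e ∈ S, t ∈ bottom (placed e)) :
    ∃ r > t, (∀ u ∈ Set.Ico t r, ∃ e ∈ S, u ∈ bottom (placed e)) ∧
      ∀ e ∈ S, r ∉ bottom (placed e) := by
  set J := ⋃ e ∈ S, translate (e.1, e.1) (I e.2) with hJ
  have hfin : J.Finite := hS.biUnion fun e he => (hI e he).finite.image _
  have hmem u : u ∈ icoUnion J ↔ ∃ e ∈ S, u ∈ bottom (placed e) := by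
    rw [icoUnion, hJ, Set.biUnion_iUnion]
    simp only [Set.biUnion_iUnion, Set.mem_iUnion₂, exists_prop]
    refine exists_congr fun e => and_congr_right fun he => ?_
    rw [(hI e he).bottom_placed, mem_icoUnion]
    rfl
  obtain ⟨i, -, hti, hcov, hunc⟩ := exists_first_notMem_icoUnion hfin ((hmem t).mpr ht)
  exact ⟨i.2, hti, fun u hu => (hmem u).mp (hcov hu), by simpa [hmem] using hunc⟩

variable {T : Finset (Set (ℝ × ℝ))} {I : Set (ℝ × ℝ) → Set (ℝ × ℝ)}

theorem IsConfig.exists_insert (hT : ∀ τ ∈ T, IsHalfOpenTile τ (I τ)) (h : IsConfig T S q)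
    (hτ : τ ∈ T) (hsub : τ ⊆ configRegion S q) :
    ∃ r > q, IsConfig T (insert (q, τ) S) r := by
  have hmem : ∀ e ∈ insert (q, τ) S, e.2 ∈ T := Set.forall_mem_insert.mpr ⟨hτ, h.mem⟩
  have hplaced := placed_subset_of_subset_configRegion hsub
  have hq : q ∈ bottom (placed (q, τ)) := (hT τ hτ).anchored.mem_translate q
  obtain ⟨r, hqr, hcov, hunc⟩ := exists_first_uncovered (h.finite.insert (q, τ))
    (fun e he => hT _ (hmem e he)) ⟨_, Set.mem_insert _ _, hq⟩
  refine ⟨r, hqr, h.finite.insert _, hmem, Set.forall_mem_insert.mpr ⟨⟨h.nonneg, hqr⟩,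
    fun e he => ⟨(h.start_mem e he).1, (h.start_mem e he).2.trans hqr⟩⟩, ?_, fun t ht => ?_, hunc,
    h.nonneg.trans hqr.le⟩
  · refine h.disjoint.insert fun e he _ => Set.disjoint_left.mpr fun p hp hpe => ?_
    exact (hplaced hp).2 (Set.mem_biUnion he hpe)
  · rcases lt_or_ge t q with hlt | hge
    · obtain ⟨e, he, hte⟩ := h.covered t ⟨ht.1, hlt⟩
      exact ⟨e, Set.mem_insert_of_mem _ he, hte⟩
    · exact hcov t ⟨hge, ht.2⟩

theorem IsConfig.exists_run_end (hT : ∀ τ ∈ T, IsHalfOpenTile τ (I τ)) (h : IsConfig T S q)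
    (he : e ∈ S) (htq : t < q) (ht : t ∈ bottom (placed e))
    (hleft : ∀ᶠ u in 𝓝[<] t, u ∉ bottom (placed e)) :
    ∃ s, t < s ∧ s - t ∈ runLengths (I e.2) ∧ (s = q ∨ s < q ∧
      ∃ e' ∈ S, s ∈ bottom (placed e') ∧ ∀ᶠ u in 𝓝[<] s, u ∉ bottom (placed e')) := by
  have heT := hT _ (h.mem e he)
  rw [heT.bottom_placed] at ht hleft
  obtain ⟨s, hts, hlen, hcov, hunc⟩ := exists_run (heT.finite.image _) ht hleft
  rw [← translate, runLengths_translate] at hlen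
  rw [← translate, ← heT.bottom_placed] at hcov hunc
  refine ⟨s, hts, hlen, ?_⟩
  have hsq : s ≤ q := not_lt.mp fun hqs => h.uncovered e he (hcov ⟨htq.le, hqs⟩)
  refine hsq.eq_or_lt.imp_right fun hsq => ⟨hsq, ?_⟩
  have hstart : 0 ≤ t - e.1 := heT.anchored.2 _ (mem_bottom_placed.mp (hcov ⟨le_rfl, hts⟩))
  have hs : 0 ≤ s := by linarith [(h.start_mem e he).1]
  obtain ⟨e', he', hse'⟩ := h.covered s ⟨hs, hsq⟩
  refine ⟨e', he', hse', ?_⟩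
  have hne : e ≠ e' := by rintro rfl; exact hunc hse'
  filter_upwards [Ioo_mem_nhdsLT hts] with u hu hue'
  exact Set.disjoint_left.mp (h.disjoint he he' hne) (hcov ⟨hu.1.le, hu.2⟩) hue'

theorem IsConfig.sub_mem_closure (hT : ∀ τ ∈ T, IsHalfOpenTile τ (I τ)) (h : IsConfig T S q)
    (he : e ∈ S) (htq : t < q) (ht : t ∈ bottom (placed e))
    (hleft : ∀ᶠ u in 𝓝[<] t, u ∉ bottom (placed e)) :
    q - t ∈ AddSubmonoid.closure (⋃ τ ∈ T, runLengths (I τ)) := by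
  set C := ⋃ τ ∈ T, runLengths (I τ)
  have hfin : C.Finite := T.finite_toSet.biUnion fun τ hτ => finite_runLengths (hT τ hτ).finite
  have := hfin.to_subtype
  have hpos (c : C) : 0 < (c : ℝ) := by
    obtain ⟨τ, -, hc⟩ := Set.mem_iUnion₂.mp c.2
    exact hc.1
  obtain ⟨L, hL⟩ : ∃ L, q - t = L := ⟨_, rfl⟩
  induction L using induction_sub_of_forall_pos Subtype.val hpos generalizing e t with
  | neg L hneg => exact absurd htq (by linarith)
  | step L _ ih =>
    obtain ⟨s, -, hlen, hs⟩ := h.exists_run_end hT he htq ht hleft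
    have hc : s - t ∈ C := Set.mem_biUnion (h.mem e he) hlen
    rcases hs with rfl | ⟨hsq, e', he', hse', hleft'⟩
    · exact AddSubmonoid.subset_closure hc
    · have hrest := ih ⟨s - t, hc⟩ he' hsq hse' hleft' (by simp only; linarith)
      rw [← sub_add_sub_cancel q s t]
      exact add_mem hrest (AddSubmonoid.subset_closure hc)

theorem IsConfig.sub_start_mem_closure (hT : ∀ τ ∈ T, IsHalfOpenTile τ (I τ))
    (h : IsConfig T S q) (he : e ∈ S) :
    q - e.1 ∈ AddSubmonoid.closure (⋃ τ ∈ T, runLengths (I τ)) := by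
  have hanch := (hT _ (h.mem e he)).anchored
  refine h.sub_mem_closure hT he (h.start_mem e he).2 (hanch.mem_translate _) ?_
  filter_upwards [self_mem_nhdsWithin] with u hu hmem
  exact (sub_neg.mpr hu).not_ge (hanch.2 _ (mem_bottom_placed.mp hmem))

theorem IsConfig.mem_closure (hT : ∀ τ ∈ T, IsHalfOpenTile τ (I τ)) (h : IsConfig T S q) :
    q ∈ AddSubmonoid.closure (⋃ τ ∈ T, runLengths (I τ)) := by
  rcases h.nonneg.eq_or_lt with rfl | hq
  · exact zero_mem _
  · obtain ⟨e, he, hmem⟩ := h.covered 0 ⟨le_rfl, hq⟩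
    have hle : 0 ≤ 0 - e.1 := (hT _ (h.mem e he)).anchored.2 _ (mem_bottom_placed.mp hmem)
    have hzero : e.1 = 0 := le_antisymm (by linarith) (h.start_mem e he).1
    simpa [hzero] using h.sub_start_mem_closure hT he

/-- The shapes of remaining regions that do not reach farther than `W` to the left of their leftmost
bottom point. -/
def liveShapes (T : Finset (Set (ℝ × ℝ))) (W : ℝ) : Set (Set (ℝ × ℝ)) :=
  {R | (∀ p ∈ R, -W ≤ p.1) ∧ ∃ S q, IsConfig T S q ∧ R = configRegion S q}

theorem IsConfig.configRegion_eq {W : ℝ} (h : IsConfig T S q) (hW : ∀ τ ∈ T, ∀ p ∈ τ, p.1 ≤ W)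
    (hlive : ∀ p ∈ configRegion S q, -W ≤ p.1) :
    configRegion S q = halfStrip (-min q W) \
      ⋃ e ∈ (fun e : ℝ × Set (ℝ × ℝ) => (q - e.1, e.2)) '' {e ∈ S | q - e.1 ≤ 2 * W},
        placed (-e.1, e.2) := by
  ext p
  simp only [Set.mem_sdiff, Set.mem_iUnion₂, Set.exists_mem_image, mem_placed, not_exists,
    sub_neg_eq_add, ← add_sub_assoc, exists_prop, not_and]
  constructor
  · intro hp
    obtain ⟨hstrip, hS⟩ := mem_configRegion.mp hp
    exact ⟨⟨neg_le.mpr (le_min (neg_le.mp hstrip.1) (neg_le.mp (hlive p hp))), hstrip.2⟩,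
      fun e he => hS e he.1⟩
  · rintro ⟨⟨hmin, hheight⟩, hS⟩
    have hp : -min q W ≤ p.1 := hmin
    refine mem_configRegion.mpr ⟨⟨(neg_le_neg (min_le_left q W)).trans hp, hheight⟩,
      fun e he hmem => hS e ⟨he, ?_⟩ hmem⟩
    have hright : p.1 + q - e.1 ≤ W := hW _ (h.mem e he) _ hmem
    linarith [min_le_right q W]

theorem finite_liveShapes (hT : ∀ τ ∈ T, IsHalfOpenTile τ (I τ)) {W : ℝ} (hW0 : 0 ≤ W)
    (hW : ∀ τ ∈ T, ∀ p ∈ τ, p.1 ≤ W) : (liveShapes T W).Finite := by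
  set A : Set ℝ := {r | r ∈ AddSubmonoid.closure (⋃ τ ∈ T, runLengths (I τ)) ∧ r ≤ 2 * W}
  have hfin : A.Finite := finite_addSubmonoid_closure_le
    (T.finite_toSet.biUnion fun τ hτ => finite_runLengths (hT τ hτ).finite)
    (by simp only [Set.mem_iUnion₂]; rintro c ⟨τ, -, hc⟩; exact hc.1) _
  refine (Set.Finite.image2 (fun m S' => halfStrip (-m) \ ⋃ e ∈ S', placed (-e.1, e.2))
    (hfin.insert W) (hfin.prod T.finite_toSet).finite_subsets).subset ?_
  rintro _ ⟨hlive, S, q, h, rfl⟩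
  refine ⟨min q W, ?_, _, ?_, (h.configRegion_eq hW hlive).symm⟩
  · rcases le_total q W with hq | hq
    · exact Set.mem_insert_of_mem _ ⟨by rw [min_eq_left hq]; exact h.mem_closure hT,
        (min_le_right q W).trans (by linarith)⟩
    · exact Set.mem_insert_iff.mpr (.inl (min_eq_right hq))
  · rintro _ ⟨e, ⟨he, hle⟩, rfl⟩
    exact ⟨⟨h.sub_start_mem_closure hT he, hle⟩, h.mem e he⟩

theorem mem_diagonals_of_remCount (hT : ∀ τ ∈ T, IsHalfOpenTile τ (I τ)) {W : ℝ} (hW0 : 0 ≤ W)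
    (hW : ∀ τ ∈ T, ∀ p ∈ τ, -W ≤ p.1 ∧ p.1 ≤ W) {ε : ℝ} (hε : 0 ≤ ε) {f : ℕ → ℕ}
    (hf : ∀ n : ℕ, remCount T (halfStrip 0) (n + ε) = f n) : f ∈ diagonals := by
  refine mem_diagonals_of_finite_shapes T (fun τ hτ => (hT τ hτ).anchored)
    (finite_liveShapes hT hW0 fun τ hτ p hp => (hW τ hτ p hp).2) ?_ ?_ ?_ hε hf
  · refine ⟨fun p hp => ?_, ∅, 0, isConfig_empty T, configRegion_empty.symm⟩
    linarith [(mem_halfStrip.mp hp).1]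
  · rintro _ ⟨-, S, q, h, rfl⟩
    exact h.isAnchored
  · rintro _ ⟨-, S, q, h, rfl⟩ τ hτ hsub
    obtain ⟨r, hqr, h'⟩ := h.exists_insert hT hτ hsub
    have hregion := translate_configRegion_diff S τ q (r - q)
    rw [add_sub_cancel] at hregion
    refine or_iff_not_imp_left.mpr fun hdead ℓ => ?_
    obtain ⟨p, hp, hpW⟩ : ∃ p ∈ configRegion (insert (q, τ) S) r, p.1 < -W := by
      by_contra! hlive
      exact hdead ⟨r - q, sub_pos.mpr hqr, hregion ▸ ⟨hlive, _, _, h', rfl⟩⟩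
    rw [← remCount_translate T _ (-(r - q)), hregion]
    exact remCount_eq_zero_of_lt (fun τ hτ => (hT τ hτ).anchored)
      (fun τ hτ p hp => (hW τ hτ p hp).1) h'.isAnchored.2 hp (by rwa [zero_sub]) hW0 _

end Shapes

/-! ### Closed regions and their half-open counterparts -/

section Germs

variable {K L : Set (ℝ × ℝ)} {p v : ℝ × ℝ}

/-- The points `p` such that `K` contains all points near `p` that are `≥ p` in both coordinates.
This turns closed tiles with disjoint interiors into disjoint half-open tiles. -/
def germs (K : Set (ℝ × ℝ)) : Set (ℝ × ℝ) := {p | K ∈ 𝓝[≥] p}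

theorem germs_subset (K : Set (ℝ × ℝ)) : germs K ⊆ K :=
  fun _ hp => mem_of_mem_nhdsWithin Set.self_mem_Ici hp

theorem germs_mono (h : K ⊆ L) : germs K ⊆ germs L :=
  fun p (hp : K ∈ 𝓝[≥] p) => mem_of_superset hp h

theorem germs_empty : germs ∅ = ∅ := Set.subset_empty_iff.mp (germs_subset ∅)

theorem translate_germs_subset (v : ℝ × ℝ) (K : Set (ℝ × ℝ)) :
    translate v (germs K) ⊆ germs (translate v K) := by
  rintro _ ⟨p, hp, rfl⟩
  have hemb := (Homeomorph.addLeft v).isOpenEmbedding.map_nhdsWithin_eq (Set.Ici p) p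
  have himage : Homeomorph.addLeft v '' Set.Ici p = Set.Ici (v + p) := Set.image_const_add_Ici _ _
  rw [himage] at hemb
  change translate v K ∈ 𝓝[≥] (v + p)
  exact hemb.ge (image_mem_map hp)

theorem germs_translate (v : ℝ × ℝ) (K : Set (ℝ × ℝ)) :
    germs (translate v K) = translate v (germs K) := by
  refine Set.Subset.antisymm ?_ (translate_germs_subset v K)
  have hback := translate_germs_subset (-v) (translate v K)
  rw [translate_translate, neg_add_cancel, translate_zero] at hback
  rw [← translate_subset_translate (v := -v), translate_translate, neg_add_cancel, translate_zero]
  exact hback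

theorem interior_subset_germs (K : Set (ℝ × ℝ)) : interior K ⊆ germs K :=
  fun _ hp => mem_nhdsWithin_of_mem_nhds (mem_interior_iff_mem_nhds.mp hp)

theorem nhdsGT_prod_le (p : ℝ × ℝ) : 𝓝[>] p.1 ×ˢ 𝓝[>] p.2 ≤ 𝓝[≥] p := by
  rw [← nhdsWithin_prod_eq]
  exact nhdsWithin_mono p fun q hq => ⟨hq.1.le, hq.2.le⟩

theorem eventually_mem_interior_of_mem_germs (hp : p ∈ germs K) :
    ∀ᶠ q in 𝓝[>] p.1 ×ˢ 𝓝[>] p.2, q ∈ interior K := by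
  have hright : ∀ᶠ q in 𝓝[>] p.1 ×ˢ 𝓝[>] p.2, p.1 < q.1 ∧ p.2 < q.2 :=
    prod_mem_prod self_mem_nhdsWithin self_mem_nhdsWithin
  filter_upwards [nhdsGT_prod_le p (eventually_eventually_nhdsWithin.mpr hp), hright] with q
    (hq : K ∈ 𝓝[Set.Ici p] q) hpq
  refine mem_interior_iff_mem_nhds.mpr ?_
  have hnhds : Set.Ici p ∈ 𝓝 q := by
    rw [← Set.Ici_prod_Ici]
    exact prod_mem_nhds (Ici_mem_nhds hpq.1) (Ici_mem_nhds hpq.2)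
  rwa [nhdsWithin_eq_nhds.mpr hnhds] at hq

theorem disjoint_germs_iff : Disjoint (germs K) (germs L) ↔ Disjoint (interior K) (interior L) := by
  refine ⟨.mono (interior_subset_germs K) (interior_subset_germs L), fun h => ?_⟩
  refine Set.disjoint_left.mpr fun p hK hL => ?_
  obtain ⟨q, hqK, hqL⟩ := ((eventually_mem_interior_of_mem_germs hK).and
    (eventually_mem_interior_of_mem_germs hL)).exists
  exact Set.disjoint_left.mp h hqK hqL

/-- The half-open box with lower left corner `b.1` and upper right corner `b.2`. -/
def halfOpenBox (b : (ℝ × ℝ) × (ℝ × ℝ)) : Set (ℝ × ℝ) :=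
  Set.Ico b.1.1 b.2.1 ×ˢ Set.Ico b.1.2 b.2.2

variable {b : (ℝ × ℝ) × (ℝ × ℝ)}

theorem halfOpenBox_subset_germs (b : (ℝ × ℝ) × (ℝ × ℝ)) :
    halfOpenBox b ⊆ germs (Set.Icc b.1 b.2) := by
  rintro p ⟨⟨h₁, h₁'⟩, h₂, h₂'⟩
  filter_upwards [self_mem_nhdsWithin,
    mem_nhdsWithin_of_mem_nhds (prod_mem_nhds (Iic_mem_nhds h₁') (Iic_mem_nhds h₂'))] with q hpq hqb
  exact ⟨⟨h₁.trans hpq.1, h₂.trans hpq.2⟩, hqb⟩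

theorem mem_Ico_of_frequently_mem_Icc {a b x : ℝ} (h : ∃ᶠ y in 𝓝[>] x, y ∈ Set.Icc a b) :
    x ∈ Set.Ico a b := by
  constructor
  · by_contra! hlt
    obtain ⟨y, hy, hya⟩ := (h.and_eventually (nhdsWithin_le_nhds (Iio_mem_nhds hlt))).exists
    exact hy.1.not_gt hya
  · obtain ⟨y, hy, hxy⟩ := (h.and_eventually self_mem_nhdsWithin).exists
    exact lt_of_lt_of_le hxy hy.2

theorem mem_halfOpenBox_of_frequently
    (h : ∃ᶠ q in 𝓝[>] p.1 ×ˢ 𝓝[>] p.2, q ∈ Set.Icc b.1 b.2) : p ∈ halfOpenBox b :=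
  ⟨mem_Ico_of_frequently_mem_Icc (tendsto_fst.frequently (h.mono fun _ hq => ⟨hq.1.1, hq.2.1⟩)),
    mem_Ico_of_frequently_mem_Icc (tendsto_snd.frequently (h.mono fun _ hq => ⟨hq.1.2, hq.2.2⟩))⟩

theorem frequently_mem_of_mem_germs (hp : p ∈ germs K) :
    ∃ᶠ q in 𝓝[>] p.1 ×ˢ 𝓝[>] p.2, q ∈ K :=
  Eventually.frequently (nhdsGT_prod_le p hp)

theorem germs_biUnion_Icc (s : Finset ((ℝ × ℝ) × (ℝ × ℝ))) :
    germs (⋃ b ∈ s, Set.Icc b.1 b.2) = ⋃ b ∈ s, halfOpenBox b := by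
  refine Set.Subset.antisymm (fun p hp => ?_) (Set.iUnion₂_subset fun b hb =>
    (halfOpenBox_subset_germs b).trans (germs_mono fun q hq => Set.mem_biUnion hb hq))
  have hfreq := frequently_mem_of_mem_germs hp
  simp only [Set.mem_iUnion₂, exists_prop, frequently_exists_finset] at hfreq
  obtain ⟨b, hb, hfreq⟩ := hfreq
  exact Set.mem_biUnion hb (mem_halfOpenBox_of_frequently hfreq)

theorem germs_Icc (b : (ℝ × ℝ) × (ℝ × ℝ)) : germs (Set.Icc b.1 b.2) = halfOpenBox b := by
  simpa using germs_biUnion_Icc {b}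

theorem closure_halfOpenBox (h₁ : b.1.1 < b.2.1) (h₂ : b.1.2 < b.2.2) :
    closure (halfOpenBox b) = Set.Icc b.1 b.2 := by
  rw [halfOpenBox, closure_prod_eq, closure_Ico h₁.ne, closure_Ico h₂.ne, Set.Icc_prod_Icc]

theorem IsAxisParallelRegion.closure_germs (h : IsAxisParallelRegion K) :
    closure (germs K) = K := by
  obtain ⟨s, hs, rfl⟩ := h
  rw [germs_biUnion_Icc, Finset.closure_biUnion]
  exact Set.iUnion₂_congr fun b hb => closure_halfOpenBox (hs b hb).1 (hs b hb).2

theorem IsAxisParallelRegion.isBounded (h : IsAxisParallelRegion K) : Bornology.IsBounded K := by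
  obtain ⟨s, -, rfl⟩ := h
  exact (Bornology.isBounded_biUnion_finset s).mpr fun b _ => Metric.isBounded_Icc b.1 b.2

theorem IsAxisParallelRegion.translate (h : IsAxisParallelRegion K) (v : ℝ × ℝ) :
    IsAxisParallelRegion (translate v K) := by
  classical
  obtain ⟨s, hs, rfl⟩ := h
  refine ⟨s.image fun b => (v + b.1, v + b.2), ?_, ?_⟩
  · simpa only [Finset.forall_mem_image, Prod.fst_add, Prod.snd_add, add_lt_add_iff_left] using hs
  · simp only [Finset.mem_image, Set.iUnion_exists, Set.biUnion_and', Set.iUnion_iUnion_eq_right,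
      IrrationalTiling.translate, Set.image_iUnion, Set.image_const_add_Icc]

theorem IsAxisParallelRegion.interior_nonempty (h : IsAxisParallelRegion K) (hne : K.Nonempty) :
    (interior K).Nonempty := by
  rw [← h.closure_germs, closure_nonempty_iff] at hne
  obtain ⟨p, hp⟩ := hne
  exact (eventually_mem_interior_of_mem_germs hp).exists

theorem IsAxisParallelRegion.mem_germs_of_frequently (h : IsAxisParallelRegion K)
    (hp : ∃ᶠ q in 𝓝[>] p.1 ×ˢ 𝓝[>] p.2, q ∈ K) : p ∈ germs K := by
  obtain ⟨s, -, rfl⟩ := h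
  simp only [Set.mem_iUnion₂, exists_prop, frequently_exists_finset] at hp
  obtain ⟨b, hb, hfreq⟩ := hp
  rw [germs_biUnion_Icc]
  exact Set.mem_biUnion hb (mem_halfOpenBox_of_frequently hfreq)

theorem germs_sUnion {P : Set (Set (ℝ × ℝ))} (hP : P.Finite)
    (h : ∀ K ∈ P, IsAxisParallelRegion K) : germs (⋃₀ P) = ⋃ K ∈ P, germs K := by
  refine Set.Subset.antisymm (fun p hp => ?_)
    (Set.iUnion₂_subset fun K hK => germs_mono (Set.subset_sUnion_of_mem hK))
  obtain ⟨K, hK, hfreq⟩ := (frequently_exists_finite hP).mp (frequently_mem_of_mem_germs hp)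
  exact Set.mem_biUnion hK ((h K hK).mem_germs_of_frequently hfreq)

end Germs

section Translate

variable (v : ℝ × ℝ) (K : Set (ℝ × ℝ))

theorem interior_translate : interior (translate v K) = translate v (interior K) :=
  ((Homeomorph.addLeft v).image_interior K).symm

theorem volume_translate : MeasureTheory.volume (translate v K) = MeasureTheory.volume K := by
  rw [translate, Set.image_add_left, MeasureTheory.measure_preimage_add]

end Translate

theorem finite_of_pairwiseDisjoint_interior {T P : Set (Set (ℝ × ℝ))} (hT : T.Finite)
    (hint : ∀ τ ∈ T, (interior τ).Nonempty)
    (hpieces : ∀ K ∈ P, ∃ τ ∈ T, ∃ v : ℝ × ℝ, K = translate v τ)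
    (hdisj : P.PairwiseDisjoint interior) (hB : Bornology.IsBounded (⋃₀ P)) : P.Finite := by
  have hcov : P ⊆ ⋃ τ ∈ T, {K ∈ P | ∃ v, K = translate v τ} := fun K hK => by
    obtain ⟨τ, hτ, v, hv⟩ := hpieces K hK
    exact Set.mem_biUnion hτ ⟨hK, v, hv⟩
  refine (hT.biUnion fun τ hτ => ?_).subset hcov
  have hfin := MeasureTheory.Measure.finite_const_le_meas_of_disjoint_iUnion
    (MeasureTheory.volume : MeasureTheory.Measure (ℝ × ℝ))
    (isOpen_interior.measure_pos MeasureTheory.volume (hint τ hτ))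
    (As := fun K : {K ∈ P | ∃ v, K = translate v τ} => interior (K : Set (ℝ × ℝ)))
    (fun K => isOpen_interior.measurableSet)
    (fun K L hne => hdisj K.2.1 L.2.1 (Subtype.coe_ne_coe.mpr hne))
    (ne_top_of_le_ne_top hB.measure_lt_top.ne (MeasureTheory.measure_mono
      (Set.iUnion_subset fun K => interior_subset.trans (Set.subset_sUnion_of_mem K.2.1))))
  refine Set.finite_coe_iff.mp (Set.finite_univ_iff.mp (hfin.subset ?_))
  rintro ⟨_, hK, v, rfl⟩ -
  rw [Set.mem_ofPred_eq, interior_translate, volume_translate]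

theorem rectangle_subset (L : ℝ) : rectangle L ⊆ Set.Icc 0 L ×ˢ Set.Icc 0 1 := by
  rw [rectangle]
  split_ifs
  exacts [subset_rfl, Set.empty_subset _]

theorem isBounded_rectangle (L : ℝ) : Bornology.IsBounded (rectangle L) :=
  ((Metric.isBounded_Icc 0 L).prod (Metric.isBounded_Icc 0 1)).subset (rectangle_subset L)

theorem germs_rectangle (L : ℝ) : germs (rectangle L) = halfStrip 0 \ halfStrip L := by
  have hdiff : halfStrip 0 \ halfStrip L = halfOpenBox ((0, 0), (L, 1)) := by
    ext p
    simp only [Set.mem_sdiff, mem_halfStrip, halfOpenBox, Set.mem_prod, Set.mem_Ico]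
    grind
  rw [hdiff, rectangle]
  split_ifs with hL
  · rw [Set.Icc_prod_Icc]
    exact germs_Icc ((0, 0), (L, 1))
  · simp [germs_empty, halfOpenBox, Set.Ico_eq_empty hL]

theorem closure_germs_rectangle (L : ℝ) : closure (germs (rectangle L)) = rectangle L := by
  by_cases hL : 0 < L
  · refine IsAxisParallelRegion.closure_germs ⟨{((0, 0), (L, 1))}, by simpa using hL, ?_⟩
    simp [rectangle, hL, Set.Icc_prod_Icc]
  · simp [rectangle, hL, germs_empty]

section TilingPartition

variable {T P : Set (Set (ℝ × ℝ))} {Γ : Set (ℝ × ℝ)} {L : ℝ}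

theorem isTiling_image_translate (v : Set (ℝ × ℝ) → ℝ × ℝ) :
    IsTiling ((fun τ => translate (v τ) τ) '' T) Γ P ↔ IsTiling T Γ P := by
  refine ⟨fun h => ⟨fun K hK => ?_, h.nonoverlapping, h.covers⟩,
    fun h => ⟨fun K hK => ?_, h.nonoverlapping, h.covers⟩⟩
  · obtain ⟨_, ⟨τ, hτ, rfl⟩, u, rfl⟩ := h.pieces K hK
    exact ⟨τ, hτ, u + v τ, translate_translate ..⟩
  · obtain ⟨τ, hτ, u, rfl⟩ := h.pieces K hK
    exact ⟨_, ⟨τ, hτ, rfl⟩, u - v τ, by rw [translate_translate, sub_add_cancel]⟩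

theorem IsTiling.isAxisParallelRegion (hP : IsTiling T Γ P)
    (hreg : ∀ τ ∈ T, IsAxisParallelRegion τ) : ∀ K ∈ P, IsAxisParallelRegion K := by
  intro K hK
  obtain ⟨τ, hτ, u, rfl⟩ := hP.pieces K hK
  exact (hreg τ hτ).translate u

theorem snd_eq_zero_of_translate_subset {τ : Set (ℝ × ℝ)} {v : ℝ × ℝ} {B : Set ℝ}
    (hτ : Prod.snd '' τ = Set.Icc 0 1) (hsub : translate v τ ⊆ B ×ˢ Set.Icc 0 1) : v.2 = 0 := by
  have hshift {y : ℝ} (hy : y ∈ Set.Icc 0 1) : v.2 + y ∈ Set.Icc 0 1 := by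
    rw [← hτ] at hy
    obtain ⟨p, hp, rfl⟩ := hy
    exact (hsub ⟨p, hp, rfl⟩).2
  linarith [(hshift (y := 0) (by simp)).1, (hshift (y := 1) (by simp)).2]

theorem interior_nonempty_of_image_snd (hreg : ∀ τ ∈ T, IsAxisParallelRegion τ)
    (hheight : ∀ τ ∈ T, Prod.snd '' τ = Set.Icc 0 1) : ∀ τ ∈ T, (interior τ).Nonempty := by
  refine fun τ hτ => (hreg τ hτ).interior_nonempty (Set.Nonempty.of_image (f := Prod.snd) ?_)
  rw [hheight τ hτ]
  exact Set.nonempty_Icc.mpr zero_le_one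

theorem IsTiling.isPartition_germs (hP : IsTiling T (rectangle L) P) (hT : T.Finite)
    (hreg : ∀ τ ∈ T, IsAxisParallelRegion τ) (hheight : ∀ τ ∈ T, Prod.snd '' τ = Set.Icc 0 1) :
    IsPartition (germs '' T) (halfStrip 0 \ halfStrip L) (germs '' P) where
  pieces := by
    rintro _ ⟨K, hK, rfl⟩
    obtain ⟨τ, hτ, u, rfl⟩ := hP.pieces K hK
    have hu : u.2 = 0 := snd_eq_zero_of_translate_subset (hheight τ hτ)
      ((Set.subset_sUnion_of_mem hK).trans (hP.covers.trans_subset (rectangle_subset L)))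
    exact ⟨_, ⟨τ, hτ, rfl⟩, u.1, by rw [← hu, germs_translate]⟩
  disjoint := by
    rintro _ ⟨K, hK, rfl⟩ _ ⟨K', hK', rfl⟩ hne
    exact disjoint_germs_iff.mpr (hP.nonoverlapping K hK K' hK' fun h => hne (by rw [h]))
  covers := by
    have hfin : P.Finite := finite_of_pairwiseDisjoint_interior hT
      (interior_nonempty_of_image_snd hreg hheight) hP.pieces hP.nonoverlapping
      (hP.covers ▸ isBounded_rectangle L)
    rw [Set.sUnion_image, ← germs_sUnion hfin (hP.isAxisParallelRegion hreg), hP.covers,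
      germs_rectangle]

theorem IsPartition.exists_eq_germs_translate (hP : IsPartition (germs '' T) Γ P)
    {K : Set (ℝ × ℝ)} (hK : K ∈ P) : ∃ τ ∈ T, ∃ v, K = germs (IrrationalTiling.translate v τ) := by
  obtain ⟨_, ⟨τ, hτ, rfl⟩, x, rfl⟩ := hP.pieces K hK
  exact ⟨τ, hτ, (x, 0), (germs_translate ..).symm⟩

theorem IsPartition.germs_closure (hP : IsPartition (germs '' T) Γ P)
    (hreg : ∀ τ ∈ T, IsAxisParallelRegion τ) {K : Set (ℝ × ℝ)} (hK : K ∈ P) :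
    germs (closure K) = K := by
  obtain ⟨τ, hτ, v, rfl⟩ := hP.exists_eq_germs_translate hK
  rw [((hreg τ hτ).translate v).closure_germs]

theorem IsPartition.isTiling_closure
    (hP : IsPartition (germs '' T) (halfStrip 0 \ halfStrip L) P) (hT : T.Finite)
    (hreg : ∀ τ ∈ T, IsAxisParallelRegion τ) (hheight : ∀ τ ∈ T, Prod.snd '' τ = Set.Icc 0 1) :
    IsTiling T (rectangle L) (closure '' P) where
  pieces := by
    rintro _ ⟨K, hK, rfl⟩
    obtain ⟨τ, hτ, v, rfl⟩ := hP.exists_eq_germs_translate hK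
    exact ⟨τ, hτ, v, ((hreg τ hτ).translate v).closure_germs⟩
  nonoverlapping := by
    rintro _ ⟨K, hK, rfl⟩ _ ⟨K', hK', rfl⟩ hne
    rw [← disjoint_germs_iff, hP.germs_closure hreg hK, hP.germs_closure hreg hK']
    exact hP.disjoint hK hK' fun h => hne (by rw [h])
  covers := by
    have hint : ∀ τ ∈ germs '' T, (interior τ).Nonempty := by
      rintro _ ⟨τ, hτ, rfl⟩
      exact (interior_nonempty_of_image_snd hreg hheight τ hτ).mono
        (interior_maximal (interior_subset_germs τ) isOpen_interior)
    have hfin : P.Finite := finite_of_pairwiseDisjoint_interior (hT.image _) hint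
      (fun K hK => (hP.pieces K hK).imp fun _ h => h.imp_right fun ⟨x, hx⟩ => ⟨_, hx⟩)
      (hP.disjoint.mono fun _ => interior_subset)
      (by rw [hP.covers, ← germs_rectangle]; exact (isBounded_rectangle L).subset (germs_subset _))
    rw [Set.sUnion_image, ← hfin.closure_biUnion, ← Set.sUnion_eq_biUnion, hP.covers,
      ← germs_rectangle, closure_germs_rectangle]

theorem encard_isTiling_eq_remCount (hT : T.Finite) (hreg : ∀ τ ∈ T, IsAxisParallelRegion τ)
    (hheight : ∀ τ ∈ T, Prod.snd '' τ = Set.Icc 0 1) (hL : 0 ≤ L) :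
    {P | IsTiling T (rectangle L) P}.encard = remCount (germs '' T) (halfStrip 0) L := by
  have hstrip : halfStrip L ⊆ halfStrip 0 :=
    Set.prod_mono (Set.Ici_subset_Ici.mpr hL) subset_rfl
  rw [remCount, if_pos hstrip, partitionCount]
  have hinv : Set.InvOn (Set.image closure) (Set.image germs) {P | IsTiling T (rectangle L) P}
      {P | IsPartition (germs '' T) (halfStrip 0 \ halfStrip L) P} := by
    constructor
    · intro P hP
      rw [Set.image_image, Set.image_congr fun K hK =>
        (IsTiling.isAxisParallelRegion hP hreg K hK).closure_germs, Set.image_id']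
    · intro P hP
      rw [Set.image_image, Set.image_congr fun K hK => IsPartition.germs_closure hP hreg hK,
        Set.image_id']
  have hbij := hinv.bijOn (fun _ hP => IsTiling.isPartition_germs hP hT hreg hheight)
    fun _ hP => IsPartition.isTiling_closure hP hT hreg hheight
  rw [← hbij.image_eq, hbij.injOn.encard_image]

end TilingPartition

theorem exists_isLeast_icoUnion {J : Set (ℝ × ℝ)} (hJ : J.Finite) (hne : J.Nonempty)
    (hlt : ∀ i ∈ J, i.1 < i.2) : ∃ x, IsLeast (icoUnion J) x := by
  obtain ⟨i, hi, hmin⟩ := Set.exists_min_image J Prod.fst hJ hne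
  refine ⟨i.1, Ico_subset_icoUnion hi ⟨le_rfl, hlt i hi⟩, fun t ht => ?_⟩
  obtain ⟨j, hj, hjt, -⟩ := mem_icoUnion.mp ht
  exact (hmin j hj).trans hjt

theorem bottom_biUnion_halfOpenBox {s : Set ((ℝ × ℝ) × (ℝ × ℝ))}
    (hlow : ∀ b ∈ s, 0 ≤ b.1.2 ∧ b.1.2 < b.2.2) :
    bottom (⋃ b ∈ s, halfOpenBox b) =
      icoUnion ((fun b => (b.1.1, b.2.1)) '' {b ∈ s | b.1.2 = 0}) := by
  ext x
  simp only [bottom, Set.mem_ofPred_eq, Set.mem_iUnion₂, exists_prop, halfOpenBox, Set.mem_prod,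
    Set.mem_Ico, mem_icoUnion, Set.exists_mem_image]
  refine exists_congr fun b => ?_
  constructor
  · rintro ⟨hb, hx, hle, -⟩
    exact ⟨⟨hb, hle.antisymm (hlow b hb).1⟩, hx⟩
  · rintro ⟨⟨hb, h0⟩, hx⟩
    exact ⟨hb, hx, h0.le, h0 ▸ (hlow b hb).2⟩

theorem bottom_translate (x : ℝ) (K : Set (ℝ × ℝ)) {J : Set (ℝ × ℝ)} (hK : bottom K = icoUnion J) :
    bottom (translate (x, 0) K) = icoUnion (translate (x, x) J) := by
  ext t
  rw [mem_icoUnion_translate, ← hK]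
  exact mem_bottom_placed (e := (x, K))

theorem IsAxisParallelRegion.exists_isHalfOpenTile {K : Set (ℝ × ℝ)} (h : IsAxisParallelRegion K)
    (hK : IsLeast (Prod.snd '' K) 0) :
    ∃ x J, IsHalfOpenTile (germs (IrrationalTiling.translate (x, 0) K)) J := by
  obtain ⟨s, hs, rfl⟩ := h
  have hlow : ∀ b ∈ s, 0 ≤ b.1.2 := fun b hb =>
    hK.2 ⟨b.1, Set.mem_biUnion hb ⟨le_rfl, (hs b hb).1.le, (hs b hb).2.le⟩, rfl⟩
  obtain ⟨b, hb, hb0⟩ : ∃ b ∈ s, b.1.2 = 0 := by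
    obtain ⟨p, hp, hp0⟩ := hK.1
    obtain ⟨b, hb, hpb⟩ := Set.mem_iUnion₂.mp hp
    exact ⟨b, hb, le_antisymm (hp0 ▸ hpb.1.2) (hlow b hb)⟩
  set J : Set (ℝ × ℝ) := (fun b : (ℝ × ℝ) × (ℝ × ℝ) => (b.1.1, b.2.1)) '' {b | b ∈ s ∧ b.1.2 = 0}
  have hbottom : bottom (germs (⋃ b ∈ s, Set.Icc b.1 b.2)) = icoUnion J := by
    rw [germs_biUnion_Icc]
    exact bottom_biUnion_halfOpenBox fun b hb => ⟨hlow b hb, (hs b hb).2⟩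
  have hJ : J.Finite := (s.finite_toSet.subset (Set.sep_subset _ _)).image _
  have hlt : ∀ i ∈ J, i.1 < i.2 := by
    rintro _ ⟨b, hb, rfl⟩
    exact (hs b hb.1).1
  obtain ⟨x, hx⟩ := exists_isLeast_icoUnion hJ ⟨_, Set.mem_image_of_mem _ ⟨hb, hb0⟩⟩ hlt
  refine ⟨-x, IrrationalTiling.translate (-x, -x) J, ?_, hJ.image _, ?_⟩
  all_goals rw [germs_translate]
  · have hmem t : (t, 0) ∈ IrrationalTiling.translate (-x, 0) (germs (⋃ b ∈ s, Set.Icc b.1 b.2)) ↔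
        t + x ∈ icoUnion J := by
      rw [← sub_neg_eq_add, ← mem_icoUnion_translate, ← bottom_translate _ _ hbottom]
      rfl
    exact ⟨(hmem 0).mpr (by rw [zero_add]; exact hx.1), fun t ht => by
      linarith [hx.2 ((hmem t).mp ht)]⟩
  · exact bottom_translate _ _ hbottom

theorem image_snd_translate (v : ℝ × ℝ) (K : Set (ℝ × ℝ)) :
    Prod.snd '' translate v K = (v.2 + ·) '' (Prod.snd '' K) := by
  rw [translate, Set.image_image, Set.image_image]
  rfl

theorem IsAxisParallelRegion.exists_normalization {K : Set (ℝ × ℝ)} (h : IsAxisParallelRegion K)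
    (htall : IsTall K) :
    ∃ v, Prod.snd '' IrrationalTiling.translate v K = Set.Icc 0 1 ∧
      ∃ J, IsHalfOpenTile (germs (IrrationalTiling.translate v K)) J := by
  obtain ⟨c, hc⟩ := htall
  have hheight x : Prod.snd '' IrrationalTiling.translate (x, -c) K = Set.Icc 0 1 := by
    rw [image_snd_translate, hc, Set.image_const_add_Icc, neg_add_cancel, neg_add_cancel_left]
  obtain ⟨x, J, hJ⟩ := (h.translate (0, -c)).exists_isHalfOpenTile
    (by rw [hheight]; exact isLeast_Icc zero_le_one)
  rw [translate_translate, Prod.mk_add_mk, add_zero, zero_add] at hJ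
  exact ⟨(x, -c), hheight x, J, hJ⟩

theorem tileCountingFunctions_subset_diagonals : tileCountingFunctions ⊆ diagonals := by
  rintro f ⟨T, ε, hT, htile, hε, hf⟩
  choose! v hheight hhalf using fun τ hτ =>
    (htile τ hτ).1.region.exists_normalization (htile τ hτ).2
  set T' := (fun τ => translate (v τ) τ) '' T
  have hreg : ∀ τ ∈ T', IsAxisParallelRegion τ :=
    Set.forall_mem_image.mpr fun τ hτ => (htile τ hτ).1.region.translate (v τ)
  have hT' : T'.Finite := hT.image _
  obtain ⟨T'', hT''⟩ := (hT'.image germs).exists_finset_coe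
  have hhalf'' : ∀ τ ∈ T'', ∃ J, IsHalfOpenTile τ J := by
    simp only [← Finset.mem_coe, hT'', T', Set.forall_mem_image]
    exact hhalf
  choose! I hI using hhalf''
  have hbdd : Bornology.IsBounded (⋃ τ ∈ T', germs τ) :=
    (Bornology.isBounded_biUnion hT').mpr fun τ hτ => (hreg τ hτ).isBounded.subset (germs_subset τ)
  obtain ⟨W, hW0, hW⟩ := hbdd.exists_pos_norm_le
  refine mem_diagonals_of_remCount hI hW0.le (fun τ hτ p hp => ?_) hε fun n => ?_
  · rw [← Finset.mem_coe, hT''] at hτ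
    obtain ⟨τ, hτ, rfl⟩ := hτ
    exact abs_le.mp ((norm_fst_le p).trans (hW p (Set.mem_biUnion hτ hp)))
  · rw [hT'', ← encard_isTiling_eq_remCount hT' hreg (Set.forall_mem_image.mpr hheight)
      (by positivity), ← hf n]
    simp only [T', isTiling_image_translate]

/-! ### Binomial multisums with parameters -/

theorem tsum_natCast_eq_iff {X : Type*} (t : X → ℕ) (N : ℕ) :
    ∑' x, (t x : ℝ≥0∞) = N ↔ (Function.support t).Finite ∧ ∑ᶠ x, t x = N := by
  have key (hfin : (Function.support t).Finite) :
      ∑' x, (t x : ℝ≥0∞) = ((∑ᶠ x, t x : ℕ) : ℝ≥0∞) := by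
    rw [finsum_eq_sum_of_support_subset (s := hfin.toFinset) t (by simp), Nat.cast_sum]
    exact tsum_eq_sum fun x hx => by simpa using hx
  constructor
  · intro h
    have hfin : (Function.support t).Finite := by
      refine (ENNReal.finite_const_le_of_tsum_ne_top (a := fun x => (t x : ℝ≥0∞))
        (by simp [h]) one_ne_zero).subset fun x hx => ?_
      simpa using Nat.one_le_iff_ne_zero.mpr hx
    rw [key hfin] at h
    exact ⟨hfin, by exact_mod_cast h⟩
  · rintro ⟨hfin, h⟩
    rw [key hfin, h]

theorem binom_zero_left (b : ℤ) : binom 0 b = if b = 0 then 1 else 0 := by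
  rcases lt_trichotomy b 0 with h | rfl | h
  · simp [binom, h.ne, h.not_ge]
  · simp [binom]
  · simp [binom, h.ne', h.not_ge]

theorem binom_self (a : ℤ) : binom a a = if 0 ≤ a then 1 else 0 := by
  unfold binom
  split_ifs <;> first | omega | simp

theorem binom_natCast (a b : ℕ) : binom a b = a.choose b := by
  unfold binom
  split_ifs with h1 h2
  · simp
  · omega
  · rw [Nat.choose_eq_zero_of_lt (by omega)]

/-- Integer-valued affine functions of a natural vector, with integer coefficients. -/
def IsAff {ι : Type*} [Fintype ι] (φ : (ι → ℕ) → ℤ) : Prop :=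
  ∃ (a : ι → ℤ) (c : ℤ), ∀ p, φ p = ∑ i, a i * p i + c

section IsAff

variable {ι κ : Type*} [Fintype ι] [Fintype κ] {φ ψ : (ι → ℕ) → ℤ}

theorem isAff_const (c : ℤ) : IsAff fun _ : ι → ℕ => c := ⟨0, c, by simp⟩

theorem isAff_coord (i : ι) : IsAff fun p : ι → ℕ => (p i : ℤ) := by
  classical
  exact ⟨Pi.single i 1, 0, fun p => by simp [Pi.single_apply]⟩

theorem IsAff.add (hφ : IsAff φ) (hψ : IsAff ψ) : IsAff fun p => φ p + ψ p := by
  obtain ⟨a, c, h⟩ := hφ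
  obtain ⟨a', c', h'⟩ := hψ
  refine ⟨a + a', c + c', fun p => ?_⟩
  simp only [h, h', Pi.add_apply, add_mul, Finset.sum_add_distrib]
  ring

theorem IsAff.const_mul (hφ : IsAff φ) (b : ℤ) : IsAff fun p => b * φ p := by
  obtain ⟨a, c, h⟩ := hφ
  refine ⟨fun i => b * a i, b * c, fun p => ?_⟩
  simp only [h, mul_add, Finset.mul_sum, mul_assoc]

theorem IsAff.sub (hφ : IsAff φ) (hψ : IsAff ψ) : IsAff fun p => φ p - ψ p := by
  simpa [sub_eq_add_neg] using hφ.add (hψ.const_mul (-1))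

theorem isAff_sum {X : Type*} (s : Finset X) (φ : X → (ι → ℕ) → ℤ) (h : ∀ x ∈ s, IsAff (φ x)) :
    IsAff fun p => ∑ x ∈ s, φ x p := by
  simpa only [← Finset.sum_apply] using
    Finset.sum_induction φ IsAff (fun _ _ => IsAff.add) (isAff_const 0) h

theorem IsAff.comp (hφ : IsAff φ) {σ : (κ → ℕ) → ι → ℕ} (hσ : ∀ i, IsAff fun p => (σ p i : ℤ)) :
    IsAff fun p => φ (σ p) := by
  obtain ⟨a, c, h⟩ := hφ
  simp only [h]
  exact (isAff_sum _ _ fun i _ => (hσ i).const_mul (a i)).add (isAff_const c)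

theorem IsAff.exists_affineForm {d : ℕ} {φ : (Unit ⊕ Fin d → ℕ) → ℤ} (hφ : IsAff φ) :
    ∃ A : AffineForm d, ∀ (v : Fin d → ℕ) n,
      A.eval (fun j => v j) n = φ (Sum.elim (fun _ => n) v) := by
  obtain ⟨a, c, h⟩ := hφ
  refine ⟨⟨fun j => a (.inr j), a (.inl ()), c⟩, fun v n => ?_⟩
  simp only [AffineForm.eval, h, Fintype.sum_sum_type, Finset.univ_unique, Finset.sum_singleton,
    Sum.elim_inl, Sum.elim_inr]
  ring

end IsAff

/-- Functions of a natural vector given by a multisum of products of binomial coefficients of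
affine functions, with summation over natural vectors. The values lie in `ℝ≥0∞`, so that multisums
can be rearranged before they are known to be finite. -/
def IsMultisum {ι : Type*} [Fintype ι] (g : (ι → ℕ) → ℝ≥0∞) : Prop :=
  ∃ (ρ κ : Type) (_ : Fintype ρ) (_ : Fintype κ) (α β : ρ → (ι ⊕ κ → ℕ) → ℤ),
    (∀ i, IsAff (α i)) ∧ (∀ i, IsAff (β i)) ∧
    ∀ p, g p = ∑' v : κ → ℕ, ∏ i, (binom (α i (Sum.elim p v)) (β i (Sum.elim p v)) : ℝ≥0∞)

section IsMultisum

variable {ι : Type*} {κ : Type} [Fintype ι] [Fintype κ] {g g' : (ι → ℕ) → ℝ≥0∞}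

theorem isMultisum_prod_binom {ρ : Type} [Fintype ρ] (α β : ρ → (ι → ℕ) → ℤ)
    (hα : ∀ i, IsAff (α i)) (hβ : ∀ i, IsAff (β i)) :
    IsMultisum fun p : ι → ℕ => ∏ i, (binom (α i p) (β i p) : ℝ≥0∞) :=
  ⟨ρ, Empty, inferInstance, inferInstance, fun i p => α i (p ∘ Sum.inl),
    fun i p => β i (p ∘ Sum.inl), fun i => (hα i).comp fun _ => isAff_coord _,
    fun i => (hβ i).comp fun _ => isAff_coord _, fun p => by simp⟩

theorem isMultisum_binom {α β : (ι → ℕ) → ℤ} (hα : IsAff α) (hβ : IsAff β) :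
    IsMultisum fun p : ι → ℕ => (binom (α p) (β p) : ℝ≥0∞) := by
  simpa using isMultisum_prod_binom (ρ := Unit) (fun _ => α) (fun _ => β) (fun _ => hα) fun _ => hβ

theorem isMultisum_indicator {ρ : Type} [Finite ρ] (φ : ρ → (ι → ℕ) → ℤ)
    (hφ : ∀ i, IsAff (φ i)) : IsMultisum (Set.indicator {p | ∀ i, φ i p = 0} 1) := by
  have := Fintype.ofFinite ρ
  convert isMultisum_prod_binom (fun _ _ => 0) φ (fun _ => isAff_const 0) hφ using 2 with p
  simp only [binom_zero_left]
  by_cases h : ∀ i, φ i p = 0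
  · simp [h]
  · obtain ⟨i, hi⟩ := not_forall.mp h
    rw [Finset.prod_eq_zero (Finset.mem_univ i) (by simp [hi])]
    simp [h]

theorem IsMultisum.comp {ι' : Type*} [Fintype ι'] (hg : IsMultisum g) {σ : (ι' → ℕ) → ι → ℕ}
    (hσ : ∀ i, IsAff fun p => (σ p i : ℤ)) : IsMultisum fun p => g (σ p) := by
  obtain ⟨ρ, μ, _, _, α, β, hα, hβ, h⟩ := hg
  have hσ' : ∀ j, IsAff fun p : ι' ⊕ μ → ℕ =>
      ((Sum.elim (σ (p ∘ Sum.inl)) (p ∘ Sum.inr) j : ℕ) : ℤ) := by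
    rintro (i | j)
    · exact (hσ i).comp fun _ => isAff_coord _
    · exact isAff_coord _
  exact ⟨ρ, μ, inferInstance, inferInstance, _, _, fun i => (hα i).comp hσ',
    fun i => (hβ i).comp hσ', fun p => by simp only [h, Sum.elim_comp_inl, Sum.elim_comp_inr]⟩

theorem IsMultisum.tsum {g : (ι ⊕ κ → ℕ) → ℝ≥0∞} (hg : IsMultisum g) :
    IsMultisum fun p : ι → ℕ => ∑' w : κ → ℕ, g (Sum.elim p w) := by
  obtain ⟨ρ, μ, _, _, α, β, hα, hβ, h⟩ := hg
  let l : (ι ⊕ κ) ⊕ μ → ι ⊕ (κ ⊕ μ) := Equiv.sumAssoc ι κ μ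
  refine ⟨ρ, κ ⊕ μ, inferInstance, inferInstance, fun i p => α i (p ∘ l), fun i p => β i (p ∘ l),
    fun i => (hα i).comp fun _ => isAff_coord _, fun i => (hβ i).comp fun _ => isAff_coord _,
    fun p => ?_⟩
  rw [← (Equiv.sumArrowEquivProdArrow κ μ ℕ).symm.tsum_eq, ENNReal.tsum_prod']
  refine tsum_congr fun w => (h _).trans (tsum_congr fun v => ?_)
  have hl : Sum.elim p ((Equiv.sumArrowEquivProdArrow κ μ ℕ).symm (w, v)) ∘ l =
      Sum.elim (Sum.elim p w) v := by ext ((i | i) | i) <;> rfl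
  simp only [hl]

theorem IsMultisum.mul (hg : IsMultisum g) (hg' : IsMultisum g') :
    IsMultisum fun p => g p * g' p := by
  obtain ⟨ρ, μ, _, _, α, β, hα, hβ, h⟩ := hg
  obtain ⟨ρ', μ', _, _, α', β', hα', hβ', h'⟩ := hg'
  let l : ι ⊕ μ → (ι ⊕ μ) ⊕ μ' := Sum.inl
  let r : ι ⊕ μ' → (ι ⊕ μ) ⊕ μ' := Sum.map Sum.inl id
  have hmul : IsMultisum fun q : (ι ⊕ μ) ⊕ μ' → ℕ =>
      ∏ i : ρ ⊕ ρ', (binom (Sum.elim (fun i => α i (q ∘ l)) (fun i => α' i (q ∘ r)) i)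
        (Sum.elim (fun i => β i (q ∘ l)) (fun i => β' i (q ∘ r)) i) : ℝ≥0∞) := by
    refine isMultisum_prod_binom _ _ ?_ ?_ <;> rintro (i | i)
    · exact (hα i).comp fun _ => isAff_coord _
    · exact (hα' i).comp fun _ => isAff_coord _
    · exact (hβ i).comp fun _ => isAff_coord _
    · exact (hβ' i).comp fun _ => isAff_coord _
  convert hmul.tsum.tsum using 2 with p
  rw [h, h', ← ENNReal.tsum_mul_right]
  refine tsum_congr fun v => ?_
  rw [← ENNReal.tsum_mul_left]
  refine tsum_congr fun v' => ?_
  have hr : Sum.elim (Sum.elim p v) v' ∘ r = Sum.elim p v' := by ext (i | i) <;> rfl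
  simp only [Fintype.prod_sum_type, Sum.elim_inl, Sum.elim_inr, l, Sum.elim_comp_inl, hr]

theorem IsMultisum.sum_antidiagonal {g : (ι ⊕ (κ ⊕ κ) → ℕ) → ℝ≥0∞} (hg : IsMultisum g)
    [DecidableEq κ] (σ : κ → ι) :
    IsMultisum fun p => ∑ x ∈ Finset.HasAntidiagonal.antidiagonal
      (Finsupp.equivFunOnFinite.symm (p ∘ σ)), g (Sum.elim p (Sum.elim x.1 x.2)) := by
  have hind := isMultisum_indicator (ι := ι ⊕ (κ ⊕ κ))
    (fun j q => (q (.inr (.inl j)) : ℤ) + q (.inr (.inr j)) - q (.inl (σ j)))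
    fun j => ((isAff_coord _).add (isAff_coord _)).sub (isAff_coord _)
  convert (hind.mul hg).tsum using 2 with p
  let e : (κ →₀ ℕ) × (κ →₀ ℕ) ≃ (κ ⊕ κ → ℕ) :=
    (Finsupp.equivFunOnFinite.prodCongr Finsupp.equivFunOnFinite).trans
      (Equiv.sumArrowEquivProdArrow κ κ ℕ).symm
  have he (x : (κ →₀ ℕ) × (κ →₀ ℕ)) : e x = Sum.elim x.1 x.2 := rfl
  have hmem (x : (κ →₀ ℕ) × (κ →₀ ℕ)) :
      x ∈ Finset.HasAntidiagonal.antidiagonal (Finsupp.equivFunOnFinite.symm (p ∘ σ)) ↔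
        ∀ j, (x.1 j : ℤ) + x.2 j - p (σ j) = 0 := by
    simp only [Finset.HasAntidiagonal.mem_antidiagonal, Finsupp.ext_iff, Finsupp.add_apply,
      Finsupp.equivFunOnFinite_symm_apply_apply, Function.comp_apply]
    exact forall_congr' fun j => by omega
  rw [← e.tsum_eq, tsum_eq_sum (s := Finset.HasAntidiagonal.antidiagonal
    (Finsupp.equivFunOnFinite.symm (p ∘ σ)))]
  · refine Finset.sum_congr rfl fun x hx => ?_
    rw [Set.indicator_of_mem (by simpa [he] using (hmem x).mp hx), he]
    simp
  · intro x hx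
    rw [Set.indicator_of_notMem (by simpa [he] using (hmem x).not.mp hx), zero_mul]

end IsMultisum

theorem mem_binomialMultisums_of_tsum_int {ρ : Type*} [Fintype ρ] {d : ℕ} (α β : ρ → AffineForm d)
    {f : ℕ → ℕ} (h : ∀ n, ∑' v : Fin d → ℤ,
      ∏ i, (binom ((α i).eval v n) ((β i).eval v n) : ℝ≥0∞) = f n) :
    f ∈ binomialMultisums := by
  let e := Fintype.equivFin ρ
  refine ⟨Fintype.card ρ, d, α ∘ e.symm, β ∘ e.symm, fun n => ?_⟩
  rw [← tsum_natCast_eq_iff, ← h n]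
  refine tsum_congr fun v => ?_
  rw [← e.symm.prod_comp]
  simp

theorem mem_binomialMultisums_of_tsum_nat {ρ : Type*} [Fintype ρ] {d : ℕ} (α β : ρ → AffineForm d)
    {f : ℕ → ℕ} (h : ∀ n, ∑' v : Fin d → ℕ,
      ∏ i, (binom ((α i).eval (fun j => v j) n) ((β i).eval (fun j => v j) n) : ℝ≥0∞) = f n) :
    f ∈ binomialMultisums := by
  -- The additional factors `binom (v j) (v j)` cut the summation down to natural vectors.
  let coord (j : Fin d) : AffineForm d := ⟨Pi.single j 1, 0, 0⟩
  have hcoord (j : Fin d) (v : Fin d → ℤ) (n : ℕ) : (coord j).eval v n = v j := by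
    simp [coord, AffineForm.eval, Pi.single_apply]
  refine mem_binomialMultisums_of_tsum_int (Sum.elim α coord) (Sum.elim β coord) fun n => ?_
  have hinj : Function.Injective fun (v : Fin d → ℕ) j => (v j : ℤ) :=
    fun v w hvw => funext fun j => Nat.cast_injective (congrFun hvw j)
  simp only [Fintype.prod_sum_type, Sum.elim_inl, Sum.elim_inr, hcoord, binom_self]
  rw [← hinj.tsum_eq, ← h n]
  · simp
  · intro v hv
    refine ⟨fun j => (v j).toNat, funext fun j => Int.toNat_of_nonneg (by_contra fun hj => hv ?_)⟩
    have h0 : ∏ j, ((if 0 ≤ v j then 1 else 0 : ℕ) : ℝ≥0∞) = 0 :=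
      Finset.prod_eq_zero (Finset.mem_univ j) (by simp [hj])
    simp only [h0, mul_zero]

theorem mem_binomialMultisums_of_isMultisum {g : (Unit → ℕ) → ℝ≥0∞} (hg : IsMultisum g)
    {f : ℕ → ℕ} (hf : ∀ n, g (fun _ => n) = f n) : f ∈ binomialMultisums := by
  obtain ⟨ρ, κ, _, _, α, β, hα, hβ, h⟩ := hg
  let e := Fintype.equivFin κ
  have hσ : ∀ i, IsAff fun p : Unit ⊕ Fin (Fintype.card κ) → ℕ => (p (Sum.map id e i) : ℤ) :=
    fun _ => isAff_coord _
  choose A hA using fun i => ((hα i).comp hσ).exists_affineForm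
  choose B hB using fun i => ((hβ i).comp hσ).exists_affineForm
  refine mem_binomialMultisums_of_tsum_nat A B fun n => ?_
  rw [← hf n, h, ← (e.arrowCongr (Equiv.refl ℕ)).symm.tsum_eq]
  refine tsum_congr fun v => Finset.prod_congr rfl fun i _ => ?_
  have hv : (fun j : Unit ⊕ κ => Sum.elim (fun _ => n) v (Sum.map id e j)) =
      Sum.elim (fun _ => n) ((e.arrowCongr (Equiv.refl ℕ)).symm v) := by
    ext (_ | _) <;> rfl
  rw [hA, hB, hv]

/-! ### Coefficients of powers of `ℕ`-rational series -/

theorem coeff_invOneSubPow (R : Type*) [CommRing R] (m j : ℕ) :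
    PowerSeries.coeff j (PowerSeries.invOneSubPow R m).val = (binom (m + j - 1) j : R) := by
  rcases m with _ | m
  · have h : binom ((0 : ℕ) + j - 1) j = if j = 0 then 1 else 0 := by
      unfold binom
      split_ifs <;> omega
    rw [PowerSeries.invOneSubPow_zero, Units.val_one, PowerSeries.coeff_one, h]
    simp
  · rw [PowerSeries.invOneSubPow_val_succ_eq_mk_add_choose, PowerSeries.coeff_mk,
      show ((m + 1 : ℕ) + j - 1 : ℤ) = (m + j : ℕ) by push_cast; ring, binom_natCast,
      Nat.choose_symm_add]

section Coefficients

variable {σ : Type*}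

theorem finite_support_coeff_pow {R : Type*} [CommSemiring R] {F : MvPowerSeries σ R}
    (hF : MvPowerSeries.constantCoeff F = 0) (c : σ →₀ ℕ) :
    (Function.support fun j : ℕ => MvPowerSeries.coeff c (F ^ j)).Finite := by
  refine (Set.finite_Iic c.degree).subset fun j hj => Set.mem_Iic.mpr (not_lt.mp fun h => hj ?_)
  exact MvPowerSeries.coeff_of_lt_order (lt_of_lt_of_le (by exact_mod_cast h)
    (MvPowerSeries.le_order_pow_of_constantCoeff_eq_zero j hF))

theorem pow_eq_subst_invOneSubPow {R : Type*} [CommRing R] {F G : MvPowerSeries σ R}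
    (hF : MvPowerSeries.constantCoeff F = 0) (h : (1 - F) * G = 1) (m : ℕ) :
    G ^ m = (PowerSeries.invOneSubPow R m).val.subst F := by
  have hs := PowerSeries.HasSubst.of_constantCoeff_zero hF
  have hinv : (1 - F) ^ m * (PowerSeries.invOneSubPow R m).val.subst F = 1 := by
    have := congrArg (PowerSeries.substAlgHom hs) (PowerSeries.invOneSubPow R m).inv_val
    rwa [PowerSeries.invOneSubPow_inv_eq_one_sub_pow, map_mul, map_pow, map_sub, map_one,
      PowerSeries.coe_substAlgHom, PowerSeries.subst_X hs] at this
  exact (left_inv_eq_right_inv (by rw [← mul_pow, mul_comm, h, one_pow]) hinv)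

theorem coeff_pow_eq_finsum_binom {R : Type*} [CommRing R] {F G : MvPowerSeries σ R}
    (hF : MvPowerSeries.constantCoeff F = 0) (h : (1 - F) * G = 1) (m : ℕ) (c : σ →₀ ℕ) :
    MvPowerSeries.coeff c (G ^ m) =
      ∑ᶠ j : ℕ, (binom (m + j - 1) j : R) * MvPowerSeries.coeff c (F ^ j) := by
  rw [pow_eq_subst_invOneSubPow hF h,
    PowerSeries.coeff_subst (PowerSeries.HasSubst.of_constantCoeff_zero hF)]
  simp only [coeff_invOneSubPow, smul_eq_mul]

variable {F G : MvPowerSeries σ ℕ}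

theorem coeff_pow_eq_natCast_finsum_binom {G : MvPowerSeries σ ℤ}
    (hF : MvPowerSeries.constantCoeff F = 0)
    (h : (1 - MvPowerSeries.map (Nat.castRingHom ℤ) F) * G = 1) (m : ℕ) (c : σ →₀ ℕ) :
    MvPowerSeries.coeff c (G ^ m) =
      (∑ᶠ j : ℕ, binom (m + j - 1) j * MvPowerSeries.coeff c (F ^ j) : ℕ) := by
  rw [coeff_pow_eq_finsum_binom (by simp [hF]) h, ← Nat.coe_castRingHom,
    map_finsum _ ((finite_support_coeff_pow hF c).subset (Function.support_mul_subset_right _ _))]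
  simp [← map_pow]

theorem exists_map_natCast_eq_of_inv {G : MvPowerSeries σ ℤ}
    (hF : MvPowerSeries.constantCoeff F = 0)
    (h : (1 - MvPowerSeries.map (Nat.castRingHom ℤ) F) * G = 1) :
    ∃ G' : MvPowerSeries σ ℕ, MvPowerSeries.map (Nat.castRingHom ℤ) G' = G := by
  refine ⟨fun c => ∑ᶠ j : ℕ, binom ((1 : ℕ) + j - 1) j * MvPowerSeries.coeff c (F ^ j), ?_⟩
  ext c
  rw [← pow_one G, coeff_pow_eq_natCast_finsum_binom hF h]
  rfl

theorem coe_coeff_pow_eq_tsum_binom (hF : MvPowerSeries.constantCoeff F = 0)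
    (h : (1 - MvPowerSeries.map (Nat.castRingHom ℤ) F) *
      MvPowerSeries.map (Nat.castRingHom ℤ) G = 1) (m : ℕ) (c : σ →₀ ℕ) :
    ((MvPowerSeries.coeff c (G ^ m) : ℕ) : ℝ≥0∞) =
      ∑' j : ℕ, (binom (m + j - 1) j : ℝ≥0∞) * (MvPowerSeries.coeff c (F ^ j) : ℕ) := by
  have hG := coeff_pow_eq_natCast_finsum_binom hF h m c
  rw [← map_pow, MvPowerSeries.coeff_map, Nat.coe_castRingHom, Nat.cast_inj] at hG
  simp only [← Nat.cast_mul]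
  exact ((tsum_natCast_eq_iff _ _).mpr ⟨(finite_support_coeff_pow hF c).subset
    (Function.support_mul_subset_right _ _), hG.symm⟩).symm

end Coefficients

/-- Families of power series, indexed by a natural vector `p`, whose coefficients form a multisum in
`p` and the exponents. -/
def IsMultisumFamily {ι σ : Type*} [Fintype ι] [Fintype σ]
    (P : (ι → ℕ) → MvPowerSeries σ ℕ) : Prop :=
  IsMultisum fun q : ι ⊕ σ → ℕ => ((MvPowerSeries.coeff
    (Finsupp.equivFunOnFinite.symm (q ∘ Sum.inr)) (P (q ∘ Sum.inl)) : ℕ) : ℝ≥0∞)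

section IsMultisumFamily

variable {ι : Type*} {σ : Type} [Fintype ι] [Fintype σ]

theorem IsMultisumFamily.comp {ι' : Type*} [Fintype ι'] {P : (ι → ℕ) → MvPowerSeries σ ℕ}
    (hP : IsMultisumFamily P) {φ : (ι' → ℕ) → ι → ℕ} (hφ : ∀ i, IsAff fun p => (φ p i : ℤ)) :
    IsMultisumFamily fun p => P (φ p) := by
  refine IsMultisum.comp (σ := fun q => Sum.elim (φ (q ∘ Sum.inl)) (q ∘ Sum.inr)) hP ?_
  rintro (i | j)
  · exact (hφ i).comp fun _ => isAff_coord _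
  · exact isAff_coord _

theorem IsMultisumFamily.nsmul {P : (ι → ℕ) → MvPowerSeries σ ℕ} (hP : IsMultisumFamily P)
    {b : (ι → ℕ) → ℕ} (hb : IsMultisum fun p => (b p : ℝ≥0∞)) :
    IsMultisumFamily fun p => b p • P p := by
  unfold IsMultisumFamily at hP ⊢
  simpa only [map_nsmul, smul_eq_mul, Nat.cast_mul] using
    (hb.comp (σ := fun q : ι ⊕ σ → ℕ => q ∘ Sum.inl) fun _ => isAff_coord _).mul hP

theorem IsMultisumFamily.mul {P Q : (ι → ℕ) → MvPowerSeries σ ℕ} (hP : IsMultisumFamily P)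
    (hQ : IsMultisumFamily Q) : IsMultisumFamily fun p => P p * Q p := by
  classical
  let l : ι ⊕ σ → (ι ⊕ σ) ⊕ (σ ⊕ σ) := Sum.map Sum.inl Sum.inl
  let r : ι ⊕ σ → (ι ⊕ σ) ⊕ (σ ⊕ σ) := Sum.map Sum.inl Sum.inr
  unfold IsMultisumFamily at hP hQ ⊢
  convert ((hP.comp (σ := fun q => q ∘ l) fun _ => isAff_coord _).mul
    (hQ.comp (σ := fun q => q ∘ r) fun _ => isAff_coord _)).sum_antidiagonal Sum.inr using 2 with q
  rw [MvPowerSeries.coeff_mul, Nat.cast_sum]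
  refine Finset.sum_congr rfl fun x _ => ?_
  rw [Nat.cast_mul]
  congr <;> ext <;> rfl

theorem IsMultisumFamily.sum_antidiagonal {P : (ι ⊕ (Unit ⊕ Unit) → ℕ) → MvPowerSeries σ ℕ}
    (hP : IsMultisumFamily P) (i : ι) :
    IsMultisumFamily fun p => ∑ x ∈ Finset.HasAntidiagonal.antidiagonal (p i),
      P (Sum.elim p (Sum.elim (fun _ => x.1) fun _ => x.2)) := by
  let l : (ι ⊕ (Unit ⊕ Unit)) ⊕ σ → (ι ⊕ σ) ⊕ (Unit ⊕ Unit) :=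
    Sum.elim (Sum.map Sum.inl id) (Sum.inl ∘ Sum.inr)
  unfold IsMultisumFamily at hP ⊢
  convert (hP.comp (σ := fun q => q ∘ l) fun _ => isAff_coord _).sum_antidiagonal
    (fun _ : Unit => Sum.inl i) using 2 with q
  have hi : Finsupp.equivFunOnFinite.symm (q ∘ fun _ : Unit => Sum.inl i) =
      Finsupp.single () (q (Sum.inl i)) := by ext; simp
  rw [hi, Finsupp.antidiagonal_single, Finset.sum_map, map_sum, Nat.cast_sum]
  refine Finset.sum_congr rfl fun x _ => ?_
  congr 2
  congr 1
  ext ((_ | _ | _)) <;> simp [l]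

theorem isMultisumFamily_zero_pow :
    IsMultisumFamily fun p : Unit → ℕ => (0 : MvPowerSeries σ ℕ) ^ p () := by
  classical
  unfold IsMultisumFamily
  convert isMultisum_indicator (ι := Unit ⊕ σ) (fun i q => (q i : ℤ)) isAff_coord using 2 with q
  simp only [zero_pow_eq, apply_ite (MvPowerSeries.coeff _), MvPowerSeries.coeff_one, map_zero,
    Set.indicator_apply]
  simp [Finsupp.ext_iff, ← ite_and, Unique.forall_iff]

theorem isMultisumFamily_X_pow (i : σ) :
    IsMultisumFamily fun p : Unit → ℕ => (MvPowerSeries.X i : MvPowerSeries σ ℕ) ^ p () := by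
  classical
  unfold IsMultisumFamily
  convert isMultisum_indicator (ι := Unit ⊕ σ)
    (fun j q => (q (.inr j) : ℤ) - (if j = i then 1 else 0) * q (.inl ()))
    (fun j => (isAff_coord _).sub ((isAff_coord _).const_mul _)) using 2 with q
  rw [MvPowerSeries.coeff_X_pow, Set.indicator_apply]
  have h : Finsupp.equivFunOnFinite.symm (q ∘ Sum.inr) = Finsupp.single i (q (.inl ())) ↔
      ∀ j, (q (.inr j) : ℤ) - (if j = i then 1 else 0) * q (.inl ()) = 0 := by
    simp only [Finsupp.ext_iff, Finsupp.equivFunOnFinite_symm_apply_apply, Finsupp.single_apply,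
      Function.comp_apply, eq_comm (a := i)]
    exact forall_congr' fun j => by split_ifs <;> omega
  simp [h]

variable {F G : MvPowerSeries σ ℕ}

theorem IsMultisumFamily.mul_pow (hF : IsMultisumFamily fun p : Unit → ℕ => F ^ p ())
    (hG : IsMultisumFamily fun p : Unit → ℕ => G ^ p ()) :
    IsMultisumFamily fun p : Unit → ℕ => (F * G) ^ p () := by
  simpa only [_root_.mul_pow] using hF.mul hG

theorem IsMultisumFamily.add_pow (hF : IsMultisumFamily fun p : Unit → ℕ => F ^ p ())
    (hG : IsMultisumFamily fun p : Unit → ℕ => G ^ p ()) :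
    IsMultisumFamily fun p : Unit → ℕ => (F + G) ^ p () := by
  have hb : IsMultisum fun q : Unit ⊕ (Unit ⊕ Unit) → ℕ =>
      ((q (.inl ())).choose (q (.inr (.inl ()))) : ℝ≥0∞) := by
    simpa only [binom_natCast] using
      isMultisum_binom (ι := Unit ⊕ (Unit ⊕ Unit)) (isAff_coord (.inl ()))
        (isAff_coord (.inr (.inl ())))
  have hFG := (hF.comp (φ := fun (q : Unit ⊕ (Unit ⊕ Unit) → ℕ) _ => q (.inr (.inl ())))
    fun _ => isAff_coord _).mul
    (hG.comp (φ := fun q _ => q (.inr (.inr ()))) fun _ => isAff_coord _)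
  simpa only [(Commute.all F G).add_pow', Sum.elim_inl, Sum.elim_inr] using
    (hFG.nsmul hb).sum_antidiagonal ()

theorem IsMultisumFamily.inv_one_sub_pow (hF : IsMultisumFamily fun p : Unit → ℕ => F ^ p ())
    (hF0 : MvPowerSeries.constantCoeff F = 0)
    (h : (1 - MvPowerSeries.map (Nat.castRingHom ℤ) F) *
      MvPowerSeries.map (Nat.castRingHom ℤ) G = 1) :
    IsMultisumFamily fun p : Unit → ℕ => G ^ p () := by
  let l : Unit ⊕ σ → (Unit ⊕ σ) ⊕ Unit := Sum.elim Sum.inr (Sum.inl ∘ Sum.inr)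
  have hb := isMultisum_binom (ι := (Unit ⊕ σ) ⊕ Unit)
    (((isAff_coord (.inl (.inl ()))).add (isAff_coord (.inr ()))).sub (isAff_const 1))
    (isAff_coord (.inr ()))
  unfold IsMultisumFamily at hF ⊢
  convert (hb.mul (hF.comp (σ := fun q => q ∘ l) fun _ => isAff_coord _)).tsum using 2 with q
  rw [coe_coeff_pow_eq_tsum_binom hF0 h, ← (Equiv.funUnique Unit ℕ).tsum_eq]
  rfl

end IsMultisumFamily

theorem IsNRational.exists_isMultisumFamily_pow {k : ℕ} {G : MvPowerSeries (Fin k) ℤ}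
    (hG : IsNRational G) : ∃ G' : MvPowerSeries (Fin k) ℕ,
      MvPowerSeries.map (Nat.castRingHom ℤ) G' = G ∧
        IsMultisumFamily fun p : Unit → ℕ => G' ^ p () := by
  induction hG with
  | zero => exact ⟨0, map_zero _, isMultisumFamily_zero_pow⟩
  | var i => exact ⟨.X i, MvPowerSeries.map_X _ _, isMultisumFamily_X_pow i⟩
  | add _ _ ihF ihG =>
    obtain ⟨F, rfl, hF⟩ := ihF
    obtain ⟨G, rfl, hG⟩ := ihG
    exact ⟨F + G, map_add _ _ _, hF.add_pow hG⟩
  | mul _ _ ihF ihG =>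
    obtain ⟨F, rfl, hF⟩ := ihF
    obtain ⟨G, rfl, hG⟩ := ihG
    exact ⟨F * G, map_mul _ _ _, hF.mul_pow hG⟩
  | inv_one_sub _ hc hinv ihF =>
    obtain ⟨F, rfl, hF⟩ := ihF
    have hF0 : MvPowerSeries.constantCoeff F = 0 := by
      simpa [MvPowerSeries.constantCoeff_map] using hc
    obtain ⟨G, rfl⟩ := exists_map_natCast_eq_of_inv hF0 hinv
    exact ⟨G, rfl, hF.inv_one_sub_pow hF0 hinv⟩

theorem exists_isMultisum_of_mem_diagonals {f : ℕ → ℕ} (hf : f ∈ diagonals) :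
    ∃ g : (Unit → ℕ) → ℝ≥0∞, IsMultisum g ∧ ∀ n, g (fun _ => n) = f n := by
  obtain ⟨k, G, -, hG, hf⟩ := hf
  obtain ⟨G, rfl, hGpow⟩ := hG.exists_isMultisumFamily_pow
  have hσ : ∀ i : Unit ⊕ Fin k, IsAff fun p : Unit → ℕ =>
      ((Sum.elim (fun _ => 1) (fun _ => p ()) i : ℕ) : ℤ) := by
    rintro (_ | _)
    · exact isAff_const 1
    · exact isAff_coord ()
  refine ⟨_, IsMultisum.comp hGpow hσ, fun n => ?_⟩
  have hn := hf n
  rw [MvPowerSeries.coeff_map, Nat.coe_castRingHom, Nat.cast_inj] at hn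
  simp [← hn, Function.comp_def]

theorem diagonals_subset_binomialMultisums : diagonals ⊆ binomialMultisums := by
  intro f hf
  obtain ⟨g, hg, hgf⟩ := exists_isMultisum_of_mem_diagonals hf
  exact mem_binomialMultisums_of_isMultisum hg hgf

theorem mul_mem_binomialMultisums {f g : ℕ → ℕ} (hf : f ∈ diagonals) (hg : g ∈ diagonals) :
    (fun n => f n * g n) ∈ binomialMultisums := by
  obtain ⟨F, hF, hFf⟩ := exists_isMultisum_of_mem_diagonals hf
  obtain ⟨G, hG, hGg⟩ := exists_isMultisum_of_mem_diagonals hg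
  exact mem_binomialMultisums_of_isMultisum (hF.mul hG) fun n => by simp [hFf, hGg]

/-! ### Positive functionals in general position -/

section PositiveFunctional

variable {X K : Type*} [Finite X]

theorem exists_dotProduct_pos_of_zero_notMem_convexHull [Fintype K] {w : X → K → ℝ}
    (hw : 0 ∉ convexHull ℝ (Set.range w)) : ∃ l : K → ℝ, ∀ x, 0 < w x ⬝ᵥ l := by
  classical
  obtain ⟨φ, u, hu₀, hu⟩ := geometric_hahn_banach_point_closed (convex_convexHull ℝ _)
    ((Set.finite_range w).isClosed_convexHull ℝ) hw
  refine ⟨fun k => φ (Pi.single k 1), fun x => ?_⟩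
  calc 0 < φ (w x) := (map_zero φ ▸ hu₀).trans (hu _ (subset_convexHull ℝ _ ⟨x, rfl⟩))
    _ = w x ⬝ᵥ fun k => φ (Pi.single k 1) := by
      simpa [dotProduct, ← Pi.single_apply, Pi.single_comm] using
        LinearMap.pi_apply_eq_sum_univ φ.toLinearMap (w x)

theorem exists_mem_linearIndependent_int [Finite K] {U : Set (K → ℝ)}
    (hU : IsOpen U) (hne : U.Nonempty) :
    ∃ l ∈ U, LinearIndependent ℤ l := by
  have := Fintype.ofFinite K
  have hdense (z : {z : K → ℤ // z ≠ 0}) : Dense {l : K → ℝ | ∑ k, z.1 k • l k = 0}ᶜ := by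
    let φ : (K → ℝ) →ₗ[ℝ] ℝ := ∑ k, (z.1 k : ℝ) • LinearMap.proj k
    have hφ l : φ l = ∑ k, z.1 k • l k := by simp [φ]
    rw [← interior_eq_empty_iff_dense_compl, ← Set.not_nonempty_iff_eq_empty]
    intro hint
    have htop : LinearMap.ker φ = ⊤ := Submodule.eq_top_of_nonempty_interior' _ <| by
      simpa [LinearMap.ker, Submodule.comap, Set.preimage, hφ] using hint
    refine z.2 (funext fun k => ?_)
    classical
    simpa [hφ, Pi.single_apply] using
      DFunLike.congr_fun (LinearMap.ker_eq_top.mp htop) (Pi.single k 1)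
  obtain ⟨l, hlU, hl⟩ := (dense_iInter_of_isOpen (fun z : {z : K → ℤ // z ≠ 0} =>
    (isClosed_eq (by fun_prop) continuous_const).isOpen_compl) hdense).exists_mem_open hU hne
  refine ⟨l, hl, Fintype.linearIndependent_iff.mpr fun z hz k => ?_⟩
  by_contra hk
  exact Set.mem_iInter.mp hlU ⟨z, fun h => hk (congrFun h k)⟩ hz

end PositiveFunctional

section Relation

variable {X K : Type*} [Fintype X]

theorem exists_natCast_relation_of_real_relation [Finite K] (w : X → K → ℤ) {c : X → ℝ}
    (hc : ∀ x, 0 ≤ c x) (hc₀ : c ≠ 0) (h : ∀ k, ∑ x, c x * w x k = 0) :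
    ∃ m : X → ℕ, m ≠ 0 ∧ ∀ k, ∑ x, (m x : ℤ) * w x k = 0 := by
  classical
  have := Fintype.ofFinite K
  obtain ⟨x₀, hx₀⟩ := Function.ne_iff.mp hc₀
  set b : X → ℝ := fun x => c x / c x₀ with hb
  have hb₀ x : 0 ≤ b x := div_nonneg (hc x) (hc x₀)
  have hsum k : ∑ x, b x * w x k = 0 := by
    simp_rw [hb, div_mul_eq_mul_div, ← Finset.sum_div, h, zero_div]
  let G (t : ℕ) (k : K) : ℤ := ∑ x, (⌊t * b x⌋₊ : ℤ) * w x k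
  have hG t k : |G t k| ≤ ∑ x, |w x k| := by
    have hcast : (G t k : ℝ) = ∑ x, (⌊t * b x⌋₊ - t * b x) * w x k := by
      simp [G, sub_mul, mul_assoc, ← Finset.mul_sum, hsum]
    suffices |(G t k : ℝ)| ≤ ∑ x, |(w x k : ℝ)| by exact_mod_cast this
    rw [hcast]
    refine (Finset.abs_sum_le_sum_abs _ _).trans (Finset.sum_le_sum fun x _ => ?_)
    rw [abs_mul]
    refine mul_le_of_le_one_left (abs_nonneg _) (abs_le.mpr ⟨?_, ?_⟩)
    · linarith [Nat.lt_floor_add_one (t * b x)]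
    · linarith [Nat.floor_le (mul_nonneg t.cast_nonneg (hb₀ x))]
  obtain ⟨t, t', htt', hGt⟩ := Set.Finite.exists_lt_map_eq_of_forall_mem (f := G)
    (fun t => Set.mem_Icc.mpr ⟨fun k => (abs_le.mp (hG t k)).1, fun k => (abs_le.mp (hG t k)).2⟩)
    (Set.finite_Icc _ _)
  refine ⟨fun x => ⌊t' * b x⌋₊ - ⌊t * b x⌋₊, fun hm => ?_, fun k => ?_⟩
  · have := congrFun hm x₀
    simp only [hb, div_self hx₀, mul_one, Nat.floor_natCast, Pi.zero_apply] at this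
    omega
  · have hmono x : ⌊t * b x⌋₊ ≤ ⌊t' * b x⌋₊ := by gcongr; exact hb₀ x
    simpa [Nat.cast_sub (hmono _), sub_mul] using sub_eq_zero.mpr (congrFun hGt k).symm

theorem exists_natCast_relation_of_zero_mem_convexHull [Finite K] (w : X → K → ℤ)
    (h : (0 : K → ℝ) ∈ convexHull ℝ (Set.range fun x k => (w x k : ℝ))) :
    ∃ m : X → ℕ, m ≠ 0 ∧ ∀ k, ∑ x, (m x : ℤ) * w x k = 0 := by
  classical
  rw [convexHull_range_eq_exists_affineCombination] at h
  obtain ⟨s, c, hc, hc₁, hsum⟩ := h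
  rw [s.affineCombination_eq_linear_combination _ _ hc₁] at hsum
  refine exists_natCast_relation_of_real_relation w (c := fun x => if x ∈ s then c x else 0)
    (fun x => ?_) (fun h₀ => ?_) fun k => ?_
  · split_ifs with hx
    exacts [hc x hx, le_rfl]
  · refine one_ne_zero (hc₁.symm.trans (Finset.sum_eq_zero fun x hx => ?_))
    simpa [hx] using congrFun h₀ x
  · simpa using congrFun hsum k

theorem exists_dotProduct_pos_linearIndependent_int [Fintype K] (w : X → K → ℤ)
    (hw : ∀ m : X → ℕ, (∀ k, ∑ x, (m x : ℤ) * w x k = 0) → m = 0) :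
    ∃ l : K → ℝ, (∀ x, 0 < ∑ k, w x k * l k) ∧ LinearIndependent ℤ l := by
  have hhull : (0 : K → ℝ) ∉ convexHull ℝ (Set.range fun x k => (w x k : ℝ)) := fun h => by
    obtain ⟨m, hm, hrel⟩ := exists_natCast_relation_of_zero_mem_convexHull w h
    exact hm (hw m hrel)
  have hopen : IsOpen {l : K → ℝ | ∀ x, 0 < ∑ k, w x k * l k} := by
    simp only [Set.ofPred_forall]
    exact isOpen_iInter_of_finite fun x => isOpen_lt continuous_const (by fun_prop)
  exact exists_mem_linearIndependent_int hopen
    (exists_dotProduct_pos_of_zero_notMem_convexHull hhull)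

end Relation

theorem eq_zero_of_forall_add_nsmul_mem {ι : Type*} {S : Set (ι → ℕ)} (hS : S.Finite)
    {p m : ι → ℕ} (h : ∀ t : ℕ, p + t • m ∈ S) : m = 0 := by
  obtain ⟨t, t', htt', heq⟩ := hS.exists_lt_map_eq_of_forall_mem h
  funext i
  simpa [htt'.ne] using congrFun heq i

theorem exists_pos_weights {ι K : Type*} [Fintype ι] [Fintype K] [DecidableEq ι] (i₀ : ι)
    (a : K → ι → ℤ)
    (ha : ∀ m : ι → ℕ, m i₀ = 0 → (∀ k, ∑ i, a k i * (m i : ℤ) = 0) → m = 0) :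
    ∃ l : K → ℝ, (∀ i, 0 < (if i = i₀ then 1 else 0) + ∑ k, a k i * l k) ∧
      ∀ (t : ℤ) (z : K → ℤ), t + ∑ k, z k * l k = 0 → t = 0 ∧ ∀ k, z k = 0 := by
  classical
  -- The extra vector `e₀` makes the coordinate `l₀` of the functional positive.
  let w : Option ι → Option K → ℤ
    | none => fun k => k.elim 1 fun _ => 0
    | some i => fun k => k.elim (if i = i₀ then 1 else 0) (a · i)
  obtain ⟨l, hl, hind⟩ := exists_dotProduct_pos_linearIndependent_int w fun m hm => by
    have hm₀ : m none = 0 ∧ m (some i₀) = 0 := by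
      have := hm none
      simp [w] at this
      omega
    have hm_some := ha (fun i => m (some i)) hm₀.2 fun k => by
      simpa [w, mul_comm] using hm (some k)
    funext x
    exact x.rec hm₀.1 (congrFun hm_some)
  have hl₀ : 0 < l none := by simpa [w] using hl none
  refine ⟨fun k => l (some k) / l none, fun i => ?_, fun t z h => ?_⟩
  · have := div_pos (hl (some i)) hl₀
    simpa [w, add_div, Finset.sum_div, mul_div_assoc, ite_div, hl₀.ne'] using this
  · have := Fintype.linearIndependent_iff.mp hind (fun k => k.elim t z) (by
      simp_rw [mul_div_assoc', ← Finset.sum_div] at h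
      field_simp at h
      simpa using h)
    exact ⟨this none, fun k => this (some k)⟩

theorem exists_real_equation {ι K : Type*} [Fintype ι] [Finite K] (i₀ : ι)
    {φ : K → (ι → ℕ) → ℤ} (hφ : ∀ k, IsAff (φ k)) {n₀ : ℕ}
    (hne : {p : ι → ℕ | p i₀ = n₀ ∧ ∀ k, φ k p = 0}.Nonempty)
    (hfin : {p : ι → ℕ | p i₀ = n₀ ∧ ∀ k, φ k p = 0}.Finite) :
    ∃ (W : ι → ℝ) (η : ℝ), (∀ i, 0 < W i) ∧ ∀ (p : ι → ℕ) (n : ℕ),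
      (p i₀ = n ∧ ∀ k, φ k p = 0) ↔ ∑ i, p i * W i = n + η := by
  classical
  have := Fintype.ofFinite K
  choose a c hac using hφ
  obtain ⟨p₀, hp₀, hpφ⟩ := hne
  obtain ⟨l, hl, hind⟩ := exists_pos_weights i₀ a fun m hm₀ hm =>
    eq_zero_of_forall_add_nsmul_mem hfin (p := p₀) fun t => by
      refine ⟨by simp [hp₀, hm₀], fun k => ?_⟩
      calc φ k (p₀ + t • m) = φ k p₀ + t * ∑ i, a k i * m i := by
            simp [hac, mul_add, Finset.sum_add_distrib, Finset.mul_sum, mul_left_comm]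
            ring
        _ = 0 := by rw [hpφ, hm, mul_zero, add_zero]
  refine ⟨fun i => (if i = i₀ then 1 else 0) + ∑ k, a k i * l k, -∑ k, c k * l k, hl,
    fun p n => ?_⟩
  have hsum : ∑ i, p i * ((if i = i₀ then 1 else 0) + ∑ k, a k i * l k) - (n + -∑ k, c k * l k) =
      ((p i₀ - n : ℤ) : ℝ) + ∑ k, φ k p * l k := by
    simp only [hac, mul_add, add_mul, Finset.sum_add_distrib, Finset.mul_sum, Finset.sum_mul,
      Int.cast_add, Int.cast_sum, Int.cast_mul, Int.cast_natCast, Int.cast_sub, mul_ite, mul_one,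
      mul_zero, Finset.sum_ite_eq', Finset.mem_univ, if_true]
    rw [Finset.sum_comm]
    simp only [mul_left_comm, mul_assoc]
    ring
  beta_reduce
  rw [← sub_eq_zero (b := (n + _ : ℝ)), hsum]
  constructor
  · rintro ⟨hp, hk⟩
    simp [hp, hk]
  · intro h
    obtain ⟨hn, hk⟩ := hind _ _ h
    exact ⟨by omega, hk⟩

/-! ### Walkable functions -/

/-- Functions of the length counting the walks from a fixed vertex `s` to a fixed vertex without
outgoing edges. -/
def IsWalkable (g : ℝ → ℝ≥0∞) : Prop :=
  ∃ (Q E : Type) (_ : Finite Q) (_ : Fintype E) (src dst : E → Q) (len : E → ℝ) (fin : Q)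
    (N : Q → ℝ → ℝ≥0∞) (s : Q), IsWalkCount src dst len fin N ∧ (∀ e, src e ≠ fin) ∧ N s = g

theorem IsWalkCount.of_neg {Q E G A : Type*} [Fintype E] [AddCommGroup G] [PartialOrder G]
    [AddCommMonoidWithOne A] {src dst : E → Q} {len : E → G} {fin : Q} {N : Q → G → A}
    (hN : IsWalkCount src dst len fin N) (p : Q) {L : G} (hL : L < 0) : N p L = 0 :=
  not_not.mp fun h => hL.not_ge (hN.nonneg_of_ne_zero p L h)

theorem IsWalkable.of_neg {g : ℝ → ℝ≥0∞} (hg : IsWalkable g) {L : ℝ} (hL : L < 0) : g L = 0 := by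
  obtain ⟨Q, E, _, _, src, dst, len, fin, N, s, hN, -, rfl⟩ := hg
  exact hN.of_neg s hL

open scoped Classical in
theorem isWalkable_indicator_zero : IsWalkable fun L => if L = 0 then 1 else 0 :=
  ⟨Unit, Empty, inferInstance, inferInstance, nofun, nofun, nofun, (),
    fun _ L => if L = 0 then 1 else 0, (),
    isWalkCount_of_first_edge nofun (fun _ L hL => if_neg hL.ne) (by simp), nofun, rfl⟩

theorem IsWalkable.loops {I : Type} [Fintype I] {g G : ℝ → ℝ≥0∞} (hg : IsWalkable g) {x : I → ℝ}
    (hx : ∀ i, 0 < x i) (of_neg : ∀ L < 0, G L = 0)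
    (hG : ∀ L, G L = g (L - 1) + ∑ i, G (L - x i)) : IsWalkable G := by
  classical
  obtain ⟨Q, E, _, _, src, dst, len, fin, N, s, hN, hfin, rfl⟩ := hg
  refine ⟨Option Q, E ⊕ Option I, inferInstance, inferInstance,
    Sum.elim (some ∘ src) fun _ => none,
    Sum.elim (some ∘ dst) fun i => i.elim (some s) fun _ => none,
    Sum.elim len fun i => i.elim 1 x, some fin, fun q => q.elim G N, none,
    isWalkCount_of_first_edge ?_ ?_ ?_, by simp [hfin], rfl⟩
  · rintro (e | _ | i)
    exacts [hN.len_pos e, one_pos, hx i]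
  · rintro (_ | q) L hL
    exacts [of_neg L hL, hN.of_neg q hL]
  · rintro (_ | q) L -
    · simpa [Fintype.sum_option] using hG L
    · simpa [Fintype.sum_option] using hN.first_edge q L

theorem tsum_choose_mul (G : ℕ → ℕ → ℝ≥0∞) :
    ∑' c : ℕ × ℕ, ((c.1 + c.2).choose c.1 : ℝ≥0∞) * G c.1 c.2 =
      G 0 0 + ∑' c : ℕ × ℕ, ((c.1 + c.2).choose c.1 : ℝ≥0∞) * G (c.1 + 1) c.2 +
        ∑' c : ℕ × ℕ, ((c.1 + c.2).choose c.1 : ℝ≥0∞) * G c.1 (c.2 + 1) := by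
  have hdiag (H : ℕ → ℕ → ℝ≥0∞) : ∑' c : ℕ × ℕ, ((c.1 + c.2).choose c.1 : ℝ≥0∞) * H c.1 c.2 =
      ∑' n : ℕ, ∑ c ∈ Finset.HasAntidiagonal.antidiagonal n,
        (n.choose c.1 : ℝ≥0∞) * H c.1 c.2 := by
    rw [← Finset.HasAntidiagonal.sigmaAntidiagonalEquivProd.tsum_eq, ENNReal.tsum_sigma']
    refine tsum_congr fun n => ?_
    rw [← Finset.tsum_subtype]
    refine tsum_congr fun c => ?_
    simp [Finset.HasAntidiagonal.sigmaAntidiagonalEquivProd,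
      Finset.HasAntidiagonal.mem_antidiagonal.mp c.2]
  rw [hdiag G, hdiag fun a b => G (a + 1) b, hdiag fun a b => G a (b + 1),
    tsum_eq_zero_add' ENNReal.summable, add_assoc, add_comm (∑' n, _), ← ENNReal.tsum_add]
  congr 1
  · simp
  · refine tsum_congr fun n => ?_
    rw [Finset.sum_antidiagonal_choose_succ_mul]
    congr 1
    refine Finset.sum_congr rfl fun c hc => ?_
    rw [Nat.choose_symm_of_eq_add (Finset.HasAntidiagonal.mem_antidiagonal.mp hc).symm]

theorem IsWalkable.tsum_choose {g : ℝ → ℝ≥0∞} (hg : IsWalkable g) {x y : ℝ} (hx : 0 < x)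
    (hy : 0 < y) : IsWalkable fun L =>
      ∑' c : ℕ × ℕ, ((c.1 + c.2).choose c.1 : ℝ≥0∞) * g (L - 1 - c.1 * x - c.2 * y) := by
  refine hg.loops (x := fun b => bif b then x else y) (Bool.rec hy hx) (fun L hL => ?_) fun L => ?_
  · refine ENNReal.tsum_eq_zero.mpr fun c => ?_
    rw [hg.of_neg, mul_zero]
    have := mul_nonneg c.1.cast_nonneg hx.le
    have := mul_nonneg c.2.cast_nonneg hy.le
    linarith
  · rw [tsum_choose_mul fun a b => g (L - 1 - a * x - b * y), Fintype.sum_bool, add_assoc]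
    simp only [Nat.cast_zero, Nat.cast_add, Nat.cast_one, zero_mul, sub_zero, cond_true, cond_false]
    congr! 4 with c c <;> ring_nf

/-- New initial and final vertices are joined to the two walks by edges of lengths `x`, `y` and
`1`. -/
theorem IsWalkable.add {g₁ g₂ : ℝ → ℝ≥0∞} (h₁ : IsWalkable g₁) (h₂ : IsWalkable g₂) {x y : ℝ}
    (hx : 0 < x) (hy : 0 < y) : IsWalkable fun L => g₁ (L - 1 - x) + g₂ (L - 1 - y) := by
  classical
  obtain ⟨Q₁, E₁, _, _, src₁, dst₁, len₁, fin₁, N₁, s₁, hN₁, -, rfl⟩ := h₁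
  obtain ⟨Q₂, E₂, _, _, src₂, dst₂, len₂, fin₂, N₂, s₂, hN₂, -, rfl⟩ := h₂
  let N : Bool ⊕ Q₁ ⊕ Q₂ → ℝ → ℝ≥0∞
    | .inl false, L => N₁ s₁ (L - 1 - x) + N₂ s₂ (L - 1 - y)
    | .inl true, L => if L = 0 then 1 else 0
    | .inr (.inl q), L => N₁ q (L - 1)
    | .inr (.inr q), L => N₂ q (L - 1)
  refine ⟨Bool ⊕ Q₁ ⊕ Q₂, (E₁ ⊕ E₂) ⊕ Bool ⊕ Bool, inferInstance, inferInstance,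
    Sum.elim (Sum.map src₁ src₂ · |> .inr) (Sum.elim (fun _ => .inl false)
      fun b => .inr (bif b then .inl fin₁ else .inr fin₂)),
    Sum.elim (Sum.map dst₁ dst₂ · |> .inr) (Sum.elim
      (fun b => .inr (bif b then .inl s₁ else .inr s₂)) fun _ => .inl true),
    Sum.elim (Sum.elim len₁ len₂) (Sum.elim (fun b => bif b then x else y) fun _ => 1),
    .inl true, N, .inl false, isWalkCount_of_first_edge ?_ ?_ ?_, ?_, rfl⟩
  · rintro ((e | e) | (_ | _) | _)
    exacts [hN₁.len_pos e, hN₂.len_pos e, hy, hx, one_pos]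
  · rintro ((_ | _) | q | q) L hL
    · simp only [N]
      rw [hN₁.of_neg _ (by linarith), hN₂.of_neg _ (by linarith), add_zero]
    · exact if_neg hL.ne
    · exact hN₁.of_neg q (by linarith)
    · exact hN₂.of_neg q (by linarith)
  · rintro ((_ | _) | q | q) L -
    · simp [N, sub_right_comm]
    · simp [N]
    · simp [N, hN₁.first_edge q (L - 1), sub_right_comm, eq_comm (a := q), ite_and, add_comm]
    · simp [N, hN₂.first_edge q (L - 1), sub_right_comm, eq_comm (a := q), ite_and, add_comm]
  · rintro ((e | e) | (_ | _) | _ | _) <;> simp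

/-- Sequences obtained by evaluating a walk count at the points `n + η`. -/
def IsWalkSequence (f : ℕ → ℝ≥0∞) : Prop :=
  ∃ g, IsWalkable g ∧ ∃ η : ℝ, ∀ n : ℕ, f n = g (n + η)

theorem isWalkSequence_zero : IsWalkSequence fun _ => 0 :=
  ⟨_, isWalkable_indicator_zero, 1, fun n => (if_neg n.cast_add_one_ne_zero).symm⟩

theorem IsWalkSequence.add {f₁ f₂ : ℕ → ℝ≥0∞} (h₁ : IsWalkSequence f₁) (h₂ : IsWalkSequence f₂) :
    IsWalkSequence fun n => f₁ n + f₂ n := by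
  obtain ⟨g₁, hg₁, η₁, h₁⟩ := h₁
  obtain ⟨g₂, hg₂, η₂, h₂⟩ := h₂
  have hη₁ := le_max_left η₁ η₂
  have hη₂ := le_max_right η₁ η₂
  refine ⟨_, hg₁.add hg₂ (x := max η₁ η₂ + 1 - η₁) (y := max η₁ η₂ + 1 - η₂) (by linarith)
    (by linarith), max η₁ η₂ + 2, fun n => ?_⟩
  simp only [h₁, h₂]
  congr 2 <;> ring

theorem isWalkSequence_sum {X : Type*} (s : Finset X) (f : X → ℕ → ℝ≥0∞)
    (h : ∀ x ∈ s, IsWalkSequence (f x)) : IsWalkSequence fun n => ∑ x ∈ s, f x n := by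
  classical
  induction s using Finset.induction_on with
  | empty => simpa using isWalkSequence_zero
  | insert x s hx ih =>
    simp only [Finset.sum_insert hx]
    exact (h x (s.mem_insert_self x)).add (ih fun y hy => h y (Finset.mem_insert_of_mem hy))

open scoped Classical in
theorem isWalkable_tsum_prod_choose {J : Type} [Fintype J] (x y : J → ℝ) (hx : ∀ j, 0 < x j)
    (hy : ∀ j, 0 < y j) :
    IsWalkable fun L => ∑' c : J → ℕ × ℕ,
      if ∑ j, ((c j).1 * x j + (c j).2 * y j + 1) = L then
        ∏ j, (((c j).1 + (c j).2).choose (c j).1 : ℝ≥0∞) else 0 := by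
  revert x y
  refine Fintype.induction_empty_option (P := fun J _ => ∀ x y : J → ℝ, (∀ j, 0 < x j) →
    (∀ j, 0 < y j) → IsWalkable fun L => ∑' c : J → ℕ × ℕ,
      if ∑ j, ((c j).1 * x j + (c j).2 * y j + 1) = L then
        ∏ j, (((c j).1 + (c j).2).choose (c j).1 : ℝ≥0∞) else 0) ?_ ?_ ?_ J
  · intro J J' _ e ih x y hx hy
    convert ih (x ∘ e) (y ∘ e) (fun _ => hx _) fun _ => hy _ using 2 with L
    let := Fintype.ofEquiv J' e.symm
    rw [← (e.arrowCongr (Equiv.refl (ℕ × ℕ))).tsum_eq]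
    refine tsum_congr fun c => ?_
    simp only [← e.sum_comp, ← e.prod_comp]
    simp
  · intro x y _ _
    convert isWalkable_indicator_zero using 2 with L
    simp [tsum_fintype, eq_comm]
  · intro J _ ih x y hx hy
    convert (ih (x ∘ some) (y ∘ some) (fun _ => hx _) fun _ => hy _).tsum_choose
      (hx none) (hy none) using 2 with L
    rw [← Equiv.piOptionEquivProd.symm.tsum_eq, ENNReal.tsum_prod']
    refine tsum_congr fun c => ?_
    rw [← ENNReal.tsum_mul_left]
    refine tsum_congr fun v => ?_
    simp only [Equiv.piOptionEquivProd_symm_apply, Fintype.sum_option, Fintype.prod_option,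
      Function.comp_apply, mul_ite, mul_zero]
    congr 1
    exact propext ⟨fun h => by linarith, fun h => by linarith⟩

/-! ### Binomial multisums count walks -/

section SystemSum

variable {J K : Type} [Fintype J]

/-- The coordinates of a family of pairs. -/
def coordinates (c : J → ℕ × ℕ) : J ⊕ J → ℕ := Sum.elim (fun j => (c j).1) fun j => (c j).2

open scoped Classical in
/-- The sum of products of binomial coefficients over all natural solutions of a system of
equations in which a distinguished coordinate has the prescribed value `n`. -/
noncomputable def systemSum (j₀ : J) (φ : K → (J ⊕ J → ℕ) → ℤ) (n : ℕ) : ℝ≥0∞ :=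
  ∑' c : J → ℕ × ℕ, if (c j₀).1 = n ∧ ∀ k, φ k (coordinates c) = 0 then
    ∏ j, (((c j).1 + (c j).2).choose (c j).1 : ℝ≥0∞) else 0

theorem finite_solutions_of_systemSum_ne_top {j₀ : J} {φ : K → (J ⊕ J → ℕ) → ℤ} {n : ℕ}
    (h : systemSum j₀ φ n ≠ ⊤) :
    {p : J ⊕ J → ℕ | p (.inl j₀) = n ∧ ∀ k, φ k p = 0}.Finite := by
  classical
  refine ((ENNReal.finite_const_le_of_tsum_ne_top h one_ne_zero).image coordinates).subset ?_
  rintro p ⟨hp, hpφ⟩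
  have hcoord : coordinates (fun j => (p (.inl j), p (.inr j))) = p :=
    Sum.elim_comp_inl_inr p
  refine ⟨_, ?_, hcoord⟩
  rw [Set.mem_ofPred_eq, hcoord, if_pos ⟨hp, hpφ⟩, ← Nat.cast_prod, Nat.one_le_cast]
  exact Finset.prod_pos fun j _ => Nat.choose_pos (Nat.le_add_right _ _)

theorem isWalkSequence_systemSum [Finite K] (j₀ : J) {φ : K → (J ⊕ J → ℕ) → ℤ}
    (hφ : ∀ k, IsAff (φ k)) (h : ∀ n, systemSum j₀ φ n ≠ ⊤) :
    IsWalkSequence (systemSum j₀ φ) := by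
  classical
  by_cases hne : ∃ c : J → ℕ × ℕ, ∀ k, φ k (coordinates c) = 0
  · obtain ⟨c₀, hc₀⟩ := hne
    obtain ⟨W, η, hW, hiff⟩ := exists_real_equation (.inl j₀) hφ ⟨coordinates c₀, rfl, hc₀⟩
      (finite_solutions_of_systemSum_ne_top (h (c₀ j₀).1))
    refine ⟨_, isWalkable_tsum_prod_choose (fun j => W (.inl j)) (fun j => W (.inr j))
      (fun j => hW _) fun j => hW _, η + Fintype.card J, fun n => tsum_congr fun c => ?_⟩
    congr 1
    refine propext ((hiff (coordinates c) n).trans ?_)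
    simp [coordinates, Finset.sum_add_distrib, ← add_assoc]
  · convert isWalkSequence_zero with n
    exact ENNReal.tsum_eq_zero.mpr fun c => if_neg fun hc => hne ⟨c, hc.2⟩

end SystemSum

theorem prod_tsum {ι X : Type*} [Fintype ι] (f : ι → X → ℝ≥0∞) :
    ∏ i, ∑' x, f i x = ∑' c : ι → X, ∏ i, f i (c i) := by
  revert f
  refine Fintype.induction_empty_option (P := fun ι _ => ∀ f : ι → X → ℝ≥0∞,
    ∏ i, ∑' x, f i x = ∑' c : ι → X, ∏ i, f i (c i)) ?_ ?_ ?_ ι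
  · intro ι κ _ e ih f
    let := Fintype.ofEquiv κ e.symm
    rw [← e.prod_comp, ih fun i => f (e i), ← (e.arrowCongr (Equiv.refl X)).tsum_eq]
    refine tsum_congr fun c => ?_
    simp [← e.prod_comp]
  · intro f
    simp [tsum_fintype]
  · intro ι _ ih f
    rw [← Equiv.piOptionEquivProd.symm.tsum_eq, ENNReal.tsum_prod', Fintype.prod_option, ih,
      ← ENNReal.tsum_mul_right]
    refine tsum_congr fun c => ?_
    simp [← ENNReal.tsum_mul_left]

/-- The integers as natural numbers with a sign: `(false, u)` stands for `u` and `(true, u)` for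
`-1 - u`. -/
def signedEquiv : Bool × ℕ ≃ ℤ := (Equiv.boolProdEquivSum ℕ).trans Equiv.intEquivNatSumNat.symm

theorem signedEquiv_apply (s : Bool) (u : ℕ) :
    signedEquiv (s, u) = (bif s then -1 else 1) * u - s.toInt := by
  cases s
  · simp [signedEquiv, Equiv.intEquivNatSumNat]
  · simp [signedEquiv, Equiv.intEquivNatSumNat, Int.negSucc_eq]
    ring

theorem tsum_int_eq_sum_tsum_nat {d : ℕ} (F : (Fin d → ℤ) → ℝ≥0∞) :
    ∑' v, F v = ∑ σ : Fin d → Bool, ∑' u : Fin d → ℕ, F fun j => signedEquiv (σ j, u j) := by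
  rw [← ((Equiv.arrowProdEquivProdArrow (Fin d) (fun _ => Bool) fun _ => ℕ).symm.trans
    (Equiv.piCongrRight fun _ => signedEquiv)).tsum_eq, ENNReal.tsum_prod', tsum_fintype]
  rfl

/-- The system of equations in `x` and `y` whose solution contributes `(x + y).choose x` to
`binom a b`: the sign `s = false` accounts for `0 ≤ b ≤ a` and `s = true` for `(a, b) = (-1, 0)`. -/
def binomSystem (s : Bool) (a b x y : ℤ) : Fin 3 → ℤ :=
  ![x - b, x + y - a - s.toInt, s.toInt * (x + y)]

theorem binomSystem_false_eq_zero_iff {a b x y : ℤ} :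
    (∀ t, binomSystem false a b x y t = 0) ↔ x = b ∧ y = a - b := by
  simp [binomSystem, Fin.forall_fin_succ]
  omega

theorem binomSystem_true_eq_zero_iff {a b : ℤ} {x y : ℕ} :
    (∀ t, binomSystem true a b x y t = 0) ↔ (x = 0 ∧ y = 0) ∧ a = -1 ∧ b = 0 := by
  simp [binomSystem, Fin.forall_fin_succ]
  omega

open scoped Classical in
theorem binom_eq_sum_tsum (a b : ℤ) : (binom a b : ℝ≥0∞) = ∑ s : Bool, ∑' x : ℕ × ℕ,
    if ∀ t, binomSystem s a b x.1 x.2 t = 0 then ((x.1 + x.2).choose x.1 : ℝ≥0∞) else 0 := by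
  have htrue : (∑' x : ℕ × ℕ, if ∀ t, binomSystem true a b x.1 x.2 t = 0 then
      ((x.1 + x.2).choose x.1 : ℝ≥0∞) else 0) = if a = -1 ∧ b = 0 then 1 else 0 := by
    simp only [binomSystem_true_eq_zero_iff]
    rw [tsum_eq_single (0, 0) fun x hx => if_neg fun h => hx (Prod.ext h.1.1 h.1.2)]
    simp
  have hfalse : (∑' x : ℕ × ℕ, if ∀ t, binomSystem false a b x.1 x.2 t = 0 then
      ((x.1 + x.2).choose x.1 : ℝ≥0∞) else 0) =
      if 0 ≤ b ∧ b ≤ a then (a.toNat.choose b.toNat : ℝ≥0∞) else 0 := by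
    simp only [binomSystem_false_eq_zero_iff]
    rw [tsum_eq_single (b.toNat, (a - b).toNat) fun x hx => if_neg fun h =>
      hx (Prod.ext (by simp [← h.1]) (by simp [← h.2]))]
    have hiff : ((b.toNat : ℤ) = b ∧ ((a - b).toNat : ℤ) = a - b) ↔ 0 ≤ b ∧ b ≤ a := by omega
    simp only [hiff]
    by_cases h : 0 ≤ b ∧ b ≤ a
    · rw [if_pos h, if_pos h, show b.toNat + (a - b).toNat = a.toNat by omega]
    · rw [if_neg h, if_neg h]
  rw [Fintype.sum_bool, htrue, hfalse, binom]
  split_ifs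
  any_goals omega
  all_goals simp

section Encoding

variable {r d : ℕ}

/-- The equations on blocks `c : Option (Fin d) ⊕ Fin r → ℕ × ℕ` that describe the summands with
signs `σ` of the variables and signs `S` of the binomial coefficients. The blocks `(n, 0)` and
`(u, 0)` encode the argument and the absolute values of the variables, the others the binomial
coefficients. -/
def encodingSystem (α β : Fin r → AffineForm d) (σ : Fin d → Bool) (S : Fin r → Bool) :
    Option (Fin d) ⊕ Fin r × Fin 3 →
      ((Option (Fin d) ⊕ Fin r) ⊕ (Option (Fin d) ⊕ Fin r) → ℕ) → ℤ :=
  Sum.elim (fun o p => p (.inr (.inl o))) fun i p =>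
    binomSystem (S i.1)
      ((α i.1).eval (fun j => signedEquiv (σ j, p (.inl (.inl (some j))))) (p (.inl (.inl none))))
      ((β i.1).eval (fun j => signedEquiv (σ j, p (.inl (.inl (some j))))) (p (.inl (.inl none))))
      (p (.inl (.inr i.1))) (p (.inr (.inr i.1))) i.2

theorem isAff_eval_signedEquiv {ι : Type*} [Fintype ι] (α : AffineForm d) (σ : Fin d → Bool)
    (u : Fin d → ι) (i₀ : ι) :
    IsAff fun p : ι → ℕ => α.eval (fun j => signedEquiv (σ j, p (u j))) (p i₀) := by
  simp only [AffineForm.eval, signedEquiv_apply]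
  exact ((isAff_sum _ _ fun j _ => (((isAff_coord _).const_mul _).sub
    (isAff_const _)).const_mul _).add ((isAff_coord _).const_mul _)).add (isAff_const _)

theorem isAff_binomSystem {ι : Type*} [Fintype ι] (s : Bool) {a b x y : (ι → ℕ) → ℤ}
    (ha : IsAff a) (hb : IsAff b) (hx : IsAff x) (hy : IsAff y) (t : Fin 3) :
    IsAff fun p => binomSystem s (a p) (b p) (x p) (y p) t := by
  fin_cases t
  exacts [hx.sub hb, ((hx.add hy).sub ha).sub (isAff_const _), (hx.add hy).const_mul _]

theorem isAff_encodingSystem (α β : Fin r → AffineForm d) (σ : Fin d → Bool) (S : Fin r → Bool)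
    (k : Option (Fin d) ⊕ Fin r × Fin 3) : IsAff (encodingSystem α β σ S k) := by
  rcases k with o | ⟨i, t⟩
  · exact isAff_coord _
  · exact isAff_binomSystem _ (isAff_eval_signedEquiv _ _ _ _) (isAff_eval_signedEquiv _ _ _ _)
      (isAff_coord _) (isAff_coord _) t

open scoped Classical in
theorem systemSum_encodingSystem (α β : Fin r → AffineForm d) (σ : Fin d → Bool)
    (S : Fin r → Bool) (n : ℕ) :
    systemSum (.inl none) (encodingSystem α β σ S) n =
      ∑' (u : Fin d → ℕ) (x : Fin r → ℕ × ℕ), ∏ i,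
        if ∀ t, binomSystem (S i) ((α i).eval (fun j => signedEquiv (σ j, u j)) n)
          ((β i).eval (fun j => signedEquiv (σ j, u j)) n) (x i).1 (x i).2 t = 0
        then (((x i).1 + (x i).2).choose (x i).1 : ℝ≥0∞) else 0 := by
  let block (u : Fin d → ℕ) (o : Option (Fin d)) : ℕ × ℕ := (o.elim n u, 0)
  have hblock : Function.Injective block := fun u u' h =>
    funext fun j => congrArg Prod.fst (congrFun h (some j))
  rw [systemSum, ← (Equiv.sumArrowEquivProdArrow _ _ _).symm.tsum_eq, ENNReal.tsum_prod',
    ← hblock.tsum_eq]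
  · refine tsum_congr fun u => tsum_congr fun x => ?_
    rw [Fintype.prod_ite_zero]
    simp [encodingSystem, coordinates, Equiv.sumArrowEquivProdArrow, Fintype.prod_sum_type, block]
  · intro w hw
    obtain ⟨x, hx⟩ := not_forall.mp (mt ENNReal.tsum_eq_zero.mpr hw)
    obtain ⟨hn, hsys⟩ := of_not_not fun h => hx (if_neg h)
    refine ⟨fun j => (w (some j)).1, funext fun o => Prod.ext ?_ ?_⟩
    · cases o
      exacts [hn.symm, rfl]
    · exact (Int.natCast_eq_zero.mp (hsys (.inl o))).symm

end Encoding

theorem isWalkSequence_of_mem_binomialMultisums {f : ℕ → ℕ} (hf : f ∈ binomialMultisums) :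
    IsWalkSequence fun n => (f n : ℝ≥0∞) := by
  classical
  obtain ⟨r, d, α, β, h⟩ := hf
  have hsum : ∀ n, (f n : ℝ≥0∞) = ∑ x : (Fin d → Bool) × (Fin r → Bool),
      systemSum (.inl none) (encodingSystem α β x.1 x.2) n := by
    intro n
    rw [← (tsum_natCast_eq_iff _ _).mpr (h n), tsum_int_eq_sum_tsum_nat, Fintype.sum_prod_type]
    refine Finset.sum_congr rfl fun σ _ => ?_
    simp only [systemSum_encodingSystem, Nat.cast_prod, binom_eq_sum_tsum, Fintype.prod_sum,
      prod_tsum]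
    exact Summable.tsum_finsetSum fun _ _ => ENNReal.summable
  simp only [hsum]
  refine isWalkSequence_sum _ _ fun x _ =>
    isWalkSequence_systemSum _ (isAff_encodingSystem α β x.1 x.2) fun n => ?_
  exact ENNReal.sum_ne_top.mp (hsum n ▸ ENNReal.natCast_ne_top _) x (Finset.mem_univ x)

/-! ### Tiles realizing the edges of a graph -/

theorem starConvex_interior {𝕜 V : Type*} [Field 𝕜] [LinearOrder 𝕜] [IsStrictOrderedRing 𝕜]
    [AddCommGroup V] [Module 𝕜 V] [TopologicalSpace V] [ContinuousAdd V]
    [ContinuousConstSMul 𝕜 V] {x : V} {s : Set V} (hs : StarConvex 𝕜 x s)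
    (hx : x ∈ interior s) : StarConvex 𝕜 x (interior s) := by
  intro y hy a b ha hb hab
  rcases hb.eq_or_lt with rfl | hb'
  · rw [add_zero] at hab
    rwa [hab, one_smul, zero_smul, add_zero]
  refine interior_maximal ?_ ((isOpen_interior.smul₀ hb'.ne').vadd (a • x))
    (Set.vadd_mem_vadd_set (Set.smul_mem_smul_set hy))
  rintro _ ⟨_, ⟨z, hz, rfl⟩, rfl⟩
  exact hs (interior_subset hz) ha hb hab

/-- The left side at height `y` of a tile or region whose left side is shifted to the right by `a`
in the upper half of the strip. -/
noncomputable def stepSide (a y : ℝ) : ℝ := if y < 1 / 2 then 0 else a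

/-- The closed tile of length `ℓ` the upper half of which has its left and right sides shifted to
the right by `a` and `b`. -/
def stepTile (a b ℓ : ℝ) : Set (ℝ × ℝ) :=
  Set.Icc (0, 0) (ℓ, 1 / 2) ∪ Set.Icc (a, 1 / 2) (ℓ + b, 1)

/-- The half-open strip to the right of the left side of a step tile with left shift `a`. -/
def stepRegion (a : ℝ) : Set (ℝ × ℝ) := {p | p.2 ∈ Set.Ico 0 1 ∧ stepSide a p.2 ≤ p.1}

section StepTile

variable {a b ℓ : ℝ}

theorem stepSide_zero_right (a : ℝ) : stepSide a 0 = 0 := if_pos (by norm_num)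

theorem stepSide_half (a : ℝ) : stepSide a (1 / 2) = a := if_neg (lt_irrefl _)

theorem stepSide_nonneg (ha : 0 ≤ a) (y : ℝ) : 0 ≤ stepSide a y := by
  unfold stepSide
  split_ifs
  exacts [le_rfl, ha]

theorem stepSide_le_add (ha : a ≤ ℓ) (hb : 0 ≤ b) (hℓ : 0 ≤ ℓ) (y : ℝ) :
    stepSide a y ≤ ℓ + stepSide b y := by
  unfold stepSide
  split_ifs <;> linarith

theorem mem_stepRegion_half {x : ℝ} : (x, 1 / 2) ∈ stepRegion a ↔ a ≤ x := by
  rw [stepRegion, Set.mem_ofPred_eq, stepSide_half]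
  exact and_iff_right (by norm_num)

theorem stepRegion_zero : stepRegion 0 = halfStrip 0 := by
  ext p
  simp [stepRegion, stepSide, halfStrip, and_comm]

theorem stepRegion_injective : Function.Injective stepRegion := fun _ _ h =>
  le_antisymm (mem_stepRegion_half.mp (h ▸ mem_stepRegion_half.mpr le_rfl))
    (mem_stepRegion_half.mp (h ▸ mem_stepRegion_half.mpr le_rfl))

theorem isAnchored_stepRegion (a : ℝ) : IsAnchored (stepRegion a) :=
  ⟨by simp [stepRegion, stepSide_zero_right], fun x hx => (stepSide_zero_right a).ge.trans hx.2⟩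

theorem stepTile_eq_biUnion_Icc (a b ℓ : ℝ) : stepTile a b ℓ =
    ⋃ c ∈ ({((0, 0), (ℓ, 1 / 2)), ((a, 1 / 2), (ℓ + b, 1))} : Finset ((ℝ × ℝ) × (ℝ × ℝ))),
      Set.Icc c.1 c.2 := by
  simp [stepTile]

theorem mem_germs_stepTile {p : ℝ × ℝ} : p ∈ germs (stepTile a b ℓ) ↔
    p.2 ∈ Set.Ico 0 1 ∧ p.1 ∈ Set.Ico (stepSide a p.2) (ℓ + stepSide b p.2) := by
  rw [stepTile_eq_biUnion_Icc, germs_biUnion_Icc]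
  simp only [halfOpenBox, Finset.mem_insert, Finset.mem_singleton, Set.iUnion_iUnion_eq_or_left,
    Set.iUnion_iUnion_eq_left, Set.mem_union, Set.mem_prod, Set.mem_Ico, stepSide]
  split_ifs <;> grind

theorem isAnchored_germs_stepTile (hℓ : 0 < ℓ) : IsAnchored (germs (stepTile a b ℓ)) := by
  refine ⟨mem_germs_stepTile.mpr ?_, fun x hx => ?_⟩
  · simpa [stepSide_zero_right] using hℓ
  · exact (stepSide_zero_right a).ge.trans (mem_germs_stepTile.mp hx).2.1

theorem germs_stepTile_subset_stepRegion : germs (stepTile a b ℓ) ⊆ stepRegion a := fun _ hp =>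
  have hp := mem_germs_stepTile.mp hp
  ⟨hp.1, hp.2.1⟩

theorem stepRegion_diff_germs_stepTile (ha : a ≤ ℓ) (hb : 0 ≤ b) (hℓ : 0 ≤ ℓ) :
    stepRegion a \ germs (stepTile a b ℓ) = translate (ℓ, 0) (stepRegion b) := by
  ext p
  have := stepSide_le_add ha hb hℓ p.2
  simp only [stepRegion, Set.mem_sdiff, Set.mem_ofPred_eq, mem_germs_stepTile, mem_translate,
    Prod.fst_sub, Prod.snd_sub, sub_zero, Set.mem_Ico]
  grind

theorem eq_of_germs_stepTile_eq {a' b' ℓ' : ℝ} (ha : a < ℓ) (hb : 0 ≤ b) (hℓ : 0 < ℓ)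
    (h : germs (stepTile a b ℓ) = germs (stepTile a' b' ℓ')) : a = a' ∧ b = b' := by
  have hsection y (hy : y ∈ Set.Ico (0 : ℝ) 1) : Set.Ico (stepSide a y) (ℓ + stepSide b y) =
      Set.Ico (stepSide a' y) (ℓ' + stepSide b' y) := by
    ext x
    have := congrArg ((x, y) ∈ ·) h
    simpa [mem_germs_stepTile, hy.1, hy.2] using this
  have hlower := hsection 0 (by norm_num)
  have hupper := hsection (1 / 2) (by norm_num)
  simp only [stepSide_zero_right, stepSide_half, add_zero] at hlower hupper
  rw [Set.Ico_eq_Ico_iff (.inl hℓ)] at hlower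
  rw [Set.Ico_eq_Ico_iff (.inl (by linarith))] at hupper
  exact ⟨hupper.1, by linarith [hlower.2, hupper.2]⟩

/-- A tile placed against a left side with a different shift leaves a hole to its left that no tile
can reach. -/
theorem remCount_stepRegion_diff_eq_zero {𝓣 : Set (Set (ℝ × ℝ))} (h𝓣 : ∀ τ ∈ 𝓣, IsAnchored τ)
    (hnonneg : ∀ τ ∈ 𝓣, ∀ p ∈ τ, (0 : ℝ) ≤ p.1) {c : ℝ} (ha : a < ℓ) (hb : 0 ≤ b) (hca : a ≠ c)
    (hsub : germs (stepTile a b ℓ) ⊆ stepRegion c) (L : ℝ) :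
    remCount 𝓣 (stepRegion c \ germs (stepTile a b ℓ)) L = 0 := by
  have hc : c < a := by
    refine lt_of_le_of_ne (mem_stepRegion_half.mp (hsub (mem_germs_stepTile.mpr ?_))) hca.symm
    rw [stepSide_half, stepSide_half]
    exact ⟨by norm_num, le_rfl, by linarith⟩
  have hhole : (c, 1 / 2) ∈ stepRegion c \ germs (stepTile a b ℓ) := by
    refine ⟨mem_stepRegion_half.mpr le_rfl, fun h => hc.not_ge ?_⟩
    simpa only [stepSide_half] using (mem_germs_stepTile.mp h).2.1
  refine remCount_eq_zero_of_lt h𝓣 (W := 0) (by simpa using hnonneg) (q := ℓ) (fun x hx => ?_)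
    hhole (by linarith) le_rfl L
  by_contra! hlt
  have hx0 := (isAnchored_stepRegion c).2 x hx.1
  exact hx.2 (mem_germs_stepTile.mpr (by simp [stepSide_zero_right, hx0, hlt]))

theorem image_snd_stepTile (hb : 0 ≤ b) (ha : a ≤ ℓ) (hℓ : 0 ≤ ℓ) :
    Prod.snd '' stepTile a b ℓ = Set.Icc 0 1 := by
  rw [stepTile, Set.image_union, Set.Icc_prod_eq, Set.Icc_prod_eq,
    Set.snd_image_prod (Set.nonempty_Icc.mpr hℓ),
    Set.snd_image_prod (Set.nonempty_Icc.mpr (by simp only; linarith)),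
    Set.Icc_union_Icc_eq_Icc (by norm_num) (by norm_num)]

theorem isTile_stepTile (ha : 0 ≤ a) (hb : 0 ≤ b) (hℓ : a < ℓ) : IsTile (stepTile a b ℓ) := by
  have hcenter : ((a + ℓ) / 2, 1 / 2) ∈ interior (stepTile a b ℓ) := by
    refine interior_maximal (s := stepTile a b ℓ) (t := Set.Ioo a ℓ ×ˢ Set.Ioo 0 1) ?_
      (isOpen_Ioo.prod isOpen_Ioo) ⟨⟨by linarith, by linarith⟩, by norm_num⟩
    rintro p ⟨⟨h₁, h₂⟩, h₃, h₄⟩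
    rcases le_total p.2 (1 / 2) with h | h
    · exact .inl ⟨⟨by linarith, h₃.le⟩, h₂.le, h⟩
    · exact .inr ⟨⟨h₁.le, h⟩, by linarith, h₄.le⟩
  have hstar : StarConvex ℝ ((a + ℓ) / 2, 1 / 2) (stepTile a b ℓ) := by
    refine ((convex_Icc _ _).starConvex ?_).union ((convex_Icc _ _).starConvex ?_) <;>
      constructor <;> constructor <;> norm_num <;> linarith
  refine ⟨⟨_, ?_, stepTile_eq_biUnion_Icc a b ℓ⟩, ?_, ?_⟩
  · simp only [Finset.mem_insert, Finset.mem_singleton, forall_eq_or_imp, forall_eq]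
    norm_num
    constructor <;> linarith
  · have : ContractibleSpace (stepTile a b ℓ) :=
      hstar.contractibleSpace ⟨_, interior_subset hcenter⟩
    exact SimplyConnectedSpace.ofContractible _
  · exact ((starConvex_interior hstar hcenter).isPathConnected hcenter).isConnected

end StepTile

section EdgeTiles

variable {Q E : Type*} {src dst : E → Q} {len : E → ℝ} {fin : Q} {off : Q → ℝ}

/-- The shift `off q` encodes the vertex `q` in the left and right sides of the tiles. -/
structure IsOffset (len : E → ℝ) (fin : Q) (off : Q → ℝ) : Prop where
  injective : Function.Injective off
  fin_eq_zero : off fin = 0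
  nonneg : ∀ q, 0 ≤ off q
  lt_len : ∀ q e, off q < len e

theorem exists_isOffset [Finite Q] [Finite E] (hlen : ∀ e, 0 < len e) (fin : Q) :
    ∃ off, IsOffset len fin off := by
  classical
  obtain ⟨δ, hδlen, hδ⟩ := ((eventually_all.mpr fun e =>
    nhdsWithin_le_nhds (eventually_lt_nhds (hlen e))).and
    (self_mem_nhdsWithin : ∀ᶠ δ in 𝓝[>] (0 : ℝ), 0 < δ)).exists
  have := Set.Ico.infinite hδ
  let shift : Q ↪ Set.Ico 0 δ := ((Finite.equivFin Q).toEmbedding.trans Fin.valEmbedding).trans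
    (Infinite.natEmbedding _) |>.setValue fin ⟨0, le_rfl, hδ⟩
  exact ⟨fun q => shift q, Subtype.val_injective.comp shift.injective,
    congrArg Subtype.val (Function.Embedding.setValue_eq _ fin _),
    fun q => (shift q).2.1, fun q e => (shift q).2.2.trans (hδlen e)⟩

/-- The tile of the edge `e`. -/
def edgeTile (src dst : E → Q) (len : E → ℝ) (off : Q → ℝ) (e : E) : Set (ℝ × ℝ) :=
  stepTile (off (src e)) (off (dst e)) (len e)

theorem IsOffset.injective_germs_edgeTile (h : IsOffset len fin off)
    (hinj : Function.Injective fun e => (src e, dst e)) :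
    Function.Injective fun e => germs (edgeTile src dst len off e) := fun e _ he =>
  have ⟨hsrc, hdst⟩ := eq_of_germs_stepTile_eq (h.lt_len _ e) (h.nonneg _)
    ((h.nonneg _).trans_lt (h.lt_len (src e) e)) he
  hinj (Prod.ext (h.injective hsrc) (h.injective hdst))

theorem IsOffset.isWalkCount_remCount [Fintype E] (h : IsOffset len fin off)
    (hinj : Function.Injective fun e => (src e, dst e)) :
    IsWalkCount src dst len fin fun q L =>
      remCount (Set.range fun e => germs (edgeTile src dst len off e)) (stepRegion (off q)) L := by
  classical
  have hlen e : 0 < len e := (h.nonneg fin).trans_lt (h.lt_len fin e)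
  have hanchored e : IsAnchored (germs (edgeTile src dst len off e)) :=
    isAnchored_germs_stepTile (hlen e)
  have hregion q : stepRegion (off q) = halfStrip 0 ↔ q = fin := by
    rw [← stepRegion_zero, stepRegion_injective.eq_iff, ← h.fin_eq_zero, h.injective.eq_iff]
  refine isWalkCount_of_first_edge hlen
    (fun q L hL => remCount_of_neg _ (isAnchored_stepRegion _) hL) fun q L _ => ?_
  have hrec := remCount_eq_sum (Finset.univ.image fun e => germs (edgeTile src dst len off e))
    (by simpa using hanchored) (isAnchored_stepRegion (off q)) L
  rw [Finset.sum_image (h.injective_germs_edgeTile hinj).injOn] at hrec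
  simp only [Finset.coe_image, Finset.coe_univ, Set.image_univ, hregion] at hrec
  rw [hrec]
  congr 1
  refine Finset.sum_congr rfl fun e _ => ?_
  by_cases he : src e = q
  · subst he
    have hdiff : stepRegion (off (src e)) \ germs (edgeTile src dst len off e) =
        translate (len e, 0) (stepRegion (off (dst e))) :=
      stepRegion_diff_germs_stepTile (h.lt_len _ e).le (h.nonneg _) (hlen e).le
    have hsub : germs (edgeTile src dst len off e) ⊆ stepRegion (off (src e)) :=
      germs_stepTile_subset_stepRegion
    rw [if_pos hsub, if_pos rfl, hdiff]
    simpa using remCount_translate (Set.range fun e => germs (edgeTile src dst len off e))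
      (stepRegion (off (dst e))) (len e) (L - len e)
  · rw [if_neg he]
    split_ifs with hsub
    · refine remCount_stepRegion_diff_eq_zero (by simpa using hanchored) ?_ (h.lt_len _ e)
        (h.nonneg _) (h.injective.ne he) hsub L
      rintro _ ⟨e', rfl⟩ p hp
      exact (stepSide_nonneg (h.nonneg _) _).trans (mem_germs_stepTile.mp hp).2.1
    · rfl

theorem IsWalkCount.of_subdivision {A : Type*} [AddCommMonoidWithOne A] [Fintype E]
    {N : Q ⊕ E → ℝ → A}
    (hN : IsWalkCount (Sum.map src id) (Sum.elim Sum.inr (Sum.inl ∘ dst))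
      (Sum.elim (len · / 2) (len · / 2)) (.inl fin) N) :
    IsWalkCount src dst len fin fun q => N (.inl q) where
  len_pos e := by simpa using hN.len_pos (.inl e)
  nonneg_of_ne_zero q := hN.nonneg_of_ne_zero (.inl q)
  first_edge q L := by
    classical
    have hmiddle e L : N (.inr e) L = N (.inl (dst e)) (L - len e / 2) := by
      rw [hN.first_edge]
      simp
    rw [hN.first_edge]
    simp [hmiddle, sub_sub]

theorem exists_tiles [Finite Q] [Fintype E] (src dst : E → Q) (hlen : ∀ e, 0 < len e) (fin : Q) :
    ∃ T : Set (Set (ℝ × ℝ)), T.Finite ∧ (∀ τ ∈ T, IsTile τ ∧ IsTall τ) ∧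
      ∃ N : Q → ℝ → ℕ∞, IsWalkCount src dst len fin N ∧
        ∀ L, 0 ≤ L → {P | IsTiling T (rectangle L) P}.encard = N fin L := by
  let halfLen : E ⊕ E → ℝ := Sum.elim (len · / 2) (len · / 2)
  have hhalf : ∀ e, 0 < halfLen e :=
    Sum.rec (fun e => half_pos (hlen e)) fun e => half_pos (hlen e)
  obtain ⟨off, hoff⟩ := exists_isOffset hhalf (Sum.inl fin : Q ⊕ E)
  let tile := edgeTile (Sum.map src id) (Sum.elim Sum.inr (Sum.inl ∘ dst)) halfLen off
  have hinj : Function.Injective fun e : E ⊕ E =>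
      (Sum.map src id e, (Sum.elim Sum.inr (Sum.inl ∘ dst) e : Q ⊕ E)) := by
    rintro (e | e) (e' | e') h <;> simp_all
  have hheight : ∀ τ ∈ Set.range tile, Prod.snd '' τ = Set.Icc 0 1 := by
    rintro _ ⟨e, rfl⟩
    exact image_snd_stepTile (hoff.nonneg _) (hoff.lt_len _ e).le (hhalf e).le
  have htile : ∀ τ ∈ Set.range tile, IsTile τ := by
    rintro _ ⟨e, rfl⟩
    exact isTile_stepTile (hoff.nonneg _) (hoff.nonneg _) (hoff.lt_len _ e)
  refine ⟨Set.range tile, Set.finite_range _,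
    fun τ hτ => ⟨htile τ hτ, 0, by simpa using hheight τ hτ⟩,
    _, (hoff.isWalkCount_remCount hinj).of_subdivision, fun L hL => ?_⟩
  rw [encard_isTiling_eq_remCount (Set.finite_range _) (fun τ hτ => (htile τ hτ).region) hheight hL,
    ← stepRegion_zero, ← hoff.fin_eq_zero, ← Set.range_comp]
  rfl

end EdgeTiles

section ReturnEdge

variable {Q E G A : Type*} [Fintype E] [AddCommGroup G] [LinearOrder G] [IsOrderedAddMonoid G]
  [Archimedean G] [AddCommMonoidWithOne A] {src dst : E → Q} {len : E → G} {fin s : Q} {ε : G}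
  {M N : Q → G → A}

theorem IsWalkCount.exists_sub_nsmul_mem
    (hM : IsWalkCount (fun o : Option E => o.elim fin src) (fun o => o.elim s dst)
      (fun o => o.elim ε len) fin M) {V : AddSubgroup G} (hV : ∀ e, len e ∈ V) {p : Q} {L : G}
    (hL : M p L ≠ 0) : ∃ k : ℕ, L - k • ε ∈ V := by
  classical
  induction L using induction_sub_of_forall_pos _ hM.len_pos generalizing p with
  | neg L hneg => exact absurd (hM.of_neg p hneg) hL
  | step L _ ih =>
    rw [hM.first_edge] at hL
    by_cases hend : p = fin ∧ L = 0
    · exact ⟨0, by simp [hend.2]⟩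
    rw [if_neg hend, zero_add] at hL
    obtain ⟨o, -, ho⟩ := Finset.exists_ne_zero_of_sum_ne_zero hL
    obtain ⟨k, hk⟩ := ih o fun h => ho (by rw [h, ite_self])
    cases o with
    | none =>
      refine ⟨k + 1, ?_⟩
      rwa [succ_nsmul', ← sub_sub]
    | some e =>
      refine ⟨k, ?_⟩
      rw [sub_right_comm] at hk
      simpa using V.add_mem hk (hV e)

theorem IsWalkCount.eq_of_return_edge
    (hM : IsWalkCount (fun o : Option E => o.elim fin src) (fun o => o.elim s dst)
      (fun o => o.elim ε len) fin M) (hN : IsWalkCount src dst len fin N)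
    {V : AddSubgroup G} (hV : ∀ e, len e ∈ V) (hε : ∀ k : ℕ, (k + 1) • ε ∉ V) {L : G}
    (hL : L ∈ V) (p : Q) : M p L = N p L := by
  classical
  induction L using induction_sub_of_forall_pos _ hN.len_pos generalizing p with
  | neg L hneg => rw [hM.of_neg p hneg, hN.of_neg p hneg]
  | step L _ ih =>
    have hreturn : M s (L - ε) = 0 := by
      by_contra hne
      obtain ⟨k, hk⟩ := hM.exists_sub_nsmul_mem hV hne
      rw [sub_sub, ← succ_nsmul'] at hk
      exact hε k (by simpa using V.sub_mem hL hk)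
    have hedge e : M (dst e) (L - len e) = N (dst e) (L - len e) :=
      ih e (V.sub_mem hL (hV e)) (dst e)
    rw [hM.first_edge, hN.first_edge, Fintype.sum_option]
    simp [hreturn, hedge]

end ReturnEdge

theorem IsWalkCount.add_return_edge {Q E G A : Type*} [Fintype E] [AddCommGroup G]
    [PartialOrder G] [AddCommMonoidWithOne A] {src dst : E → Q} {len : E → G} {fin s : Q} {ε : G}
    {M : Q → G → A}
    (hM : IsWalkCount (fun o : Option E => o.elim fin src) (fun o => o.elim s dst)
      (fun o => o.elim ε len) fin M) (hfin : ∀ e, src e ≠ fin) {L : G} (hL : L + ε ≠ 0) :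
    M fin (L + ε) = M s L := by
  rw [hM.first_edge, Fintype.sum_option]
  simp [hL, hfin]

theorem exists_gt_notMem_span {S : Set ℝ} (hS : S.Countable) (B : ℝ) :
    ∃ ε > B, ε ∉ Submodule.span ℚ S := by
  have := hS.to_subtype
  have hspan : (Submodule.span ℚ S : Set ℝ).Countable := by
    rw [Finsupp.span_eq_range_linearCombination]
    exact Set.countable_range _
  obtain ⟨ε, hε, hB⟩ := (hspan.dense_compl ℝ).exists_gt B
  exact ⟨ε, hB, hε⟩

theorem IsWalkCount.map {Q E G A B : Type*} [Fintype E] [AddCommGroup G] [PartialOrder G]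
    [NonAssocSemiring A] [NonAssocSemiring B] {src dst : E → Q} {len : E → G} {fin : Q}
    {N : Q → G → A} (hN : IsWalkCount src dst len fin N) (φ : A →+* B) :
    IsWalkCount src dst len fin fun p L => φ (N p L) where
  len_pos := hN.len_pos
  nonneg_of_ne_zero p L h := hN.nonneg_of_ne_zero p L fun h0 => h (by rw [h0, map_zero])
  first_edge p L := by
    rw [hN.first_edge]
    simp only [map_add, map_sum, apply_ite φ, map_one, map_zero]

/-- An edge of a length `ε` outside the rational span of all other lengths turns the walks from `s`
to `fin` of length `n + η` into closed walks at `fin` of length `n + η + ε`. -/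
theorem mem_tileCountingFunctions_of_isWalkSequence {f : ℕ → ℕ}
    (hf : IsWalkSequence fun n => (f n : ℝ≥0∞)) : f ∈ tileCountingFunctions := by
  obtain ⟨_, ⟨Q, E, _, _, src, dst, len, fin, N, s, hN, hfin, rfl⟩, η, hη⟩ := hf
  obtain ⟨ε, hεη, hε⟩ :=
    exists_gt_notMem_span ((Set.finite_range len).insert η |>.insert 1).countable (max 0 (-η))
  let V := Submodule.span ℚ (insert 1 (insert η (Set.range len)))
  have hlenV e : len e ∈ V := Submodule.subset_span (by simp)
  have hηV (n : ℕ) : n + η ∈ V := by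
    have h1 : (1 : ℝ) ∈ V := Submodule.subset_span (by simp)
    simpa using V.add_mem (V.nsmul_mem h1 n) (Submodule.subset_span (by simp) : η ∈ V)
  have hεV (k : ℕ) : (k + 1) • ε ∉ V := by
    rw [← Nat.cast_smul_eq_nsmul ℚ, V.smul_mem_iff (by positivity)]
    exact hε
  obtain ⟨hε0, hηε⟩ := max_lt_iff.mp hεη
  obtain ⟨T, hT, htile, M, hM, hcount⟩ := exists_tiles (fun o : Option E => o.elim fin src)
    (fun o => o.elim s dst) (len := fun o => o.elim ε len) (Option.rec hε0 hN.len_pos) fin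
  refine ⟨T, η + ε, hT, htile, by linarith, fun n => ?_⟩
  have hpos : 0 < n + η + ε := by linarith [n.cast_nonneg (α := ℝ)]
  have hMf : (M s (n + η) : ℝ≥0∞) = f n :=
    ((hM.map ENat.toENNRealRingHom).eq_of_return_edge hN (V := V.toAddSubgroup) hlenV hεV
      (hηV n) s).trans (hη n).symm
  rw [← add_assoc, hcount _ hpos.le, hM.add_return_edge hfin hpos.ne']
  exact_mod_cast hMf

theorem binomialMultisums_subset_tileCountingFunctions :
    binomialMultisums ⊆ tileCountingFunctions := fun _ hf =>
  mem_tileCountingFunctions_of_isWalkSequence (isWalkSequence_of_mem_binomialMultisums hf)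

theorem tileCountingFunctions_eq_diagonals : tileCountingFunctions = diagonals :=
  tileCountingFunctions_subset_diagonals.antisymm
    (diagonals_subset_binomialMultisums.trans binomialMultisums_subset_tileCountingFunctions)

theorem diagonals_eq_binomialMultisums : diagonals = binomialMultisums :=
  diagonals_subset_binomialMultisums.antisymm
    (binomialMultisums_subset_tileCountingFunctions.trans tileCountingFunctions_subset_diagonals)

theorem closedUnderAddMul_binomialMultisums : ClosedUnderAddMul binomialMultisums := by
  refine fun f hf g hg => ⟨?_, ?_⟩
  · rw [← diagonals_eq_binomialMultisums, ← tileCountingFunctions_eq_diagonals]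
    refine mem_tileCountingFunctions_of_isWalkSequence ?_
    simpa using (isWalkSequence_of_mem_binomialMultisums hf).add
      (isWalkSequence_of_mem_binomialMultisums hg)
  · rw [← diagonals_eq_binomialMultisums] at hf hg
    exact mul_mem_binomialMultisums hf hg

end IrrationalTiling

theorem corollaryc :
    IrrationalTiling.tileCountingFunctions = IrrationalTiling.diagonals ∧
    IrrationalTiling.diagonals = IrrationalTiling.binomialMultisums ∧
    IrrationalTiling.ClosedUnderAddMul IrrationalTiling.tileCountingFunctions ∧
    IrrationalTiling.ClosedUnderAddMul IrrationalTiling.diagonals ∧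
    IrrationalTiling.ClosedUnderAddMul IrrationalTiling.binomialMultisums := by
  have h := IrrationalTiling.closedUnderAddMul_binomialMultisums
  have h₁ := IrrationalTiling.tileCountingFunctions_eq_diagonals
  have h₂ := IrrationalTiling.diagonals_eq_binomialMultisums
  exact ⟨h₁, h₂, by rwa [h₁, h₂], by rwa [h₂], h⟩
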